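/- Consider systems of two conservation laws up to order $\epsilon^2$, $$u^i_t=\partial_x\Big[A^i+\epsilon\sum_j B^i_j u^j_x+\epsilon^2\Big(\sum_j C^i_j u^j_{xx}+\sum_{j,k}D^i_{jk}u^j_xu^k_x\Big)\Big],\qquad (u^1,u^2)=(u,v),$$ with coefficients depending on $(u,v)$, all functions being of class $C^\infty$ (respectively, all functions being real analytic) near a given point $(u_0,v_0)$ with $u_0\neq 0$. Such a system is called integrable up to order $\epsilon^2$ near $(u_0,v_0)$ if its dispersionless limit $u^i_t=\partial_xA^i$ has Riemann invariants with distinct characteristic velocities there and every symmetry (commuting flow) $u^i_\tau=\partial_x S^i(u,v)$ of the dispersionless limit, defined near $(u_0,v_0)$, extends to a system of conservation laws of the above form, with $S^i$ in place of $A^i$, which commutes with the given system up to terms of order $\epsilon^3$. **Theorem.** (1) Every system as above whose dispersionless limit is the $(2,1)$ flow of $B_2$ with $c=-1$, $$u_t=\partial_x\big[uv+\tfrac13u^3\big],\qquad v_t=\partial_x\big[\tfrac12 v^2\big],$$ and which is integrable up to order $\epsilon^2$ near $(u_0,v_0)$, can be reduced near $(u_0,v_0)$, up to terms of order $\epsilon^3$,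 by a Miura transformation $w^i=u^i+\partial_x\big(\epsilon M^i(u,v)+\epsilon^2\sum_j\beta^i_j(u,v)u^j_x\big)$ to the form $$u_t=\partial_x\big[uv+\tfrac13u^3+\epsilon^2(a_{16}v_x^2+a_{17}u_xv_x)\big],$$ $$v_t=\partial_x\big[\tfrac12v^2+\epsilon(uf\,u_x+f\,v_x)+\epsilon^2(g\,u_{xx}+h\,v_{xx}+a_{25}u_x^2+a_{26}v_x^2+a_{26}\,u\,u_xv_x)\big],$$ where $$a_{16}=-g_{vv}+\frac{2f_v^2+h_v+2ff_{vv}}{2u}-\frac92\frac{g_v}{u^2}+\frac{2ff_v+h}{u^3}-\frac{g}{u^4}+\frac23\frac{f^2}{u^5},$$ $$a_{17}=ff_{vv}-ug_{vv}+f_v^2-\frac{4g_v}{u}+\frac{2ff_v}{u^2}+\frac23\frac{f^2}{u^4},$$ $$a_{25}=ug_v-ff_v+\frac{3g}{u}-\frac16\frac{f^2}{u^2},$$ $$a_{26}=ug_{vv}-ff_{vv}-f_v^2+\frac{6g_v}{u}-\frac{11}{3}\frac{ff_v}{u^2}+\frac{3g}{u^3}-\frac43\frac{f^2}{u^4},$$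 and $$f=F\big(\tfrac12u^2+v\big)u,\qquad g=G\big(\tfrac12u^2+v\big)u^3+\frac{f^2}{3u},\qquad h=\frac gu+H(v)$$ for some functions $F,G$ of one variable near $\tfrac12u_0^2+v_0$ and $H$ near $v_0$. (2) Conversely, $F,G,H$ are arbitrary: for all such functions $F,G,H$ the above system is integrable up to order $\epsilon^2$ near $(u_0,v_0)$. -/

import Mathlib

open Filter Asymptotics
open scoped Topology ContDiff

noncomputable section

namespace B2Deformation

/-! ### Jets, total derivative, evolutionary derivatives

The field variables are `u = u⁰` and `v = u¹`. A point `z` of the infinite jet space has the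
coordinates `z s i = ∂ₓˢ uⁱ`. All functions of jets that occur below depend on finitely many
coordinates only and are smooth in them. -/

/-- Infinite jets of two functions of `x`: `z s i` stands for `∂ₓˢ uⁱ`. -/
abbrev Jet : Type := ℕ → Fin 2 → ℝ

/-- The point `(u, v)` over which a jet lies. -/
def Jet.base (z : Jet) : ℝ × ℝ := (z 0 0, z 0 1)

/-- The total derivative `∂ₓ = ∑ₛ u^k_{(s+1)} ∂/∂u^k_{(s)}`: the derivative of `a` along the vector
whose `∂/∂u^k_{(s)}`-component is `u^k_{(s+1)}`. -/
def Dx (a : Jet → ℝ) : Jet → ℝ :=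
  fun z => lineDeriv ℝ a z (fun s => z (s + 1))

/-- The derivative `∑ₛ (∂ₓˢ X^k) ∂a/∂u^k_{(s)}` of `a` along the evolutionary system
`u^k_t = X^k`, that is, the time derivative of `a` on its solutions. -/
def evol (X : Fin 2 → Jet → ℝ) (a : Jet → ℝ) : Jet → ℝ :=
  fun z => lineDeriv ℝ a z (fun s i => Dx^[s] (X i) z)

/-! ### Systems of conservation laws up to order `ε²` -/

/-- A system of two conservation laws up to order `ε²`,
`uⁱ_t = ∂ₓ[Aⁱ + ε ∑ⱼ Bⁱⱼ uʲ_x + ε² (∑ⱼ Cⁱⱼ uʲ_xx + ∑ⱼₖ Dⁱⱼₖ uʲ_x uᵏ_x)]`,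
with coefficients that are functions of `(u, v)`. -/
structure ConsSystem where
  /-- the fluxes of the dispersionless limit -/
  A : Fin 2 → ℝ × ℝ → ℝ
  /-- the coefficients of the first order part -/
  B : Fin 2 → Fin 2 → ℝ × ℝ → ℝ
  /-- the coefficients of the second derivatives in the second order part -/
  C : Fin 2 → Fin 2 → ℝ × ℝ → ℝ
  /-- the coefficients of the products of first derivatives in the second order part -/
  D : Fin 2 → Fin 2 → Fin 2 → ℝ × ℝ → ℝ

/-- `a` is of class `C^k` in a neighbourhood of `x₀`. -/
def NearCk {E : Type*} [NormedAddCommGroup E] [NormedSpace ℝ E]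
    (k : WithTop ℕ∞) (x₀ : E) (a : E → ℝ) : Prop :=
  ∀ᶠ x in 𝓝 x₀, ContDiffAt ℝ k a x

namespace ConsSystem

/-- All coefficients are of class `C^k` near `p₀`. -/
def NearCk (k : WithTop ℕ∞) (p₀ : ℝ × ℝ) (X : ConsSystem) : Prop :=
  (∀ i, B2Deformation.NearCk k p₀ (X.A i)) ∧
  (∀ i j, B2Deformation.NearCk k p₀ (X.B i j)) ∧
  (∀ i j, B2Deformation.NearCk k p₀ (X.C i j)) ∧
  (∀ i j l, B2Deformation.NearCk k p₀ (X.D i j l))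

/-- The flux `αⁱ` of the system `uⁱ_t = ∂ₓ αⁱ`. -/
def flux (X : ConsSystem) (ε : ℝ) (i : Fin 2) : Jet → ℝ := fun z =>
  X.A i z.base + ε * ∑ j, X.B i j z.base * z 1 j
    + ε ^ 2 * (∑ j, X.C i j z.base * z 2 j + ∑ j, ∑ l, X.D i j l z.base * z 1 j * z 1 l)

/-- The right-hand side `∂ₓ αⁱ`. -/
def field (X : ConsSystem) (ε : ℝ) (i : Fin 2) : Jet → ℝ := Dx (X.flux ε i)

/-- The system without any `ε`-corrections and with fluxes `A`. -/
def dispersionless (A : Fin 2 → ℝ × ℝ → ℝ) : ConsSystem :=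
  ⟨A, fun _ _ _ => 0, fun _ _ _ => 0, fun _ _ _ _ => 0⟩

/-- For `uⁱ_t = ∂ₓ αⁱ` and `uⁱ_τ = ∂ₓ βⁱ`, the bracket
`{α, β}ⁱ = ∑ (∂ₓˢ⁺¹ βᵏ) ∂αⁱ/∂uᵏ_{(s)} - (∂ₓˢ⁺¹ αᵏ) ∂βⁱ/∂uᵏ_{(s)}`. Its total derivative is
`uⁱ_{tτ} - uⁱ_{τt}`, so that the two flows commute exactly when the bracket vanishes. -/
def bracket (X Y : ConsSystem) (ε : ℝ) (i : Fin 2) : Jet → ℝ := fun z =>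
  evol (Y.field ε) (X.flux ε i) z - evol (X.field ε) (Y.flux ε i) z

/-- The dispersionless limits of the two systems commute near `p₀`. -/
def CommuteDispersionless (p₀ : ℝ × ℝ) (A A' : Fin 2 → ℝ × ℝ → ℝ) : Prop :=
  ∀ᶠ p in 𝓝 p₀, ∀ z : Jet, z.base = p → ∀ i,
    bracket (dispersionless A) (dispersionless A') 0 i z = 0

/-- The two systems commute near `p₀` up to the order `ε²`. -/
def CommuteUpToTwo (p₀ : ℝ × ℝ) (X Y : ConsSystem) : Prop :=
  ∀ᶠ p in 𝓝 p₀, ∀ z : Jet, z.base = p → ∀ i,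
    (fun ε : ℝ => bracket X Y ε i z) =O[𝓝 0] fun ε : ℝ => ε ^ 3

/-- The dispersionless system `uⁱ_t = ∂ₓ Aⁱ` has Riemann invariants `r⁰, r¹` near `p₀`: local
coordinates in which it takes the diagonal form `rⁱ_t = cⁱ rⁱ_x`, with different characteristic
velocities. (Tsarev's semi-Hamiltonian condition involves three different indices, and so is void
for two components.) -/
def HasRiemannInvariants (k : WithTop ℕ∞) (p₀ : ℝ × ℝ) (A : Fin 2 → ℝ × ℝ → ℝ) : Prop :=
  ∃ r c : Fin 2 → ℝ × ℝ → ℝ,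
    (∀ i, B2Deformation.NearCk k p₀ (r i)) ∧ (∀ i, B2Deformation.NearCk k p₀ (c i)) ∧
    ∀ᶠ p in 𝓝 p₀,
      LinearIndependent ℝ (fun i => fderiv ℝ (r i) p) ∧ c 0 p ≠ c 1 p ∧
      ∀ i, ∀ w : ℝ × ℝ,
        fderiv ℝ (r i) p (fderiv ℝ (A 0) p w, fderiv ℝ (A 1) p w) = c i p * fderiv ℝ (r i) p w

/-- Integrability up to the order `ε²` near `p₀`: the dispersionless limit is integrable, and
every symmetry `uⁱ_τ = ∂ₓ Sⁱ` of the dispersionless limit extends to a system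
of conservation laws that commutes with the full system up to the order `ε²`. -/
def IntegrableUpToTwo (k : WithTop ℕ∞) (p₀ : ℝ × ℝ) (X : ConsSystem) : Prop :=
  HasRiemannInvariants k p₀ X.A ∧
  ∀ S : Fin 2 → ℝ × ℝ → ℝ, (∀ i, B2Deformation.NearCk k p₀ (S i)) →
    CommuteDispersionless p₀ X.A S →
      ∃ Y : ConsSystem, Y.NearCk k p₀ ∧ Y.A = S ∧ CommuteUpToTwo p₀ X Y

end ConsSystem

/-! ### Miura transformations -/

/-- The differential polynomial `Φⁱ = ε Mⁱ + ε² ∑ⱼ βⁱⱼ uʲ_x`. -/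
def miuraPotential (M : Fin 2 → ℝ × ℝ → ℝ) (β : Fin 2 → Fin 2 → ℝ × ℝ → ℝ)
    (ε : ℝ) (i : Fin 2) : Jet → ℝ := fun z =>
  ε * M i z.base + ε ^ 2 * ∑ j, β i j z.base * z 1 j

/-- The jet of `wⁱ = uⁱ + ∂ₓ Φⁱ`, as a function of the jet of `u`. -/
def miuraJet (Φ : Fin 2 → Jet → ℝ) (z : Jet) : Jet :=
  fun s i => z s i + Dx^[s + 1] (Φ i) z

/-- Near `p₀` and up to the order `ε²`, a Miura transformation
`wⁱ = uⁱ + ∂ₓ Φⁱ`, `Φⁱ = ε Mⁱ + ε² ∑ⱼ βⁱⱼ uʲ_x`, takes the system `X` to the system `N`.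
If `uⁱ_t = ∂ₓ αⁱ`, then `wⁱ_t = ∂ₓ (αⁱ + Φⁱ_t)`, and this flux has to be the flux of `N`,
evaluated at the jet of `w`, up to terms of order `ε³`. -/
def ReducesTo (k : WithTop ℕ∞) (p₀ : ℝ × ℝ) (X N : ConsSystem) : Prop :=
  ∃ (M : Fin 2 → ℝ × ℝ → ℝ) (β : Fin 2 → Fin 2 → ℝ × ℝ → ℝ),
    (∀ i, NearCk k p₀ (M i)) ∧ (∀ i j, NearCk k p₀ (β i j)) ∧
    ∀ᶠ p in 𝓝 p₀, ∀ z : Jet, z.base = p → ∀ i,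
      (fun ε : ℝ =>
        N.flux ε i (miuraJet (miuraPotential M β ε) z) -
          (X.flux ε i z + evol (X.field ε) (miuraPotential M β ε i) z))
        =O[𝓝 0] fun ε : ℝ => ε ^ 3

/-! ### The `(2,1)` flow of `B₂` for `c = -1` and the normal form of its deformations -/

/-- The fluxes `uv + u³/3` and `v²/2`. -/
def fluxB2 : Fin 2 → ℝ × ℝ → ℝ :=
  ![fun p => p.1 * p.2 + p.1 ^ 3 / 3, fun p => p.2 ^ 2 / 2]

/-- The partial derivative `∂a/∂v`. -/
def dv (a : ℝ × ℝ → ℝ) : ℝ × ℝ → ℝ := fun p => deriv (fun t => a (p.1, t)) p.2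

/-- `f = F(u²/2 + v) u` -/
def nfF (F : ℝ → ℝ) : ℝ × ℝ → ℝ := fun p => F (p.1 ^ 2 / 2 + p.2) * p.1

/-- `g = G(u²/2 + v) u³ + f²/(3u)` -/
def nfG (F G : ℝ → ℝ) : ℝ × ℝ → ℝ := fun p =>
  G (p.1 ^ 2 / 2 + p.2) * p.1 ^ 3 + nfF F p ^ 2 / (3 * p.1)

/-- `h = g/u + H(v)` -/
def nfH (F G H : ℝ → ℝ) : ℝ × ℝ → ℝ := fun p => nfG F G p / p.1 + H p.2

/-- The coefficient `a₁₆`. -/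
def a16 (f g h : ℝ × ℝ → ℝ) : ℝ × ℝ → ℝ := fun p =>
  -dv (dv g) p + (2 * dv f p ^ 2 + dv h p + 2 * f p * dv (dv f) p) / (2 * p.1)
    - 9 / 2 * (dv g p / p.1 ^ 2) + (2 * f p * dv f p + h p) / p.1 ^ 3
    - g p / p.1 ^ 4 + 2 / 3 * (f p ^ 2 / p.1 ^ 5)

/-- The coefficient `a₁₇`. -/
def a17 (f g : ℝ × ℝ → ℝ) : ℝ × ℝ → ℝ := fun p =>
  f p * dv (dv f) p - p.1 * dv (dv g) p + dv f p ^ 2 - 4 * dv g p / p.1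
    + 2 * f p * dv f p / p.1 ^ 2 + 2 / 3 * (f p ^ 2 / p.1 ^ 4)

/-- The coefficient `a₂₅`. -/
def a25 (f g : ℝ × ℝ → ℝ) : ℝ × ℝ → ℝ := fun p =>
  p.1 * dv g p - f p * dv f p + 3 * g p / p.1 - 1 / 6 * (f p ^ 2 / p.1 ^ 2)

/-- The coefficient `a₂₆`. -/
def a26 (f g : ℝ × ℝ → ℝ) : ℝ × ℝ → ℝ := fun p =>
  p.1 * dv (dv g) p - f p * dv (dv f) p - dv f p ^ 2 + 6 * dv g p / p.1
    - 11 / 3 * (f p * dv f p / p.1 ^ 2) + 3 * g p / p.1 ^ 3 - 4 / 3 * (f p ^ 2 / p.1 ^ 4)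

/-- The system
`u_t = ∂ₓ[uv + u³/3 + ε² (a₁₆ v_x² + a₁₇ u_x v_x)]`,
`v_t = ∂ₓ[v²/2 + ε (u f u_x + f v_x)
          + ε² (g u_xx + h v_xx + a₂₅ u_x² + a₂₆ v_x² + a₂₆ u u_x v_x)]`. -/
def normalFormOf (f g h : ℝ × ℝ → ℝ) : ConsSystem where
  A := fluxB2
  B := ![![fun _ => 0, fun _ => 0], ![fun p => p.1 * f p, f]]
  C := ![![fun _ => 0, fun _ => 0], ![g, h]]
  D := ![![![fun _ => 0, a17 f g], ![fun _ => 0, a16 f g h]],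
         ![![a25 f g, fun p => a26 f g p * p.1], ![fun _ => 0, a26 f g]]]

/-- The normal form with the functional parameters `F`, `G`, `H`. -/
def normalForm (F G H : ℝ → ℝ) : ConsSystem :=
  normalFormOf (nfF F) (nfG F G) (nfH F G H)

end B2Deformation

end

/-! A flux α generates the evolutionary derivation `der (along α)`. The commutator of the
derivations of two fluxes is the derivation of their bracket (`der_along_comm`), so the bracket
obeys the Jacobi identity (`br_jacobi`). It is compatible with counting x-derivatives, and
commutation modulo ε³ splits into three homogeneous equations, at the orders 1, ε and ε²
(`fluxEq_of_isBigO`).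

A Miura transformation is, up to ε², the time-one flow of the flux εM + ε²γ; this means β = γ + ½
M', where M' is the derivative of M along its own flow. Under it fluxes change by exp(ad(εM + ε²γ)),
truncated after ε² (`transport₁`, `transport₂`, `isBigO_of_transport`). By Jacobi a commuting pair
goes to a commuting pair (`commute_transport₁`, `commute_transport₂`), so a system and its symmetry
may be normalized together.

The dispersionless flow has the Riemann invariants u²/2 + v and v, with speeds v + u² and v. Its
symmetries have the fluxes (s, ψ(v)) with s_u = u s_v + ψ'(v) (`exists_isSymmetry`).

Reduction. The single symmetry (u²/2 + v, 0) is enough. The two functions M impose two conditions on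
the first order part (`exists_firstNormal`), the four functions γ impose four on the second order
part (`exists_secondNormal`). At order ε, commutation then gives B₀₁ = 0 and (∂_u - u∂_v)(B₁₀/u²) =
0, hence B₁₀ = F(u²/2 + v) u² (`first_order`). At order ε², ∂_u - u∂_v annihilates g/u³ - F²/(3u²),
which yields G (`SecondRelations.g_equation`), and ∂_u annihilates h - F²/3 - Gu², which yields H
(`SecondRelations.h_equation`). The other coefficients follow by linear elimination
(`SecondRelations.sysD_eq`).

Converse. For arbitrary (s, ψ) the extension is written down explicitly (`symB`, `symC`, `symD`).
The relation s_u = u s_v + ψ' removes all u-derivatives of s, so commutation becomes a list of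
rational identities in u, v, the derivatives of F, G, H, ψ and the v-derivatives of s, all treated
as independent. The type `Ex` carries this reduction out.

The distinction between smooth and analytic functions matters only for solving ∂_u K = h within the
class (`exists_pd_zero_eq`); the equation along ∂_u - u∂_v is reduced to it by the coordinates (u,
u²/2 + v). -/

noncomputable section

namespace B2Deformation

/-! ### Partial derivatives -/

/-- The partial derivatives `∂a/∂u` (for `j = 0`) and `∂a/∂v` (for `j = 1`). -/
def pd (j : Fin 2) (a : ℝ × ℝ → ℝ) : ℝ × ℝ → ℝ :=
  fun p => fderiv ℝ a p ((![(1, 0), (0, 1)] : Fin 2 → ℝ × ℝ) j)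

/-- `a` is of class `C^k` at every point of `U`. -/
def CkOn (k : WithTop ℕ∞) (U : Set (ℝ × ℝ)) (a : ℝ × ℝ → ℝ) : Prop :=
  ∀ p ∈ U, ContDiffAt ℝ k a p

lemma fderiv_eq_pd (a : ℝ × ℝ → ℝ) (p w : ℝ × ℝ) :
    fderiv ℝ a p w = pd 0 a p * w.1 + pd 1 a p * w.2 := by
  have : w = w.1 • ((1 : ℝ), (0 : ℝ)) + w.2 • ((0 : ℝ), (1 : ℝ)) := by ext <;> simp
  rw [this, map_add, map_smul, map_smul]
  simp [pd, mul_comm]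

lemma ContDiffAt.pd {k m : WithTop ℕ∞} {a : ℝ × ℝ → ℝ} {p : ℝ × ℝ} (h : ContDiffAt ℝ k a p)
    (hmk : m + 1 ≤ k) (j : Fin 2) : ContDiffAt ℝ m (pd j a) p :=
  (h.fderiv_right hmk).clm_apply contDiffAt_const

lemma CkOn.pd {k m : WithTop ℕ∞} {a : ℝ × ℝ → ℝ} {U : Set (ℝ × ℝ)} (h : CkOn k U a)
    (hmk : m + 1 ≤ k) (j : Fin 2) : CkOn m U (pd j a) :=
  fun p hp => ContDiffAt.pd (h p hp) hmk j

lemma pd_comm {a : ℝ × ℝ → ℝ} {p : ℝ × ℝ} (h : ContDiffAt ℝ 2 a p) (i j : Fin 2) :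
    pd i (pd j a) p = pd j (pd i a) p := by
  have hd : DifferentiableAt ℝ (fderiv ℝ a) p :=
    (h.fderiv_right (m := 1) (by norm_num)).differentiableAt (by norm_num)
  have key : ∀ i j : Fin 2, pd i (pd j a) p =
      fderiv ℝ (fderiv ℝ a) p ((![(1, 0), (0, 1)] : Fin 2 → ℝ × ℝ) i)
        ((![(1, 0), (0, 1)] : Fin 2 → ℝ × ℝ) j) := by
    intro i j
    unfold B2Deformation.pd
    rw [fderiv_clm_apply hd (differentiableAt_const _)]
    simp
  rw [key, key]
  exact (h.isSymmSndFDerivAt (by simp)).eq _ _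

lemma pd_congr {a b : ℝ × ℝ → ℝ} {p : ℝ × ℝ} (h : a =ᶠ[𝓝 p] b) (j : Fin 2) :
    pd j a =ᶠ[𝓝 p] pd j b := by
  filter_upwards [h.eventuallyEq_nhds] with q hq
  simp only [pd, hq.fderiv_eq]

lemma two_le_infty : (2 : WithTop ℕ∞) ≤ ∞ := by
  change ((2 : ℕ∞) : WithTop ℕ∞) ≤ _
  exact WithTop.coe_le_coe.2 le_top

/-! ### Differential polynomials -/

/-- The jets over `U`. -/
def jetsOver (U : Set (ℝ × ℝ)) : Set Jet := {z | z.base ∈ U}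

/-- Functions of jets which over `U` are polynomials in the `x`-derivatives whose coefficients are
smooth functions on `U`. -/
inductive IsDiffPoly (U : Set (ℝ × ℝ)) : (Jet → ℝ) → Prop
  | base {a : ℝ × ℝ → ℝ} (ha : CkOn ∞ U a) : IsDiffPoly U (fun z => a z.base)
  | coord (s : ℕ) (i : Fin 2) : IsDiffPoly U (fun z => z s i)
  | add {a b : Jet → ℝ} (ha : IsDiffPoly U a) (hb : IsDiffPoly U b) :
      IsDiffPoly U (fun z => a z + b z)
  | mul {a b : Jet → ℝ} (ha : IsDiffPoly U a) (hb : IsDiffPoly U b) :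
      IsDiffPoly U (fun z => a z * b z)
  | congr {a b : Jet → ℝ} (ha : IsDiffPoly U a) (hab : Set.EqOn a b (jetsOver U)) : IsDiffPoly U b

lemma base_line (z w : Jet) (t : ℝ) :
    (z + t • w).base = z.base + t • w.base := by
  simp [Jet.base]

lemma hasLineDerivAt_base {a : ℝ × ℝ → ℝ} {z : Jet} (h : DifferentiableAt ℝ a z.base) (w : Jet) :
    HasLineDerivAt ℝ (fun z : Jet => a z.base) (pd 0 a z.base * w 0 0 + pd 1 a z.base * w 0 1)
      z w := by
  have := h.hasFDerivAt.hasLineDerivAt w.base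
  rw [fderiv_eq_pd] at this
  simp only [HasLineDerivAt, ← base_line] at this
  exact this

lemma hasLineDerivAt_coord (s : ℕ) (i : Fin 2) (z w : Jet) :
    HasLineDerivAt ℝ (fun z : Jet => z s i) (w s i) z w := by
  unfold HasLineDerivAt
  simpa using ((hasDerivAt_id (0 : ℝ)).mul_const (w s i)).const_add (z s i)

lemma hasLineDerivAt_add {a b : Jet → ℝ} {z w : Jet} {a' b' : ℝ} (ha : HasLineDerivAt ℝ a a' z w)
    (hb : HasLineDerivAt ℝ b b' z w) : HasLineDerivAt ℝ (fun z => a z + b z) (a' + b') z w :=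
  HasDerivAt.add ha hb

lemma hasLineDerivAt_mul {a b : Jet → ℝ} {z w : Jet} {a' b' : ℝ} (ha : HasLineDerivAt ℝ a a' z w)
    (hb : HasLineDerivAt ℝ b b' z w) :
    HasLineDerivAt ℝ (fun z => a z * b z) (a' * b z + a z * b') z w := by
  have h := HasDerivAt.mul ha hb
  simp only [zero_smul, add_zero] at h
  exact h

/-- Only the two coordinates of order zero decide whether a jet lies over `U`, so openness of `U` in
the plane suffices and no topology on the jet space enters. -/
lemma eventually_over {U : Set (ℝ × ℝ)} (hU : IsOpen U) {z : Jet} (hz : z ∈ jetsOver U) (w : Jet) :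
    ∀ᶠ t in 𝓝 (0 : ℝ), z + t • w ∈ jetsOver U := by
  have : Continuous fun t : ℝ => z.base + t • w.base := by fun_prop
  have h := (this.continuousAt (x := 0)).preimage_mem_nhds
    (hU.mem_nhds (by simpa [jetsOver] using hz))
  filter_upwards [h] with t ht
  change (z + t • w).base ∈ U
  rw [base_line]
  exact ht

lemma hasLineDerivAt_congr {U : Set (ℝ × ℝ)} (hU : IsOpen U) {a b : Jet → ℝ} {z w : Jet}
    {a' : ℝ} (ha : HasLineDerivAt ℝ a a' z w) (hab : Set.EqOn a b (jetsOver U)) (hz : z ∈ jetsOver U) :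
    HasLineDerivAt ℝ b a' z w := by
  refine HasDerivAt.congr_of_eventuallyEq ha ?_
  filter_upwards [eventually_over hU hz w] with t ht
  exact (hab ht).symm

lemma lineDeriv_congr_over {U : Set (ℝ × ℝ)} (hU : IsOpen U) {a b : Jet → ℝ} {z : Jet}
    (hab : Set.EqOn a b (jetsOver U)) (hz : z ∈ jetsOver U) (w : Jet) :
    lineDeriv ℝ a z w = lineDeriv ℝ b z w := by
  unfold lineDeriv
  apply Filter.EventuallyEq.deriv_eq
  filter_upwards [eventually_over hU hz w] with t ht
  exact hab ht

variable {U : Set (ℝ × ℝ)} {a b : Jet → ℝ}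

/-- The coordinates of a jet, as linear forms. -/
def jetCoord (s : ℕ) (i : Fin 2) : Jet →ₗ[ℝ] ℝ where
  toFun z := z s i
  map_add' _ _ := rfl
  map_smul' _ _ := rfl

namespace IsDiffPoly

/-- A line derivative is in general only homogeneous in its direction. A differential polynomial is
a differentiable function of finitely many coordinates, which makes it linear; without this,
derivatives along sums of vector fields would not split. -/
lemma exists_linear (hU : IsOpen U) (ha : IsDiffPoly U a) {z : Jet} (hz : z ∈ jetsOver U) :
    ∃ l : Jet →ₗ[ℝ] ℝ, ∀ w, HasLineDerivAt ℝ a (l w) z w := by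
  induction ha with
  | @base a ha =>
    have hd := (ha _ hz).differentiableAt (by simp)
    refine ⟨pd 0 a z.base • jetCoord 0 0 + pd 1 a z.base • jetCoord 0 1, fun w => ?_⟩
    exact hasLineDerivAt_base hd w
  | coord s i =>
    exact ⟨jetCoord s i, fun w => hasLineDerivAt_coord s i z w⟩
  | add _ _ iha ihb =>
    obtain ⟨l, hl⟩ := iha
    obtain ⟨m, hm⟩ := ihb
    exact ⟨l + m, fun w => hasLineDerivAt_add (hl w) (hm w)⟩
  | @mul a b _ _ iha ihb =>
    obtain ⟨l, hl⟩ := iha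
    obtain ⟨m, hm⟩ := ihb
    refine ⟨b z • l + a z • m, fun w => ?_⟩
    convert hasLineDerivAt_mul (hl w) (hm w) using 1
    simp only [LinearMap.add_apply, LinearMap.smul_apply, smul_eq_mul]
    ring
  | congr _ hab iha =>
    obtain ⟨l, hl⟩ := iha
    exact ⟨l, fun w => hasLineDerivAt_congr hU (hl w) hab hz⟩

lemma hasLineDerivAt (hU : IsOpen U) (ha : IsDiffPoly U a) {z : Jet} (hz : z ∈ jetsOver U) (w : Jet) :
    HasLineDerivAt ℝ a (lineDeriv ℝ a z w) z w := by
  obtain ⟨l, hl⟩ := ha.exists_linear hU hz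
  rw [(hl w).lineDeriv]
  exact hl w

lemma lineDeriv_add_right (hU : IsOpen U) (ha : IsDiffPoly U a) {z : Jet} (hz : z ∈ jetsOver U)
    (v w : Jet) : lineDeriv ℝ a z (v + w) = lineDeriv ℝ a z v + lineDeriv ℝ a z w := by
  obtain ⟨l, hl⟩ := ha.exists_linear hU hz
  rw [(hl v).lineDeriv, (hl w).lineDeriv, (hl _).lineDeriv, map_add]

lemma const (c : ℝ) : IsDiffPoly U (fun _ => c) :=
  base (U := U) (a := fun _ => c) (fun _ _ => contDiffAt_const)

lemma smul (c : ℝ) (ha : IsDiffPoly U a) : IsDiffPoly U (fun z => c * a z) :=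
  (const c).mul ha

lemma neg (ha : IsDiffPoly U a) : IsDiffPoly U (fun z => - a z) :=
  (ha.smul (-1)).congr fun z _ => by simp

lemma sub (ha : IsDiffPoly U a) (hb : IsDiffPoly U b) : IsDiffPoly U (fun z => a z - b z) :=
  (ha.add hb.neg).congr fun z _ => by simp [sub_eq_add_neg]

lemma sum {ι : Type*} (s : Finset ι) {f : ι → Jet → ℝ} (hf : ∀ i ∈ s, IsDiffPoly U (f i)) :
    IsDiffPoly U (fun z => ∑ i ∈ s, f i z) := by
  classical
  induction s using Finset.induction_on with
  | empty => simpa using const 0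
  | insert i s hi ih =>
    refine ((hf i (by simp)).add (ih fun j hj => hf j (by simp [hj]))).congr fun z _ => ?_
    simp [Finset.sum_insert hi]

end IsDiffPoly

/-! ### Vector fields on the jet space -/

/-- The derivative of `a` along the vector field `w`. -/
def der (w : Jet → Jet) (a : Jet → ℝ) : Jet → ℝ := fun z => lineDeriv ℝ a z (w z)

/-- The vector field which gives the total derivative. -/
def shift : Jet → Jet := fun z s => z (s + 1)

/-- The prolongation of the evolutionary system `uⁱ_t = Xⁱ`. -/
def prolong (X : Fin 2 → Jet → ℝ) : Jet → Jet := fun z s i => Dx^[s] (X i) z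

/-- Vector fields whose components are differential polynomials. -/
def IsDiffField (U : Set (ℝ × ℝ)) (w : Jet → Jet) : Prop :=
  ∀ s i, IsDiffPoly U (fun z => w z s i)

lemma dx_eq_der (a : Jet → ℝ) : Dx a = der shift a := rfl

lemma isDiffField_shift : IsDiffField U shift := fun s i => .coord (s + 1) i

variable {v w : Jet → Jet} {z : Jet}

lemma der_congr (hU : IsOpen U) (hab : Set.EqOn a b (jetsOver U)) :
    Set.EqOn (der w a) (der w b) (jetsOver U) :=
  fun z hz => lineDeriv_congr_over hU hab hz (w z)

lemma der_base {a : ℝ × ℝ → ℝ} (ha : DifferentiableAt ℝ a z.base) :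
    der w (fun z => a z.base) z = pd 0 a z.base * w z 0 0 + pd 1 a z.base * w z 0 1 :=
  (hasLineDerivAt_base ha (w z)).lineDeriv

lemma der_coord (s : ℕ) (i : Fin 2) : der w (fun z => z s i) z = w z s i :=
  (hasLineDerivAt_coord s i z (w z)).lineDeriv

lemma der_add (hU : IsOpen U) (ha : IsDiffPoly U a) (hb : IsDiffPoly U b) (hz : z ∈ jetsOver U) :
    der w (fun z => a z + b z) z = der w a z + der w b z :=
  (hasLineDerivAt_add (ha.hasLineDerivAt hU hz (w z)) (hb.hasLineDerivAt hU hz (w z))).lineDeriv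

lemma der_mul (hU : IsOpen U) (ha : IsDiffPoly U a) (hb : IsDiffPoly U b) (hz : z ∈ jetsOver U) :
    der w (fun z => a z * b z) z = der w a z * b z + a z * der w b z :=
  (hasLineDerivAt_mul (ha.hasLineDerivAt hU hz (w z)) (hb.hasLineDerivAt hU hz (w z))).lineDeriv

lemma der_const (c : ℝ) : der w (fun _ => c) z = 0 := by
  simp [der, lineDeriv]

lemma der_smul (hU : IsOpen U) (c : ℝ) (ha : IsDiffPoly U a) (hz : z ∈ jetsOver U) :
    der w (fun z => c * a z) z = c * der w a z := by
  rw [der_mul hU (.const c) ha hz, der_const]; ring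

lemma der_sub (hU : IsOpen U) (ha : IsDiffPoly U a) (hb : IsDiffPoly U b) (hz : z ∈ jetsOver U) :
    der w (fun z => a z - b z) z = der w a z - der w b z := by
  have h : (fun z => a z - b z) = fun z => a z + (-1) * b z := by funext z; ring
  rw [h, der_add hU ha (hb.smul _) hz, der_smul hU _ hb hz]; ring

lemma CkOn.differentiableAt {a : ℝ × ℝ → ℝ} (ha : CkOn ∞ U a) (hz : z ∈ jetsOver U) :
    DifferentiableAt ℝ a z.base := (ha _ hz).differentiableAt (by simp)

lemma CkOn.pd_top {a : ℝ × ℝ → ℝ} (ha : CkOn ∞ U a) (j : Fin 2) : CkOn ∞ U (B2Deformation.pd j a) :=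
  ha.pd (by simp) j

/-- The derivation rules hold only over `U`, where the coefficients are differentiable. The
constructor `congr` of `IsDiffPoly` is what lets the class be closed under derivations nevertheless.
-/
lemma IsDiffPoly.der (hU : IsOpen U) (ha : IsDiffPoly U a) (hw : IsDiffField U w) :
    IsDiffPoly U (der w a) := by
  induction ha with
  | @base a ha =>
    refine (((base (ha.pd_top 0)).mul (hw 0 0)).add ((base (ha.pd_top 1)).mul (hw 0 1))).congr ?_
    exact fun z hz => (der_base (ha.differentiableAt hz)).symm
  | coord s i => exact (hw s i).congr fun z _ => (der_coord s i).symm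
  | add ha hb iha ihb => exact (iha.add ihb).congr fun z hz => (der_add hU ha hb hz).symm
  | mul ha hb iha ihb =>
    exact ((iha.mul hb).add (ha.mul ihb)).congr fun z hz => (der_mul hU ha hb hz).symm
  | congr _ hab iha => exact iha.congr (der_congr hU hab)

/-- The commutator of two vector fields. -/
lemma der_comm (hU : IsOpen U) (ha : IsDiffPoly U a) (hv : IsDiffField U v)
    (hw : IsDiffField U w) (hz : z ∈ jetsOver U) :
    der v (der w a) z - der w (der v a) z = lineDeriv ℝ a z
      (fun s i => der v (fun z => w z s i) z - der w (fun z => v z s i) z) := by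
  induction ha with
  | @base a ha =>
    have key : ∀ {v w : Jet → Jet}, IsDiffField U v → IsDiffField U w →
        der v (der w fun z => a z.base) z =
        (pd 0 (pd 0 a) z.base * v z 0 0 + pd 1 (pd 0 a) z.base * v z 0 1) * w z 0 0 +
          pd 0 a z.base * der v (fun z => w z 0 0) z +
        ((pd 0 (pd 1 a) z.base * v z 0 0 + pd 1 (pd 1 a) z.base * v z 0 1) * w z 0 1 +
          pd 1 a z.base * der v (fun z => w z 0 1) z) := by
      intro v w hv hw
      have h0 := IsDiffPoly.base (ha.pd_top 0)
      have h1 := IsDiffPoly.base (ha.pd_top 1)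
      rw [der_congr (b := fun z => pd 0 a z.base * w z 0 0 + pd 1 a z.base * w z 0 1) hU
        (fun z hz => der_base (ha.differentiableAt hz)) hz,
        der_add hU (h0.mul (hw 0 0)) (h1.mul (hw 0 1)) hz, der_mul hU h0 (hw 0 0) hz,
        der_mul hU h1 (hw 0 1) hz, der_base ((ha.pd_top 0).differentiableAt hz),
        der_base ((ha.pd_top 1).differentiableAt hz)]
    -- The terms with second derivatives of `a` agree in both compositions because mixed partials
    -- commute; only the derivatives of the components of the fields remain.
    rw [key hv hw, key hw hv, (hasLineDerivAt_base (ha.differentiableAt hz) _).lineDeriv,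
      pd_comm ((ha _ hz).of_le two_le_infty) 1 0]
    ring
  | coord s i =>
    rw [(hasLineDerivAt_coord s i z _).lineDeriv]
    simp only [funext fun z => der_coord (w := w) (z := z) s i,
      funext fun z => der_coord (w := v) (z := z) s i]
  | @add a b ha hb iha ihb =>
    have key : ∀ {v w : Jet → Jet}, IsDiffField U w →
        der v (der w fun z => a z + b z) z = der v (der w a) z + der v (der w b) z := by
      intro v w hw
      rw [der_congr hU (fun z hz => der_add hU ha hb hz) hz, der_add hU (ha.der hU hw)
        (hb.der hU hw) hz]
    rw [key hw, key hv, (hasLineDerivAt_add (ha.hasLineDerivAt hU hz _) (hb.hasLineDerivAt hU hz _)).lineDeriv,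
      ← iha, ← ihb]
    ring
  | @mul a b ha hb iha ihb =>
    have key : ∀ {v w : Jet → Jet}, IsDiffField U w →
        der v (der w fun z => a z * b z) z = der v (der w a) z * b z + der w a z * der v b z +
          (der v a z * der w b z + a z * der v (der w b) z) := by
      intro v w hw
      rw [der_congr hU (fun z hz => der_mul hU ha hb hz) hz, der_add hU ((ha.der hU hw).mul hb)
        (ha.mul (hb.der hU hw)) hz, der_mul hU (ha.der hU hw) hb hz,
        der_mul hU ha (hb.der hU hw) hz]
    rw [key hw, key hv, (hasLineDerivAt_mul (ha.hasLineDerivAt hU hz _) (hb.hasLineDerivAt hU hz _)).lineDeriv,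
      ← iha, ← ihb]
    ring
  | @congr a b ha hab iha =>
    rw [← lineDeriv_congr_over hU hab hz, ← iha, der_congr hU (der_congr hU hab) hz,
      der_congr hU (der_congr hU hab) hz]

end B2Deformation
end

noncomputable section

namespace B2Deformation

variable {U : Set (ℝ × ℝ)} {a b : Jet → ℝ} {v w : Jet → Jet} {z : Jet}

/-! ### The bracket of fluxes -/

lemma IsDiffPoly.dx (hU : IsOpen U) (ha : IsDiffPoly U a) : IsDiffPoly U (Dx a) :=
  ha.der hU isDiffField_shift

lemma IsDiffPoly.dx_iterate (hU : IsOpen U) (ha : IsDiffPoly U a) (s : ℕ) :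
    IsDiffPoly U (Dx^[s] a) := by
  induction s with
  | zero => exact ha
  | succ s ih => rw [Function.iterate_succ_apply']; exact ih.dx hU

lemma dx_congr (hU : IsOpen U) (hab : Set.EqOn a b (jetsOver U)) :
    Set.EqOn (Dx a) (Dx b) (jetsOver U) :=
  der_congr (w := shift) hU hab

lemma dx_iterate_congr (hU : IsOpen U) (hab : Set.EqOn a b (jetsOver U)) (s : ℕ) :
    Set.EqOn (Dx^[s] a) (Dx^[s] b) (jetsOver U) := by
  induction s with
  | zero => exact hab
  | succ s ih => simp only [Function.iterate_succ_apply']; exact dx_congr hU ih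

lemma dx_iterate_add (hU : IsOpen U) (ha : IsDiffPoly U a) (hb : IsDiffPoly U b) (s : ℕ) :
    Set.EqOn (Dx^[s] (a + b)) (Dx^[s] a + Dx^[s] b) (jetsOver U) := by
  induction s with
  | zero => intro z _; rfl
  | succ s ih =>
    simp only [Function.iterate_succ_apply']
    exact (dx_congr hU ih).trans fun z hz =>
      der_add (w := shift) hU (ha.dx_iterate hU s) (hb.dx_iterate hU s) hz

lemma dx_iterate_smul (hU : IsOpen U) (c : ℝ) (ha : IsDiffPoly U a) (s : ℕ) :
    Set.EqOn (Dx^[s] (c • a)) (c • Dx^[s] a) (jetsOver U) := by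
  induction s with
  | zero => intro z _; rfl
  | succ s ih =>
    simp only [Function.iterate_succ_apply']
    exact (dx_congr hU ih).trans fun z hz => der_smul (w := shift) hU c (ha.dx_iterate hU s) hz

/-- The vector field of the system `uⁱ_t = ∂ₓ αⁱ`. -/
def along (α : Fin 2 → Jet → ℝ) : Jet → Jet := prolong fun i => Dx (α i)

/-- The bracket of the systems with the fluxes `α` and `β`. -/
def br (α β : Fin 2 → Jet → ℝ) : Fin 2 → Jet → ℝ :=
  fun i z => der (along β) (α i) z - der (along α) (β i) z

/-- Fluxes whose components are differential polynomials. -/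
def IsDiffFlux (U : Set (ℝ × ℝ)) (α : Fin 2 → Jet → ℝ) : Prop := ∀ i, IsDiffPoly U (α i)

/-- Equality of fluxes over `U`. -/
def FluxEq (U : Set (ℝ × ℝ)) (α β : Fin 2 → Jet → ℝ) : Prop :=
  ∀ i, Set.EqOn (α i) (β i) (jetsOver U)

variable {α α' β β' γ : Fin 2 → Jet → ℝ}

lemma along_apply (α : Fin 2 → Jet → ℝ) (z : Jet) (s : ℕ) (i : Fin 2) :
    along α z s i = Dx^[s + 1] (α i) z := by
  rw [Function.iterate_succ_apply]; rfl

lemma IsDiffFlux.along (hU : IsOpen U) (hα : IsDiffFlux U α) : IsDiffField U (along α) :=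
  fun s i => ((hα i).dx hU).dx_iterate hU s

lemma IsDiffFlux.add (hα : IsDiffFlux U α) (hβ : IsDiffFlux U β) : IsDiffFlux U (α + β) :=
  fun i => (hα i).add (hβ i)

lemma IsDiffFlux.smul (c : ℝ) (hα : IsDiffFlux U α) : IsDiffFlux U (c • α) :=
  fun i => (hα i).smul c

lemma IsDiffFlux.br (hU : IsOpen U) (hα : IsDiffFlux U α) (hβ : IsDiffFlux U β) :
    IsDiffFlux U (br α β) :=
  fun i => ((hα i).der hU (hβ.along hU)).sub ((hβ i).der hU (hα.along hU))

lemma along_congr (hU : IsOpen U) (h : FluxEq U α β) (hz : z ∈ jetsOver U) :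
    along α z = along β z := by
  funext s i
  rw [along_apply, along_apply]
  exact dx_iterate_congr hU (h i) _ hz

lemma along_add (hU : IsOpen U) (hα : IsDiffFlux U α) (hβ : IsDiffFlux U β)
    (hz : z ∈ jetsOver U) : along (α + β) z = along α z + along β z := by
  funext s i
  simp only [Pi.add_apply, along_apply]
  exact dx_iterate_add hU (hα i) (hβ i) _ hz

lemma along_smul (hU : IsOpen U) (c : ℝ) (hα : IsDiffFlux U α) (hz : z ∈ jetsOver U) :
    along (c • α) z = c • along α z := by
  funext s i
  simp only [Pi.smul_apply, along_apply]
  exact dx_iterate_smul hU c (hα i) _ hz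

lemma der_along_congr (hU : IsOpen U) (h : FluxEq U α β) (hab : Set.EqOn a b (jetsOver U)) :
    Set.EqOn (der (along α) a) (der (along β) b) (jetsOver U) := by
  intro z hz
  rw [der_congr hU hab hz, der, der, along_congr hU h hz]

lemma der_along_add (hU : IsOpen U) (hα : IsDiffFlux U α) (hβ : IsDiffFlux U β)
    (ha : IsDiffPoly U a) (hz : z ∈ jetsOver U) :
    der (along (α + β)) a z = der (along α) a z + der (along β) a z := by
  rw [der, along_add hU hα hβ hz, ha.lineDeriv_add_right hU hz]; rfl

lemma der_along_smul (hU : IsOpen U) (c : ℝ) (hα : IsDiffFlux U α) (hz : z ∈ jetsOver U) :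
    der (along (c • α)) a z = c * der (along α) a z := by
  rw [der, along_smul hU c hα hz, lineDeriv_smul]; rfl

/-- The total derivative commutes with evolutionary derivatives. -/
lemma dx_der_along (hU : IsOpen U) (hα : IsDiffFlux U α) (ha : IsDiffPoly U a) :
    Set.EqOn (Dx (der (along α) a)) (der (along α) (Dx a)) (jetsOver U) := by
  intro z hz
  have h := der_comm hU ha isDiffField_shift (hα.along hU) hz
  -- The commutator field is zero: the component of `along α` at level s is Dx^(s+1) α, and its
  -- total derivative is the component at level s+1, which is also the derivative along α of the
  -- shifted coordinate.
  have h0 : (fun (s : ℕ) (i : Fin 2) => der shift (fun z => along α z s i) z -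
      der (along α) (fun z => shift z s i) z) = 0 := by
    funext s i
    have h1 : (fun z => along α z s i) = Dx^[s] (Dx (α i)) := rfl
    have h2 : der (along α) (fun z => shift z s i) z = along α z (s + 1) i := der_coord _ _
    rw [h1, h2, along_apply, ← dx_eq_der, ← Function.iterate_succ_apply' Dx,
      ← Function.iterate_succ_apply Dx]
    exact sub_self _
  rw [h0, lineDeriv_zero] at h
  exact sub_eq_zero.1 h

lemma dx_iterate_der_along (hU : IsOpen U) (hα : IsDiffFlux U α) (ha : IsDiffPoly U a) (s : ℕ) :
    Set.EqOn (Dx^[s] (der (along α) a)) (der (along α) (Dx^[s] a)) (jetsOver U) := by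
  induction s with
  | zero => intro z _; rfl
  | succ s ih =>
    simp only [Function.iterate_succ_apply']
    exact (dx_congr hU ih).trans (dx_der_along hU hα (ha.dx_iterate hU s))

/-- The commutator of two evolutionary derivatives. -/
lemma der_along_comm (hU : IsOpen U) (hα : IsDiffFlux U α) (hβ : IsDiffFlux U β)
    (ha : IsDiffPoly U a) (hz : z ∈ jetsOver U) :
    der (along β) (der (along α) a) z - der (along α) (der (along β) a) z =
      der (along (br α β)) a z := by
  rw [der_comm hU ha (hβ.along hU) (hα.along hU) hz]
  unfold der
  congr 1
  funext s i
  have e : br α β i = der (along β) (α i) + (-1 : ℝ) • der (along α) (β i) := by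
    funext z; simp [br, sub_eq_add_neg]
  have h1 := (hα i).der hU (hβ.along hU)
  have h2 := (hβ i).der hU (hα.along hU)
  have h3 : IsDiffPoly U ((-1 : ℝ) • der (along α) (β i)) := h2.smul _
  -- Powers of the total derivative commute with evolutionary derivations, so each component of the
  -- commutator field is Dx^(s+1) of the bracket, as required of a prolongation.
  rw [along_apply, e, dx_iterate_add hU h1 h3 _ hz, Pi.add_apply,
    dx_iterate_smul hU _ h2 _ hz, Pi.smul_apply, dx_iterate_der_along hU hβ (hα i) _ hz,
    dx_iterate_der_along hU hα (hβ i) _ hz]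
  simp only [along_apply, smul_eq_mul, neg_one_mul, ← sub_eq_add_neg]
  rfl

lemma br_congr (hU : IsOpen U) (hα : FluxEq U α α') (hβ : FluxEq U β β') :
    FluxEq U (br α β) (br α' β') := by
  intro i z hz
  rw [br, br, der_along_congr hU hβ (hα i) hz, der_along_congr hU hα (hβ i) hz]

lemma br_add_right (hU : IsOpen U) (hα : IsDiffFlux U α) (hβ : IsDiffFlux U β)
    (hγ : IsDiffFlux U γ) : FluxEq U (br α (β + γ)) (br α β + br α γ) := by
  intro i z hz
  have h := der_add (w := along α) hU (hβ i) (hγ i) hz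
  simp only [br, Pi.add_apply, der_along_add hU hβ hγ (hα i) hz]
  change _ - der (along α) (fun z => β i z + γ i z) z = _
  rw [h]; ring

lemma br_smul_right (hU : IsOpen U) (c : ℝ) (hβ : IsDiffFlux U β) :
    FluxEq U (br α (c • β)) (c • br α β) := by
  intro i z hz
  have h := der_smul (w := along α) hU c (hβ i) hz
  simp only [br, Pi.smul_apply, der_along_smul hU c hβ hz, smul_eq_mul]
  change _ - der (along α) (fun z => c * β i z) z = _
  rw [h]; ring

lemma br_antisymm (α β : Fin 2 → Jet → ℝ) (i : Fin 2) (z : Jet) : br α β i z = -br β α i z := by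
  simp [br]

lemma br_add_left (hU : IsOpen U) (hα : IsDiffFlux U α) (hβ : IsDiffFlux U β)
    (hγ : IsDiffFlux U γ) : FluxEq U (br (α + β) γ) (br α γ + br β γ) := by
  intro i z hz
  rw [br_antisymm, br_add_right hU hγ hα hβ i hz]
  simp only [Pi.add_apply, br_antisymm α γ, br_antisymm β γ]
  ring

lemma br_smul_left (hU : IsOpen U) (c : ℝ) (hα : IsDiffFlux U α) :
    FluxEq U (br (c • α) β) (c • br α β) := by
  intro i z hz
  rw [br_antisymm, br_smul_right hU c hα i hz]
  simp only [Pi.smul_apply, br_antisymm α β, smul_eq_mul]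
  ring

/-- A flux vanishing over an open set has vanishing prolongation there. This permits applying a
further bracket to both sides of a commutation relation. -/
lemma br_eq_zero (hU : IsOpen U) (hβ : FluxEq U β 0) : FluxEq U (br α β) 0 := by
  intro i z hz
  rw [br_congr hU (fun _ _ _ => rfl) hβ i hz]
  have h0 : along 0 z = 0 := by
    funext s i
    have : ∀ s, Dx^[s] ((0 : Fin 2 → Jet → ℝ) i) = 0 := by
      intro s
      induction s with
      | zero => rfl
      | succ s ih =>
        rw [Function.iterate_succ_apply', ih]
        funext z
        exact der_const (w := shift) 0
    rw [along_apply, this]; rfl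
  have h1 : der (along α) ((0 : Fin 2 → Jet → ℝ) i) z = 0 := der_const 0
  rw [br, h1, der, h0, lineDeriv_zero]
  simp

/-- By the commutator formula each double bracket is a sum of four second derivatives of components
of α, β, γ, and these cancel. The form chosen says that `br α` is a derivation of the bracket. -/
lemma br_jacobi (hU : IsOpen U) (hα : IsDiffFlux U α) (hβ : IsDiffFlux U β)
    (hγ : IsDiffFlux U γ) :
    FluxEq U (br α (br β γ)) (br (br α β) γ + br β (br α γ)) := by
  intro i z hz
  have key : ∀ {α β γ : Fin 2 → Jet → ℝ}, IsDiffFlux U α → IsDiffFlux U β → IsDiffFlux U γ →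
      br α (br β γ) i z = der (along γ) (der (along β) (α i)) z -
        der (along β) (der (along γ) (α i)) z - der (along α) (der (along γ) (β i)) z +
        der (along α) (der (along β) (γ i)) z := by
    intro α β γ hα hβ hγ
    have h := der_sub (w := along α) hU ((hβ i).der hU (hγ.along hU))
      ((hγ i).der hU (hβ.along hU)) hz
    rw [br, ← der_along_comm hU hβ hγ (hα i) hz]
    change _ - der (along α) (fun z => der (along γ) (β i) z - der (along β) (γ i) z) z = _
    rw [h]; ring
  rw [Pi.add_apply, Pi.add_apply, br_antisymm (br α β) γ, key hα hβ hγ, key hγ hα hβ,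
    key hβ hα hγ]
  ring

/-! ### Transformation of commuting systems -/

/-- The first order part of the system transformed by `w = u + ε ∂ₓM + …`. -/
def transport₁ (M X₀ X₁ : Fin 2 → Jet → ℝ) : Fin 2 → Jet → ℝ := X₁ + br M X₀

/-- The second order part of the transformed system. -/
def transport₂ (M γ X₀ X₁ X₂ : Fin 2 → Jet → ℝ) : Fin 2 → Jet → ℝ :=
  X₂ + br M X₁ + (1 / 2 : ℝ) • br M (br M X₀) + br γ X₀

variable {M X₀ X₁ X₂ Y₀ Y₁ Y₂ : Fin 2 → Jet → ℝ}

/-- The left side is the first order relation plus `br M` applied to the zeroth order relation,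
redistributed by the Jacobi identity. -/
lemma commute_transport₁ (hU : IsOpen U) (hM : IsDiffFlux U M) (hX₀ : IsDiffFlux U X₀)
    (hX₁ : IsDiffFlux U X₁) (hY₀ : IsDiffFlux U Y₀) (hY₁ : IsDiffFlux U Y₁)
    (h₀ : FluxEq U (br X₀ Y₀) 0) (h₁ : FluxEq U (br X₀ Y₁ + br X₁ Y₀) 0) :
    FluxEq U (br X₀ (transport₁ M Y₀ Y₁) + br (transport₁ M X₀ X₁) Y₀) 0 := by
  intro i z hz
  have e0 := br_eq_zero (α := M) hU h₀ i hz
  have e1 := h₁ i hz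
  rw [br_jacobi hU hM hX₀ hY₀ i hz] at e0
  simp only [Pi.add_apply, transport₁, br_add_right hU hX₀ hY₁ (hM.br hU hY₀) i hz,
    br_add_left hU hX₁ (hM.br hU hX₀) hY₀ i hz, Pi.zero_apply] at e0 e1 ⊢
  linear_combination e0 + e1

lemma commute_transport₂ (hU : IsOpen U) (hM : IsDiffFlux U M) (hγ : IsDiffFlux U γ)
    (hX₀ : IsDiffFlux U X₀) (hX₁ : IsDiffFlux U X₁) (hX₂ : IsDiffFlux U X₂)
    (hY₀ : IsDiffFlux U Y₀) (hY₁ : IsDiffFlux U Y₁) (hY₂ : IsDiffFlux U Y₂)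
    (h₀ : FluxEq U (br X₀ Y₀) 0) (h₁ : FluxEq U (br X₀ Y₁ + br X₁ Y₀) 0)
    (h₂ : FluxEq U (br X₀ Y₂ + br X₁ Y₁ + br X₂ Y₀) 0) :
    FluxEq U (br X₀ (transport₂ M γ Y₀ Y₁ Y₂) + br (transport₁ M X₀ X₁) (transport₁ M Y₀ Y₁) +
      br (transport₂ M γ X₀ X₁ X₂) Y₀) 0 := by
  intro i z hz
  have mX₀ := hM.br hU hX₀
  have mY₀ := hM.br hU hY₀
  have mX₁ := hM.br hU hX₁
  have mY₁ := hM.br hU hY₁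
  have mmX₀ := hM.br hU mX₀
  have mmY₀ := hM.br hU mY₀
  have gX₀ := hγ.br hU hX₀
  have gY₀ := hγ.br hU hY₀
  have e2 := h₂ i hz
  have eγ := br_eq_zero (α := γ) hU h₀ i hz
  rw [br_jacobi hU hγ hX₀ hY₀ i hz] at eγ
  have e1 := br_eq_zero (α := M) hU h₁ i hz
  rw [br_add_right hU hM (hX₀.br hU hY₁) (hX₁.br hU hY₀) i hz, Pi.add_apply, Pi.add_apply,
    br_jacobi hU hM hX₀ hY₁ i hz, br_jacobi hU hM hX₁ hY₀ i hz] at e1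
  have e0 := br_eq_zero (α := M) hU (br_eq_zero (α := M) hU h₀) i hz
  rw [br_congr hU (fun _ _ _ => rfl) (br_jacobi hU hM hX₀ hY₀) i hz,
    br_add_right hU hM (mX₀.br hU hY₀) (hX₀.br hU mY₀) i hz, Pi.add_apply, Pi.add_apply,
    br_jacobi hU hM mX₀ hY₀ i hz, br_jacobi hU hM hX₀ mY₀ i hz] at e0
  simp only [Pi.add_apply, transport₁, transport₂,
    br_add_right hU hX₀ ((hY₂.add mY₁).add (mmY₀.smul (1 / 2))) gY₀ i hz,
    br_add_right hU hX₀ (hY₂.add mY₁) (mmY₀.smul (1 / 2)) i hz,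
    br_add_right hU hX₀ hY₂ mY₁ i hz, br_smul_right hU (1 / 2) mmY₀ i hz,
    br_add_left hU ((hX₂.add mX₁).add (mmX₀.smul (1 / 2))) gX₀ hY₀ i hz,
    br_add_left hU (hX₂.add mX₁) (mmX₀.smul (1 / 2)) hY₀ i hz,
    br_add_left hU hX₂ mX₁ hY₀ i hz, br_smul_left hU (1 / 2) mmX₀ i hz,
    br_add_left hU hX₁ mX₀ (hY₁.add mY₀) i hz, br_add_right hU hX₁ hY₁ mY₀ i hz,
    br_add_right hU mX₀ hY₁ mY₀ i hz, Pi.smul_apply, smul_eq_mul, Pi.zero_apply]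
    at e0 e1 e2 eγ ⊢
  -- With r₀, r₁, r₂ the three relations, the new second order relation is r₂ + ad_M r₁ + ad_γ r₀ +
  -- ½ ad_M² r₀, the ε²-coefficient of exp(ad(εM + ε²γ)) applied to r₀ + εr₁ + ε²r₂.
  linear_combination e2 + e1 + eγ + (1 / 2) * e0

end B2Deformation
end

noncomputable section

namespace B2Deformation

variable {U : Set (ℝ × ℝ)} {a : ℝ × ℝ → ℝ} {w : Jet → Jet} {z : Jet}

/-! ### Homogeneous differential polynomials of low degree -/

/-- `∑ⱼ bⱼ uʲ_x` -/
def linPoly (b : Fin 2 → ℝ × ℝ → ℝ) : Jet → ℝ := fun z => ∑ j, b j z.base * z 1 j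

/-- `∑ⱼ cⱼ uʲ_xx + ∑ⱼₖ dⱼₖ uʲ_x uᵏ_x` -/
def quadPoly (c : Fin 2 → ℝ × ℝ → ℝ) (d : Fin 2 → Fin 2 → ℝ × ℝ → ℝ) : Jet → ℝ := fun z =>
  ∑ j, c j z.base * z 2 j + ∑ j, ∑ l, d j l z.base * z 1 j * z 1 l

/-- `∑ⱼ cⱼ uʲ_xxx + ∑ⱼₖ dⱼₖ uʲ_x uᵏ_xx + ∑ⱼₖₘ eⱼₖₘ uʲ_x uᵏ_x uᵐ_x`, a number -/
def cubForm (c : Fin 2 → ℝ) (d : Fin 2 → Fin 2 → ℝ) (e : Fin 2 → Fin 2 → Fin 2 → ℝ) (z : Jet) : ℝ :=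
  ∑ j, c j * z 3 j + ∑ j, ∑ k, d j k * z 1 j * z 2 k +
    ∑ j, ∑ k, ∑ m, e j k m * z 1 j * z 1 k * z 1 m

variable {b c : Fin 2 → ℝ × ℝ → ℝ} {d : Fin 2 → Fin 2 → ℝ × ℝ → ℝ}

lemma isDiffPoly_linPoly (hb : ∀ j, CkOn ∞ U (b j)) : IsDiffPoly U (linPoly b) :=
  .sum _ fun j _ => (IsDiffPoly.base (hb j)).mul (.coord 1 j)

lemma isDiffPoly_quadPoly (hc : ∀ j, CkOn ∞ U (c j)) (hd : ∀ j l, CkOn ∞ U (d j l)) :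
    IsDiffPoly U (quadPoly c d) :=
  (IsDiffPoly.sum _ fun j _ => (IsDiffPoly.base (hc j)).mul (.coord 2 j)).add
    (.sum _ fun j _ => .sum _ fun l _ =>
      ((IsDiffPoly.base (hd j l)).mul (.coord 1 j)).mul (.coord 1 l))

lemma der_linPoly (hb : ∀ j, CkOn ∞ U (b j)) (hz : z ∈ jetsOver U) :
    der w (linPoly b) z = ∑ j, ((pd 0 (b j) z.base * w z 0 0 + pd 1 (b j) z.base * w z 0 1) * z 1 j +
      b j z.base * w z 1 j) := by
  refine HasLineDerivAt.lineDeriv (HasDerivAt.fun_sum fun j _ => ?_)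
  exact hasLineDerivAt_mul (hasLineDerivAt_base ((hb j).differentiableAt hz) (w z))
    (hasLineDerivAt_coord 1 j z (w z))

lemma der_quadPoly (hc : ∀ j, CkOn ∞ U (c j)) (hd : ∀ j l, CkOn ∞ U (d j l))
    (hz : z ∈ jetsOver U) :
    der w (quadPoly c d) z =
      ∑ j, ((pd 0 (c j) z.base * w z 0 0 + pd 1 (c j) z.base * w z 0 1) * z 2 j +
        c j z.base * w z 2 j) +
      ∑ j, ∑ l, (((pd 0 (d j l) z.base * w z 0 0 + pd 1 (d j l) z.base * w z 0 1) * z 1 j +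
        d j l z.base * w z 1 j) * z 1 l + d j l z.base * z 1 j * w z 1 l) := by
  refine HasLineDerivAt.lineDeriv (hasLineDerivAt_add (HasDerivAt.fun_sum fun j _ => ?_)
    (HasDerivAt.fun_sum fun j _ => HasDerivAt.fun_sum fun l _ => ?_))
  · exact hasLineDerivAt_mul (hasLineDerivAt_base ((hc j).differentiableAt hz) (w z))
      (hasLineDerivAt_coord 2 j z (w z))
  · exact hasLineDerivAt_mul (hasLineDerivAt_mul
      (hasLineDerivAt_base ((hd j l).differentiableAt hz) (w z))
      (hasLineDerivAt_coord 1 j z (w z))) (hasLineDerivAt_coord 1 l z (w z))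

lemma dx_base (ha : CkOn ∞ U a) :
    Set.EqOn (Dx fun z => a z.base) (linPoly fun j => pd j a) (jetsOver U) := by
  intro z hz
  rw [dx_eq_der, der_base (ha.differentiableAt hz)]
  simp [linPoly, shift]

lemma dx_linPoly (hb : ∀ j, CkOn ∞ U (b j)) :
    Set.EqOn (Dx (linPoly b)) (quadPoly b fun j k => pd k (b j)) (jetsOver U) := by
  intro z hz
  rw [dx_eq_der, der_linPoly hb hz]
  simp only [quadPoly, shift, Fin.sum_univ_two, zero_add, Nat.reduceAdd]
  ring

lemma dx_quadPoly (hc : ∀ j, CkOn ∞ U (c j)) (hd : ∀ j l, CkOn ∞ U (d j l))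
    (hz : z ∈ jetsOver U) :
    Dx (quadPoly c d) z = cubForm (fun j => c j z.base)
      (fun j k => pd j (c k) z.base + d j k z.base + d k j z.base)
      (fun j k m => pd m (d j k) z.base) z := by
  rw [dx_eq_der, der_quadPoly hc hd hz]
  simp only [cubForm, shift, Fin.sum_univ_two, zero_add, Nat.reduceAdd]
  ring

lemma dx_dx_base (hU : IsOpen U) (ha : CkOn ∞ U a) :
    Set.EqOn (Dx^[2] fun z => a z.base) (quadPoly (fun j => pd j a) fun j k => pd k (pd j a))
      (jetsOver U) :=
  (dx_congr hU (dx_base ha)).trans (dx_linPoly fun j => ha.pd_top j)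

lemma dx_dx_dx_base (hU : IsOpen U) (ha : CkOn ∞ U a) (hz : z ∈ jetsOver U) :
    Dx^[3] (fun z => a z.base) z = cubForm (fun j => pd j a z.base)
      (fun j k => pd j (pd k a) z.base + pd k (pd j a) z.base + pd j (pd k a) z.base)
      (fun j k m => pd m (pd k (pd j a)) z.base) z := by
  have h := dx_congr hU (dx_dx_base hU ha) hz
  rw [dx_quadPoly (fun j => ha.pd_top j) (fun j k => (ha.pd_top j).pd_top k) hz] at h
  exact h

lemma dx_dx_linPoly (hU : IsOpen U) (hb : ∀ j, CkOn ∞ U (b j)) (hz : z ∈ jetsOver U) :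
    Dx^[2] (linPoly b) z = cubForm (fun j => b j z.base)
      (fun j k => pd j (b k) z.base + pd k (b j) z.base + pd j (b k) z.base)
      (fun j k m => pd m (pd k (b j)) z.base) z := by
  have h := dx_congr hU (dx_linPoly hb) hz
  rw [dx_quadPoly hb (fun j k => (hb j).pd_top k) hz] at h
  exact h

/-! ### The graded parts of a flux and their brackets -/

/-- The flux `Aⁱ`. -/
def baseFlux (A : Fin 2 → ℝ × ℝ → ℝ) : Fin 2 → Jet → ℝ := fun i z => A i z.base

/-- The flux `∑ⱼ Bⁱⱼ uʲ_x`. -/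
def linFlux (B : Fin 2 → Fin 2 → ℝ × ℝ → ℝ) : Fin 2 → Jet → ℝ := fun i => linPoly (B i)

/-- The flux `∑ⱼ Cⁱⱼ uʲ_xx + ∑ⱼₖ Dⁱⱼₖ uʲ_x uᵏ_x`. -/
def quadFlux (C : Fin 2 → Fin 2 → ℝ × ℝ → ℝ) (D : Fin 2 → Fin 2 → Fin 2 → ℝ × ℝ → ℝ) :
    Fin 2 → Jet → ℝ := fun i => quadPoly (C i) (D i)

variable {A M S : Fin 2 → ℝ × ℝ → ℝ} {B P C : Fin 2 → Fin 2 → ℝ × ℝ → ℝ}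
  {D : Fin 2 → Fin 2 → Fin 2 → ℝ × ℝ → ℝ}

lemma isDiffFlux_baseFlux (hA : ∀ i, CkOn ∞ U (A i)) : IsDiffFlux U (baseFlux A) :=
  fun i => .base (hA i)

lemma isDiffFlux_linFlux (hB : ∀ i j, CkOn ∞ U (B i j)) : IsDiffFlux U (linFlux B) :=
  fun i => isDiffPoly_linPoly (hB i)

lemma isDiffFlux_quadFlux (hC : ∀ i j, CkOn ∞ U (C i j)) (hD : ∀ i j l, CkOn ∞ U (D i j l)) :
    IsDiffFlux U (quadFlux C D) :=
  fun i => isDiffPoly_quadPoly (hC i) (hD i)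

lemma along_baseFlux_zero (hA : ∀ i, CkOn ∞ U (A i)) (hz : z ∈ jetsOver U) (i : Fin 2) :
    along (baseFlux A) z 0 i = linPoly (fun j => pd j (A i)) z := by
  rw [along_apply]; exact dx_base (hA i) hz

lemma along_baseFlux_one (hU : IsOpen U) (hA : ∀ i, CkOn ∞ U (A i)) (hz : z ∈ jetsOver U)
    (i : Fin 2) : along (baseFlux A) z 1 i =
      quadPoly (fun j => pd j (A i)) (fun j k => pd k (pd j (A i))) z := by
  rw [along_apply]; exact dx_dx_base hU (hA i) hz

lemma along_baseFlux_two (hU : IsOpen U) (hA : ∀ i, CkOn ∞ U (A i)) (hz : z ∈ jetsOver U)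
    (i : Fin 2) : along (baseFlux A) z 2 i = cubForm (fun j => pd j (A i) z.base)
      (fun j k => pd j (pd k (A i)) z.base + pd k (pd j (A i)) z.base + pd j (pd k (A i)) z.base)
      (fun j k m => pd m (pd k (pd j (A i))) z.base) z := by
  rw [along_apply]; exact dx_dx_dx_base hU (hA i) hz

lemma along_linFlux_zero (hB : ∀ i j, CkOn ∞ U (B i j)) (hz : z ∈ jetsOver U) (i : Fin 2) :
    along (linFlux B) z 0 i = quadPoly (B i) (fun j k => pd k (B i j)) z := by
  rw [along_apply]; exact dx_linPoly (hB i) hz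

lemma along_linFlux_one (hU : IsOpen U) (hB : ∀ i j, CkOn ∞ U (B i j)) (hz : z ∈ jetsOver U)
    (i : Fin 2) : along (linFlux B) z 1 i = cubForm (fun j => B i j z.base)
      (fun j k => pd j (B i k) z.base + pd k (B i j) z.base + pd j (B i k) z.base)
      (fun j k m => pd m (pd k (B i j)) z.base) z := by
  rw [along_apply]; exact dx_dx_linPoly hU (hB i) hz

lemma along_quadFlux_zero (hC : ∀ i j, CkOn ∞ U (C i j)) (hD : ∀ i j l, CkOn ∞ U (D i j l))
    (hz : z ∈ jetsOver U) (i : Fin 2) :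
    along (quadFlux C D) z 0 i = cubForm (fun j => C i j z.base)
      (fun j k => pd j (C i k) z.base + D i j k z.base + D i k j z.base)
      (fun j k m => pd m (D i j k) z.base) z := by
  rw [along_apply]; exact dx_quadPoly (hC i) (hD i) hz

/-- The coefficients of the bracket of `baseFlux M` and `baseFlux A`. -/
def brB (M A : Fin 2 → ℝ × ℝ → ℝ) (i j : Fin 2) : ℝ × ℝ → ℝ := fun p =>
  ∑ l, (pd l (M i) p * pd j (A l) p - pd l (A i) p * pd j (M l) p)

/-- The coefficients of second derivatives in the bracket of `baseFlux M` and `linFlux B`. -/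
def brC (M : Fin 2 → ℝ × ℝ → ℝ) (B : Fin 2 → Fin 2 → ℝ × ℝ → ℝ) (i j : Fin 2) : ℝ × ℝ → ℝ :=
  fun p => ∑ l, (pd l (M i) p * B l j p - B i l p * pd j (M l) p)

/-- The coefficients of products in the bracket of `baseFlux M` and `linFlux B`. -/
def brD (M : Fin 2 → ℝ × ℝ → ℝ) (B : Fin 2 → Fin 2 → ℝ × ℝ → ℝ) (i j k : Fin 2) : ℝ × ℝ → ℝ :=
  fun p => ∑ l, (pd l (M i) p * pd k (B l j) p - pd l (B i j) p * pd k (M l) p -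
    B i l p * pd k (pd j (M l)) p)

/-- The bracket of parts with m and n x-derivatives has m + n + 1 of them, one coming from the outer
∂ₓ. Hence the order εⁿ of a commutation relation is homogeneous of degree n + 1, and degrees one to
three are all that is needed. -/
lemma br_baseFlux_baseFlux (hM : ∀ i, CkOn ∞ U (M i)) (hA : ∀ i, CkOn ∞ U (A i)) :
    FluxEq U (br (baseFlux M) (baseFlux A)) (linFlux (brB M A)) := by
  intro i z hz
  have e1 : der (along (baseFlux A)) (baseFlux M i) z = _ := der_base ((hM i).differentiableAt hz)
  have e2 : der (along (baseFlux M)) (baseFlux A i) z = _ := der_base ((hA i).differentiableAt hz)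
  rw [br, e1, e2]
  simp only [along_baseFlux_zero hA hz, along_baseFlux_zero hM hz, linPoly, linFlux, brB,
    Fin.sum_univ_two]
  ring

lemma br_baseFlux_linFlux (hU : IsOpen U) (hM : ∀ i, CkOn ∞ U (M i))
    (hB : ∀ i j, CkOn ∞ U (B i j)) :
    FluxEq U (br (baseFlux M) (linFlux B)) (quadFlux (brC M B) (brD M B)) := by
  intro i z hz
  have e1 : der (along (linFlux B)) (baseFlux M i) z = _ := der_base ((hM i).differentiableAt hz)
  have e2 : der (along (baseFlux M)) (linFlux B i) z = _ := der_linPoly (hB i) hz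
  rw [br, e1, e2]
  simp only [along_linFlux_zero hB hz, along_baseFlux_zero hM hz, along_baseFlux_one hU hM hz,
    linPoly, quadPoly, quadFlux, brC, brD, Fin.sum_univ_two]
  ring

/-- The coefficients of `uʲ_xxx` in the bracket of `baseFlux A` and `quadFlux C D`. -/
def quad₃ (A : Fin 2 → ℝ × ℝ → ℝ) (C : Fin 2 → Fin 2 → ℝ × ℝ → ℝ) (p : ℝ × ℝ) (i j : Fin 2) : ℝ :=
  ∑ l, (pd l (A i) p * C l j p - C i l p * pd j (A l) p)

/-- The coefficients of `uʲ_x uᵏ_xx` in the bracket of `baseFlux A` and `quadFlux C D`. -/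
def quad₂ (A : Fin 2 → ℝ × ℝ → ℝ) (C : Fin 2 → Fin 2 → ℝ × ℝ → ℝ)
    (D : Fin 2 → Fin 2 → Fin 2 → ℝ × ℝ → ℝ) (p : ℝ × ℝ) (i j k : Fin 2) : ℝ :=
  ∑ l, (pd l (A i) p * (pd j (C l k) p + D l j k p + D l k j p) - pd l (C i k) p * pd j (A l) p -
    C i l p * (pd j (pd k (A l)) p + pd k (pd j (A l)) p + pd j (pd k (A l)) p) -
    (D i j l p + D i l j p) * pd k (A l) p)

/-- The coefficients of `uʲ_x uᵏ_x uᵐ_x` in the bracket of `baseFlux A` and `quadFlux C D`. -/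
def quad₁ (A : Fin 2 → ℝ × ℝ → ℝ) (C : Fin 2 → Fin 2 → ℝ × ℝ → ℝ)
    (D : Fin 2 → Fin 2 → Fin 2 → ℝ × ℝ → ℝ) (p : ℝ × ℝ) (i j k m : Fin 2) : ℝ :=
  ∑ l, (pd l (A i) p * pd m (D l j k) p - pd l (D i j k) p * pd m (A l) p -
    C i l p * pd m (pd k (pd j (A l))) p - (D i l m p + D i m l p) * pd k (pd j (A l)) p)

lemma br_baseFlux_quadFlux (hU : IsOpen U) (hA : ∀ i, CkOn ∞ U (A i))
    (hC : ∀ i j, CkOn ∞ U (C i j)) (hD : ∀ i j l, CkOn ∞ U (D i j l)) (hz : z ∈ jetsOver U)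
    (i : Fin 2) :
    br (baseFlux A) (quadFlux C D) i z = cubForm (quad₃ A C z.base i) (quad₂ A C D z.base i)
      (quad₁ A C D z.base i) z := by
  have e1 : der (along (quadFlux C D)) (baseFlux A i) z = _ :=
    der_base ((hA i).differentiableAt hz)
  have e2 : der (along (baseFlux A)) (quadFlux C D i) z = _ := der_quadPoly (hC i) (hD i) hz
  rw [br, e1, e2]
  simp only [along_quadFlux_zero hC hD hz, along_baseFlux_zero hA hz, along_baseFlux_one hU hA hz,
    along_baseFlux_two hU hA hz, linPoly, quadPoly, cubForm, quad₃, quad₂, quad₁, Fin.sum_univ_two]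
  ring

/-- Half of the coefficients of `uʲ_xxx` in the bracket of `linFlux B` and `linFlux P`. -/
def lin₃ (B P : Fin 2 → Fin 2 → ℝ × ℝ → ℝ) (p : ℝ × ℝ) (i j : Fin 2) : ℝ :=
  ∑ l, B i l p * P l j p

/-- Half of the coefficients of `uʲ_x uᵏ_xx` in the bracket of `linFlux B` and `linFlux P`. -/
def lin₂ (B P : Fin 2 → Fin 2 → ℝ × ℝ → ℝ) (p : ℝ × ℝ) (i j k : Fin 2) : ℝ :=
  ∑ l, (pd l (B i j) p * P l k p +
    B i l p * (pd j (P l k) p + pd k (P l j) p + pd j (P l k) p))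

/-- Half of the coefficients of `uʲ_x uᵏ_x uᵐ_x` in the bracket of `linFlux B` and `linFlux P`. -/
def lin₁ (B P : Fin 2 → Fin 2 → ℝ × ℝ → ℝ) (p : ℝ × ℝ) (i j k m : Fin 2) : ℝ :=
  ∑ l, (pd l (B i j) p * pd m (P l k) p + B i l p * pd m (pd k (P l j)) p)

lemma der_along_linFlux (hU : IsOpen U) (hB : ∀ i j, CkOn ∞ U (B i j))
    (hP : ∀ i j, CkOn ∞ U (P i j)) (hz : z ∈ jetsOver U) (i : Fin 2) :
    der (along (linFlux P)) (linFlux B i) z = cubForm (lin₃ B P z.base i) (lin₂ B P z.base i)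
      (lin₁ B P z.base i) z := by
  have e1 : der (along (linFlux P)) (linFlux B i) z = _ := der_linPoly (hB i) hz
  rw [e1]
  simp only [along_linFlux_zero hP hz, along_linFlux_one hU hP hz,
    quadPoly, cubForm, lin₃, lin₂, lin₁, Fin.sum_univ_two]
  ring

end B2Deformation
end

noncomputable section

namespace B2Deformation

variable {U : Set (ℝ × ℝ)} {z : Jet}

/-! ### Orders of the commutation relations -/

lemma quartic_isBigO_iff (c₀ c₁ c₂ c₃ c₄ : ℝ) :
    ((fun ε : ℝ => c₀ + c₁ * ε + c₂ * ε ^ 2 + c₃ * ε ^ 3 + c₄ * ε ^ 4) =O[𝓝 0]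
      fun ε : ℝ => ε ^ 3) ↔ c₀ = 0 ∧ c₁ = 0 ∧ c₂ = 0 := by
  constructor
  · intro h
    -- Off zero one may divide by εⁿ, so f = O(ε) on the punctured neighbourhood; continuity then
    -- forces f(0) = 0. Used for n = 0, 1, 2 this removes the coefficients one after the other.
    have hmul : ∀ {f : ℝ → ℝ} {n : ℕ}, Continuous f →
        ((fun ε : ℝ => f ε * ε ^ n) =O[𝓝 0] fun ε : ℝ => ε ^ (n + 1)) → f 0 = 0 := by
      intro f n hf h
      have h1 : (fun ε : ℝ => f ε) =O[𝓝[≠] 0] fun ε : ℝ => ε := by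
        obtain ⟨C, hC⟩ := (h.mono (nhdsWithin_le_nhds (s := {0}ᶜ))).bound
        refine IsBigO.of_bound C ?_
        filter_upwards [hC, self_mem_nhdsWithin] with ε hε hne
        have hpos : 0 < ‖ε ^ n‖ := norm_pos_iff.2 (pow_ne_zero _ hne)
        rw [pow_succ, norm_mul, norm_mul, mul_comm ‖ε ^ n‖, ← mul_assoc] at hε
        exact le_of_mul_le_mul_right hε hpos
      have h2 : Tendsto f (𝓝[≠] 0) (𝓝 0) :=
        h1.trans_tendsto (tendsto_nhdsWithin_of_tendsto_nhds tendsto_id)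
      exact tendsto_nhds_unique
        (tendsto_nhdsWithin_of_tendsto_nhds hf.continuousAt.tendsto) h2
    have hpow : ∀ {m n : ℕ}, m ≤ n → (fun ε : ℝ => ε ^ n) =O[𝓝 0] fun ε : ℝ => ε ^ m := by
      intro m n hmn
      obtain ⟨l, rfl⟩ := Nat.exists_eq_add_of_le hmn
      have h1 : (fun ε : ℝ => ε ^ l) =O[𝓝 0] fun _ : ℝ => (1 : ℝ) :=
        (continuous_pow l).continuousAt.isBigO_one ℝ
      simpa [pow_add] using (isBigO_refl (fun ε : ℝ => ε ^ m) (𝓝 0)).mul h1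
    have e0 : c₀ = 0 := by
      have := hmul (n := 0) (f := fun ε => c₀ + c₁ * ε + c₂ * ε ^ 2 + c₃ * ε ^ 3 + c₄ * ε ^ 4)
        (by fun_prop) (by simpa using h.trans (hpow (m := 1) (by norm_num)))
      simpa using this
    subst e0
    have e1 : c₁ = 0 := by
      have := hmul (n := 1) (f := fun ε => c₁ + c₂ * ε + c₃ * ε ^ 2 + c₄ * ε ^ 3)
        (by fun_prop) (((h.trans (hpow (m := 2) (by norm_num)))).congr_left fun ε => by ring)
      simpa using this
    subst e1
    have e2 : c₂ = 0 := by
      have := hmul (n := 2) (f := fun ε => c₂ + c₃ * ε + c₄ * ε ^ 2)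
        (by fun_prop) (h.congr_left fun ε => by ring)
      simpa using this
    exact ⟨rfl, rfl, e2⟩
  · rintro ⟨rfl, rfl, rfl⟩
    have h1 : (fun ε : ℝ => c₃ + c₄ * ε) =O[𝓝 0] fun _ : ℝ => (1 : ℝ) :=
      (by fun_prop : Continuous fun ε : ℝ => c₃ + c₄ * ε).continuousAt.isBigO_one ℝ
    refine (h1.mul (isBigO_refl (fun ε : ℝ => ε ^ 3) (𝓝 0))).congr (fun ε => ?_) fun ε => ?_
    · ring
    · ring

namespace ConsSystem

/-- All coefficients of `X` are smooth on `U`. -/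
structure SmoothOver (U : Set (ℝ × ℝ)) (X : ConsSystem) : Prop where
  A : ∀ i, CkOn ∞ U (X.A i)
  B : ∀ i j, CkOn ∞ U (X.B i j)
  C : ∀ i j, CkOn ∞ U (X.C i j)
  D : ∀ i j l, CkOn ∞ U (X.D i j l)

lemma flux_eq (X : ConsSystem) (ε : ℝ) :
    X.flux ε = baseFlux X.A + ε • linFlux X.B + ε ^ 2 • quadFlux X.C X.D := rfl

lemma bracket_eq (X Y : ConsSystem) (ε : ℝ) : bracket X Y ε = br (X.flux ε) (Y.flux ε) := rfl

variable {X Y : ConsSystem}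

namespace SmoothOver

lemma base (hX : X.SmoothOver U) : IsDiffFlux U (baseFlux X.A) := isDiffFlux_baseFlux hX.A

lemma lin (hX : X.SmoothOver U) : IsDiffFlux U (linFlux X.B) := isDiffFlux_linFlux hX.B

lemma quad (hX : X.SmoothOver U) : IsDiffFlux U (quadFlux X.C X.D) := isDiffFlux_quadFlux hX.C hX.D

lemma flux (hX : X.SmoothOver U) (ε : ℝ) : IsDiffFlux U (X.flux ε) :=
  (hX.base.add (hX.lin.smul ε)).add (hX.quad.smul (ε ^ 2))

end SmoothOver

/-- Both fluxes are quadratic in ε and the bracket is bilinear, so for a fixed jet the bracket is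
exactly a quartic polynomial in ε. Being O(ε³) is therefore the vanishing of three coefficients. -/
lemma bracket_expand (hU : IsOpen U) (hX : X.SmoothOver U) (hY : Y.SmoothOver U)
    (hz : z ∈ jetsOver U) (i : Fin 2) (ε : ℝ) :
    bracket X Y ε i z = br (baseFlux X.A) (baseFlux Y.A) i z +
      (br (baseFlux X.A) (linFlux Y.B) i z + br (linFlux X.B) (baseFlux Y.A) i z) * ε +
      (br (baseFlux X.A) (quadFlux Y.C Y.D) i z + br (linFlux X.B) (linFlux Y.B) i z +
        br (quadFlux X.C X.D) (baseFlux Y.A) i z) * ε ^ 2 +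
      (br (linFlux X.B) (quadFlux Y.C Y.D) i z + br (quadFlux X.C X.D) (linFlux Y.B) i z) * ε ^ 3 +
      br (quadFlux X.C X.D) (quadFlux Y.C Y.D) i z * ε ^ 4 := by
  have key : ∀ {α : Fin 2 → Jet → ℝ}, IsDiffFlux U α → br α (Y.flux ε) i z =
      br α (baseFlux Y.A) i z + ε * br α (linFlux Y.B) i z +
        ε ^ 2 * br α (quadFlux Y.C Y.D) i z := by
    intro α hα
    rw [flux_eq, br_add_right hU hα (hY.base.add (hY.lin.smul ε)) (hY.quad.smul _) i hz,
      Pi.add_apply, Pi.add_apply, br_add_right hU hα hY.base (hY.lin.smul ε) i hz, Pi.add_apply,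
      Pi.add_apply, br_smul_right hU _ hY.lin i hz, br_smul_right hU _ hY.quad i hz]
    rfl
  rw [bracket_eq, flux_eq X, br_antisymm,
    br_add_right hU (hY.flux ε) (hX.base.add (hX.lin.smul ε)) (hX.quad.smul _) i hz,
    Pi.add_apply, Pi.add_apply, br_add_right hU (hY.flux ε) hX.base (hX.lin.smul ε) i hz,
    Pi.add_apply, Pi.add_apply, br_smul_right hU _ hX.lin i hz, br_smul_right hU _ hX.quad i hz]
  simp only [Pi.smul_apply, smul_eq_mul]
  rw [br_antisymm (Y.flux ε), br_antisymm (Y.flux ε), br_antisymm (Y.flux ε), key hX.base,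
    key hX.lin, key hX.quad]
  ring

lemma bracket_isBigO_iff (hU : IsOpen U) (hX : X.SmoothOver U) (hY : Y.SmoothOver U)
    (hz : z ∈ jetsOver U) (i : Fin 2) :
    ((fun ε : ℝ => bracket X Y ε i z) =O[𝓝 0] fun ε : ℝ => ε ^ 3) ↔
      br (baseFlux X.A) (baseFlux Y.A) i z = 0 ∧
      br (baseFlux X.A) (linFlux Y.B) i z + br (linFlux X.B) (baseFlux Y.A) i z = 0 ∧
      br (baseFlux X.A) (quadFlux Y.C Y.D) i z + br (linFlux X.B) (linFlux Y.B) i z +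
        br (quadFlux X.C X.D) (baseFlux Y.A) i z = 0 := by
  simp only [bracket_expand hU hX hY hz]
  exact quartic_isBigO_iff _ _ _ _ _

/-- The three orders of the commutation relation over `U`. -/
lemma fluxEq_of_isBigO (hU : IsOpen U) (hX : X.SmoothOver U) (hY : Y.SmoothOver U)
    (h : ∀ p ∈ U, ∀ z : Jet, z.base = p → ∀ i,
      (fun ε : ℝ => bracket X Y ε i z) =O[𝓝 0] fun ε : ℝ => ε ^ 3) :
    FluxEq U (br (baseFlux X.A) (baseFlux Y.A)) 0 ∧
    FluxEq U (br (baseFlux X.A) (linFlux Y.B) + br (linFlux X.B) (baseFlux Y.A)) 0 ∧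
    FluxEq U (br (baseFlux X.A) (quadFlux Y.C Y.D) + br (linFlux X.B) (linFlux Y.B) +
        br (quadFlux X.C X.D) (baseFlux Y.A)) 0 :=
  ⟨fun i z hz => ((bracket_isBigO_iff hU hX hY hz i).1 (h _ hz z rfl i)).1,
    fun i z hz => ((bracket_isBigO_iff hU hX hY hz i).1 (h _ hz z rfl i)).2.1,
    fun i z hz => ((bracket_isBigO_iff hU hX hY hz i).1 (h _ hz z rfl i)).2.2⟩

end ConsSystem

/-! ### Coefficients of the commutation relations -/

/-- The coefficients of `uʲ_xx` in the first order commutation relation. -/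
def ord₁C (A S : Fin 2 → ℝ × ℝ → ℝ) (B P : Fin 2 → Fin 2 → ℝ × ℝ → ℝ) (p : ℝ × ℝ)
    (i j : Fin 2) : ℝ :=
  brC A P i j p - brC S B i j p

/-- The coefficients of `uʲ_x uᵏ_x` in the first order commutation relation. -/
def ord₁D (A S : Fin 2 → ℝ × ℝ → ℝ) (B P : Fin 2 → Fin 2 → ℝ × ℝ → ℝ) (p : ℝ × ℝ)
    (i j k : Fin 2) : ℝ :=
  brD A P i j k p - brD S B i j k p

/-- The coefficients of `uʲ_xxx` in the second order commutation relation. -/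
def ord₂C (A S : Fin 2 → ℝ × ℝ → ℝ) (B P C C' : Fin 2 → Fin 2 → ℝ × ℝ → ℝ) (p : ℝ × ℝ)
    (i j : Fin 2) : ℝ :=
  quad₃ A C' p i j + (lin₃ B P p i j - lin₃ P B p i j) - quad₃ S C p i j

/-- The coefficients of `uʲ_x uᵏ_xx` in the second order commutation relation. -/
def ord₂D (A S : Fin 2 → ℝ × ℝ → ℝ) (B P C C' : Fin 2 → Fin 2 → ℝ × ℝ → ℝ)
    (D D' : Fin 2 → Fin 2 → Fin 2 → ℝ × ℝ → ℝ) (p : ℝ × ℝ) (i j k : Fin 2) : ℝ :=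
  quad₂ A C' D' p i j k + (lin₂ B P p i j k - lin₂ P B p i j k) - quad₂ S C D p i j k

/-- The coefficients of `uʲ_x uᵏ_x uᵐ_x` in the second order commutation relation. -/
def ord₂E (A S : Fin 2 → ℝ × ℝ → ℝ) (B P C C' : Fin 2 → Fin 2 → ℝ × ℝ → ℝ)
    (D D' : Fin 2 → Fin 2 → Fin 2 → ℝ × ℝ → ℝ) (p : ℝ × ℝ) (i j k m : Fin 2) : ℝ :=
  quad₁ A C' D' p i j k m + (lin₁ B P p i j k m - lin₁ P B p i j k m) - quad₁ S C D p i j k m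

variable {A S : Fin 2 → ℝ × ℝ → ℝ} {B P C C' : Fin 2 → Fin 2 → ℝ × ℝ → ℝ}
  {D D' : Fin 2 → Fin 2 → Fin 2 → ℝ × ℝ → ℝ}

lemma order_one_eq (hU : IsOpen U) (hA : ∀ i, CkOn ∞ U (A i)) (hS : ∀ i, CkOn ∞ U (S i))
    (hB : ∀ i j, CkOn ∞ U (B i j)) (hP : ∀ i j, CkOn ∞ U (P i j)) (hz : z ∈ jetsOver U)
    (i : Fin 2) :
    br (baseFlux A) (linFlux P) i z + br (linFlux B) (baseFlux S) i z =
      ∑ j, ord₁C A S B P z.base i j * z 2 j + ∑ j, ∑ k, ord₁D A S B P z.base i j k * z 1 j * z 1 k := by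
  rw [br_antisymm (linFlux B), br_baseFlux_linFlux hU hA hP i hz, br_baseFlux_linFlux hU hS hB i hz]
  simp only [quadFlux, quadPoly, ord₁C, ord₁D, Fin.sum_univ_two]
  ring

lemma order_two_eq (hU : IsOpen U) (hA : ∀ i, CkOn ∞ U (A i)) (hS : ∀ i, CkOn ∞ U (S i))
    (hB : ∀ i j, CkOn ∞ U (B i j)) (hP : ∀ i j, CkOn ∞ U (P i j))
    (hC : ∀ i j, CkOn ∞ U (C i j)) (hC' : ∀ i j, CkOn ∞ U (C' i j))
    (hD : ∀ i j k, CkOn ∞ U (D i j k)) (hD' : ∀ i j k, CkOn ∞ U (D' i j k)) (hz : z ∈ jetsOver U)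
    (i : Fin 2) :
    br (baseFlux A) (quadFlux C' D') i z + br (linFlux B) (linFlux P) i z +
        br (quadFlux C D) (baseFlux S) i z =
      cubForm (ord₂C A S B P C C' z.base i) (ord₂D A S B P C C' D D' z.base i)
        (ord₂E A S B P C C' D D' z.base i) z := by
  rw [br_antisymm (quadFlux C D), br_baseFlux_quadFlux hU hA hC' hD' hz,
    br_baseFlux_quadFlux hU hS hC hD hz, br, der_along_linFlux hU hB hP hz,
    der_along_linFlux hU hP hB hz]
  simp only [cubForm, ord₂C, ord₂D, ord₂E, Fin.sum_univ_two]
  ring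

/-- The jet with prescribed derivatives up to the third order. -/
def mkJet (p : ℝ × ℝ) (x y w : Fin 2 → ℝ) : Jet
  | 0 => ![p.1, p.2]
  | 1 => x
  | 2 => y
  | 3 => w
  | _ => 0

/-- The derivatives of a jet over `p` are free, so the monomials separate. A product u_x v_x occurs
under both index orders, hence only the sum `d 0 1 + d 1 0` is determined. -/
lemma quad_coeffs_eq_zero {p : ℝ × ℝ} {c : Fin 2 → ℝ} {d : Fin 2 → Fin 2 → ℝ}
    (h : ∀ z : Jet, z.base = p → ∑ j, c j * z 2 j + ∑ j, ∑ k, d j k * z 1 j * z 1 k = 0) :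
    (∀ j, c j = 0) ∧ d 0 0 = 0 ∧ d 0 1 + d 1 0 = 0 ∧ d 1 1 = 0 := by
  have h' : ∀ x y : Fin 2 → ℝ, ∑ j, c j * y j + ∑ j, ∑ k, d j k * x j * x k = 0 :=
    fun x y => h (mkJet p x y 0) rfl
  have h0 := h' 0 ![1, 0]
  have h1 := h' 0 ![0, 1]
  have h2 := h' ![1, 0] 0
  have h3 := h' ![0, 1] 0
  have h4 := h' ![1, 1] 0
  simp [Fin.sum_univ_two] at h0 h1 h2 h3 h4
  refine ⟨fun j => ?_, h2, by linarith, h3⟩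
  fin_cases j
  exacts [h0, h1]

lemma cubForm_coeffs_eq_zero {p : ℝ × ℝ} {c : Fin 2 → ℝ} {d : Fin 2 → Fin 2 → ℝ}
    {e : Fin 2 → Fin 2 → Fin 2 → ℝ} (h : ∀ z : Jet, z.base = p → cubForm c d e z = 0) :
    (∀ j, c j = 0) ∧ (∀ j k, d j k = 0) ∧ e 0 0 0 = 0 ∧ e 0 0 1 + e 0 1 0 + e 1 0 0 = 0 ∧
      e 0 1 1 + e 1 0 1 + e 1 1 0 = 0 ∧ e 1 1 1 = 0 := by
  have h' : ∀ x y w : Fin 2 → ℝ, ∑ j, c j * w j + ∑ j, ∑ k, d j k * x j * y k +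
      ∑ j, ∑ k, ∑ m, e j k m * x j * x k * x m = 0 :=
    fun x y w => h (mkJet p x y w) rfl
  have h0 := h' 0 0 ![1, 0]
  have h1 := h' 0 0 ![0, 1]
  have h2 := h' ![1, 0] 0 0
  have h3 := h' ![0, 1] 0 0
  -- The even and odd parts in v_x, seen at (1, 1) and (1, -1), separate the two mixed cubic
  -- monomials.
  have h4 := h' ![1, 1] 0 0
  have h5 := h' ![1, -1] 0 0
  have h6 := h' ![1, 0] ![1, 0] 0
  have h7 := h' ![1, 0] ![0, 1] 0
  have h8 := h' ![0, 1] ![1, 0] 0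
  have h9 := h' ![0, 1] ![0, 1] 0
  simp [Fin.sum_univ_two] at h0 h1 h2 h3 h4 h5 h6 h7 h8 h9
  refine ⟨fun j => ?_, fun j k => ?_, h2, by linarith, by linarith, h3⟩
  · fin_cases j
    exacts [h0, h1]
  · fin_cases j <;> fin_cases k
    · change d 0 0 = 0; linarith
    · change d 0 1 = 0; linarith
    · change d 1 0 = 0; linarith
    · change d 1 1 = 0; linarith

lemma cubForm_eq_zero {c : Fin 2 → ℝ} {d : Fin 2 → Fin 2 → ℝ} {e : Fin 2 → Fin 2 → Fin 2 → ℝ}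
    (hc : ∀ j, c j = 0) (hd : ∀ j k, d j k = 0) (h₀ : e 0 0 0 = 0)
    (h₁ : e 0 0 1 + e 0 1 0 + e 1 0 0 = 0) (h₂ : e 0 1 1 + e 1 0 1 + e 1 1 0 = 0)
    (h₃ : e 1 1 1 = 0) (z : Jet) : cubForm c d e z = 0 := by
  simp only [cubForm, hc, hd, Fin.sum_univ_two]
  linear_combination h₀ * z 1 0 ^ 3 + h₁ * z 1 0 ^ 2 * z 1 1 + h₂ * z 1 0 * z 1 1 ^ 2 +
    h₃ * z 1 1 ^ 3

end B2Deformation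
end

noncomputable section

namespace B2Deformation

/-! ### Primitives -/

/-- The mean value of `h(·, v)` between `a` and `u`. -/
def meanU (h : ℝ × ℝ → ℝ) (a : ℝ) : ℝ × ℝ → ℝ :=
  fun p => ∫ s in (0 : ℝ)..1, h (a + (p.1 - a) * s, p.2)

/-- The primitive of `h` with respect to `u` which vanishes at `u = a`. -/
def primU (h : ℝ × ℝ → ℝ) (a : ℝ) : ℝ × ℝ → ℝ := fun p => (p.1 - a) * meanU h a p

/-- The substitution t = a + (u - a)s moves the variable endpoint into the integrand. The mean value
form is used for regularity, the integral form for the fundamental theorem of calculus. -/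
lemma primU_eq (h : ℝ × ℝ → ℝ) (a : ℝ) (p : ℝ × ℝ) :
    primU h a p = ∫ t in a..p.1, h (t, p.2) := by
  have := intervalIntegral.smul_integral_comp_add_mul (a := 0) (b := 1) (fun t => h (t, p.2))
    (p.1 - a) a
  simpa [primU, meanU] using this

/-- The product carries the maximum norm, so a ball is a square and contains the horizontal segment
from any of its points to the vertical line through the centre. -/
lemma mem_ball_segment {p₀ p : ℝ × ℝ} {r s : ℝ} (hp : p ∈ Metric.ball p₀ r)
    (hs : s ∈ Set.Icc (0 : ℝ) 1) : (p₀.1 + (p.1 - p₀.1) * s, p.2) ∈ Metric.ball p₀ r := by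
  rw [Metric.mem_ball, Prod.dist_eq, max_lt_iff, Real.dist_eq] at hp ⊢
  refine ⟨?_, hp.2⟩
  simp only [add_sub_cancel_left, abs_mul, abs_of_nonneg hs.1]
  exact (mul_le_of_le_one_right (abs_nonneg _) hs.2).trans_lt hp.1

lemma hasDerivAt_primU {h : ℝ × ℝ → ℝ} {p₀ p : ℝ × ℝ} {r : ℝ}
    (hh : ContinuousOn h (Metric.ball p₀ r)) (hp : p ∈ Metric.ball p₀ r) :
    HasDerivAt (fun t => primU h p₀.1 (t, p.2)) (h p) p.1 := by
  simp only [primU_eq]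
  have hpr : |p.1 - p₀.1| < r ∧ dist p.2 p₀.2 < r := by
    rwa [Metric.mem_ball, Prod.dist_eq, max_lt_iff, Real.dist_eq] at hp
  have hc : ContinuousOn (fun t => h (t, p.2)) (Metric.ball p₀.1 r) := by
    refine hh.comp (by fun_prop) fun t ht => ?_
    rw [Metric.mem_ball, Prod.dist_eq, max_lt_iff]
    exact ⟨ht, hpr.2⟩
  have hmem : p.1 ∈ Metric.ball p₀.1 r := by rw [Metric.mem_ball, Real.dist_eq]; exact hpr.1
  have hsub : Set.uIcc p₀.1 p.1 ⊆ Metric.ball p₀.1 r := by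
    rw [← segment_eq_uIcc]
    exact (convex_ball _ _).segment_subset
      (Metric.mem_ball_self ((abs_nonneg _).trans_lt hpr.1)) hmem
  exact intervalIntegral.integral_hasDerivAt_right (hc.mono hsub).intervalIntegrable
    (hc.stronglyMeasurableAtFilter Metric.isOpen_ball _ hmem)
    (hc.continuousAt (Metric.isOpen_ball.mem_nhds hmem))

/-- The mean is the value at 0 of a convolution of the indicator of [0, 1] with a smooth family
depending on the parameter (u, v), and such convolutions are smooth in the parameter. The reflection
-x in `g` undoes the one in the convolution; the bump ψ provides compact support and equals 1 on the
range of integration. -/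
lemma contDiff_meanU {h : ℝ × ℝ → ℝ} (hh : ContDiff ℝ ∞ h) (a : ℝ) : ContDiff ℝ ∞ (meanU h a) := by
  let ψ : ContDiffBump (0 : ℝ) := ⟨1, 2, by norm_num, by norm_num⟩
  let g : ℝ × ℝ → ℝ → ℝ := fun p x => ψ x * h (a + (p.1 - a) * (-x), p.2)
  let f : ℝ → ℝ := Set.indicator (Set.Icc 0 1) 1
  have hf : MeasureTheory.LocallyIntegrable f MeasureTheory.volume := by
    refine MeasureTheory.Integrable.locallyIntegrable ?_
    exact (MeasureTheory.integrable_indicator_iff measurableSet_Icc).2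
      (MeasureTheory.integrableOn_const (by simp))
  have hg : ContDiffOn ℝ ((⊤ : ℕ∞) : WithTop ℕ∞) ↿g (Set.univ ×ˢ Set.univ) := by
    refine ContDiff.contDiffOn ?_
    have h1 : ContDiff ℝ ∞ fun q : (ℝ × ℝ) × ℝ => ψ q.2 := ψ.contDiff.comp contDiff_snd
    have h2 : ContDiff ℝ ∞ fun q : (ℝ × ℝ) × ℝ => h (a + (q.1.1 - a) * (-q.2), q.1.2) :=
      hh.comp (by fun_prop)
    exact h1.mul h2
  have key := MeasureTheory.contDiffOn_convolution_right_with_param (𝕜 := ℝ) (μ := MeasureTheory.volume)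
    (ContinuousLinearMap.mul ℝ ℝ) (k := Metric.closedBall (0 : ℝ) 2) isOpen_univ
    (isCompact_closedBall _ _) (fun p x _ hx => by
      have : ψ x = 0 := ψ.zero_of_le_dist (by
        rw [Metric.mem_closedBall, not_le] at hx; exact hx.le)
      simp [g, this]) hf hg
  rw [Set.univ_prod_univ, contDiffOn_univ] at key
  have h0 : meanU h a = fun p => MeasureTheory.convolution f (g p)
      (ContinuousLinearMap.mul ℝ ℝ) MeasureTheory.volume 0 := by
    funext p
    rw [MeasureTheory.convolution_def, meanU, intervalIntegral.integral_of_le zero_le_one,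
      ← MeasureTheory.integral_Icc_eq_integral_Ioc,
      ← MeasureTheory.integral_indicator measurableSet_Icc]
    congr 1
    funext t
    by_cases ht : t ∈ Set.Icc (0 : ℝ) 1
    · have : ψ (-t) = 1 := ψ.one_of_mem_closedBall (by
        rw [mem_closedBall_zero_iff, norm_neg, Real.norm_eq_abs, abs_of_nonneg ht.1]
        exact ht.2)
      simp [f, g, ht, this]
    · simp [f, ht]
  rw [h0]
  exact key.comp (contDiff_id.prodMk contDiff_const)

/-- Multiplication by a bump function makes `h` globally smooth without changing it near p₀. By
`mem_ball_segment` the means at nearby points see only the unchanged values. -/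
lemma nearCk_meanU_top {h : ℝ × ℝ → ℝ} {p₀ : ℝ × ℝ} (hh : NearCk ∞ p₀ h) :
    NearCk ∞ p₀ (meanU h p₀.1) := by
  obtain ⟨r, hr, hball⟩ := Metric.eventually_nhds_iff_ball.1 hh
  let χ : ContDiffBump p₀ := ⟨r / 3, r / 2, by positivity, by linarith⟩
  have hg : ContDiff ℝ ∞ fun p => χ p * h p := by
    refine contDiff_iff_contDiffAt.2 fun p => ?_
    by_cases hp : p ∈ Metric.ball p₀ r
    · exact χ.contDiff.contDiffAt.mul (hball p hp)
    · have : (fun p => χ p * h p) =ᶠ[𝓝 p] fun _ => 0 := by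
        have hp' : p ∈ (Metric.closedBall p₀ (r / 2))ᶜ := fun h' => hp
          (Metric.closedBall_subset_ball (by linarith) h')
        filter_upwards [Metric.isClosed_closedBall.isOpen_compl.mem_nhds hp'] with q hq
        have : χ q = 0 := χ.zero_of_le_dist (by
          rw [Set.mem_compl_iff, Metric.mem_closedBall, not_le] at hq; exact hq.le)
        rw [this, zero_mul]
      exact contDiffAt_const.congr_of_eventuallyEq this
  have heq : ∀ p ∈ Metric.ball p₀ (r / 3), meanU h p₀.1 p = meanU (fun p => χ p * h p) p₀.1 p := by
    intro p hp
    refine intervalIntegral.integral_congr fun s hs => ?_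
    rw [Set.uIcc_of_le zero_le_one] at hs
    have : χ (p₀.1 + (p.1 - p₀.1) * s, p.2) = 1 :=
      χ.one_of_mem_closedBall (Metric.ball_subset_closedBall (mem_ball_segment hp hs))
    simp [this]
  filter_upwards [Metric.ball_mem_nhds p₀ (by positivity : 0 < r / 3)] with p hp
  refine (contDiff_meanU hg p₀.1).contDiffAt.congr_of_eventuallyEq ?_
  filter_upwards [Metric.isOpen_ball.mem_nhds hp] with q hq using heq q hq

/-- The contraction of the first coordinate by the factor `s`. -/
def squeeze (s : ℝ) : ℝ × ℝ →L[ℝ] ℝ × ℝ :=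
  (s • ContinuousLinearMap.fst ℝ ℝ ℝ).prod (ContinuousLinearMap.snd ℝ ℝ ℝ)

lemma squeeze_apply (s : ℝ) (y : ℝ × ℝ) : squeeze s y = (s * y.1, y.2) := rfl

lemma norm_squeeze_le {s : ℝ} (hs : s ∈ Set.Icc (0 : ℝ) 1) : ‖squeeze s‖ ≤ 1 := by
  refine ContinuousLinearMap.opNorm_le_bound _ zero_le_one fun y => ?_
  rw [squeeze_apply, Prod.norm_def, Prod.norm_def, one_mul]
  refine max_le_max ?_ le_rfl
  rw [norm_mul, Real.norm_eq_abs, abs_of_nonneg hs.1]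
  exact mul_le_of_le_one_left (norm_nonneg _) hs.2

/-- The power series of `h` at p₀ is integrated term by term after the substitution (s y₁, y₂). This
contraction has norm at most 1, so the averaged coefficients are bounded by the original ones: the
radius does not shrink, and the original series dominates the sum. -/
lemma analyticAt_meanU {h : ℝ × ℝ → ℝ} {p₀ : ℝ × ℝ} (hh : AnalyticAt ℝ h p₀) :
    AnalyticAt ℝ (meanU h p₀.1) p₀ := by
  obtain ⟨P, r, hP⟩ := hh
  let c : (n : ℕ) → ℝ → ContinuousMultilinearMap ℝ (fun _ : Fin n => ℝ × ℝ) ℝ :=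
    fun n s => (P n).compContinuousLinearMap fun _ => squeeze s
  have hsq : Continuous squeeze := by
    have : squeeze = fun s => s • (ContinuousLinearMap.inl ℝ ℝ ℝ).comp
        (ContinuousLinearMap.fst ℝ ℝ ℝ) + (ContinuousLinearMap.inr ℝ ℝ ℝ).comp
        (ContinuousLinearMap.snd ℝ ℝ ℝ) := by
      funext s
      ext <;> simp [squeeze_apply]
    rw [this]
    fun_prop
  have hc : ∀ n, Continuous (c n) := by
    intro n
    have h1 := (ContinuousMultilinearMap.compContinuousLinearMapContinuousMultilinear ℝ
      (fun _ : Fin n => ℝ × ℝ) (fun _ : Fin n => ℝ × ℝ) ℝ).cont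
    have h2 := h1.comp (continuous_pi fun _ : Fin n => hsq)
    exact ((ContinuousLinearMap.apply ℝ _ (P n)).continuous.comp h2)
  have hcn : ∀ n, ∀ s ∈ Set.Icc (0 : ℝ) 1, ‖c n s‖ ≤ ‖P n‖ := by
    intro n s hs
    refine (ContinuousMultilinearMap.norm_compContinuousLinearMap_le _ _).trans ?_
    refine mul_le_of_le_one_right (norm_nonneg _) ?_
    exact Finset.prod_le_one (fun _ _ => norm_nonneg _) fun _ _ => norm_squeeze_le hs
  let Q : FormalMultilinearSeries ℝ (ℝ × ℝ) ℝ := fun n => ∫ s in (0 : ℝ)..1, c n s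
  have hQn : ∀ n, ‖Q n‖ ≤ ‖P n‖ := by
    intro n
    have := intervalIntegral.norm_integral_le_of_norm_le_const (a := 0) (b := 1) (f := c n)
      (C := ‖P n‖) fun s hs => hcn n s (by
        rw [Set.uIoc_of_le zero_le_one] at hs; exact ⟨hs.1.le, hs.2⟩)
    simpa using this
  refine ⟨Q, r, ?_, hP.r_pos, ?_⟩
  · refine hP.r_le.trans ?_
    refine ENNReal.le_of_forall_nnreal_lt fun ρ hρ => ?_
    obtain ⟨C, _, hC⟩ := P.norm_mul_pow_le_of_lt_radius hρ
    exact Q.le_radius_of_bound C fun n =>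
      (mul_le_mul_of_nonneg_right (hQn n) (by positivity)).trans (hC n)
  · intro y hy
    have hy' : ‖y‖ₑ < r := by simpa using hy
    have hQy : ∀ n, Q n (fun _ => y) = ∫ s in (0 : ℝ)..1, c n s fun _ => y := by
      intro n
      exact ((ContinuousMultilinearMap.apply ℝ (fun _ : Fin n => ℝ × ℝ) ℝ
        fun _ => y).intervalIntegral_comp_comm ((hc n).intervalIntegrable 0 1)).symm
    have hmean : meanU h p₀.1 (p₀ + y) = ∫ s in (0 : ℝ)..1, h (p₀ + squeeze s y) := by
      refine intervalIntegral.integral_congr fun s _ => ?_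
      simp only [squeeze_apply]
      congr 1
      ext
      · simp [mul_comm]
      · simp
    simp only [hQy]
    rw [hmean]
    have hsum : Summable fun n => ‖P n‖ * ‖y‖ ^ n := by
      have : ((‖y‖₊ : NNReal) : ENNReal) < P.radius := lt_of_lt_of_le hy' hP.r_le
      simpa using P.summable_norm_mul_pow this
    refine intervalIntegral.hasSum_integral_of_dominated_convergence
      (fun n _ => ‖P n‖ * ‖y‖ ^ n) (fun n => ?_) (fun n => ?_) ?_ ?_ ?_
    · exact (((ContinuousMultilinearMap.apply ℝ (fun _ : Fin n => ℝ × ℝ) ℝ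
        fun _ => y).continuous.comp (hc n))).aestronglyMeasurable
    · refine Eventually.of_forall fun s hs => ?_
      rw [Set.uIoc_of_le zero_le_one] at hs
      refine ((c n s).le_opNorm _).trans ?_
      simp only [Finset.prod_const, Finset.card_univ, Fintype.card_fin]
      exact mul_le_mul_of_nonneg_right (hcn n s ⟨hs.1.le, hs.2⟩) (by positivity)
    · exact Eventually.of_forall fun s _ => hsum
    · exact intervalIntegrable_const
    · refine Eventually.of_forall fun s hs => ?_
      rw [Set.uIoc_of_le zero_le_one] at hs
      have hle : ‖squeeze s y‖ ≤ ‖y‖ :=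
        ((squeeze s).le_opNorm y).trans
          (mul_le_of_le_one_left (norm_nonneg _) (norm_squeeze_le ⟨hs.1.le, hs.2⟩))
      have hmem : squeeze s y ∈ Metric.eball (0 : ℝ × ℝ) r := by
        have : ‖squeeze s y‖ₑ ≤ ‖y‖ₑ := by
          rw [← ofReal_norm, ← ofReal_norm]; exact ENNReal.ofReal_le_ofReal hle
        simpa using this.trans_lt hy'
      exact hP.hasSum hmem

lemma nearCk_meanU {k : WithTop ℕ∞} (hk : k = ∞ ∨ k = ω) {h : ℝ × ℝ → ℝ} {p₀ : ℝ × ℝ}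
    (hh : NearCk k p₀ h) : NearCk k p₀ (meanU h p₀.1) := by
  rcases hk with rfl | rfl
  · exact nearCk_meanU_top hh
  · have h1 : AnalyticAt ℝ h p₀ := hh.self_of_nhds.analyticAt
    filter_upwards [(analyticAt_meanU h1).eventually_analyticAt] with p hp using hp.contDiffAt

lemma pd_zero_eq_deriv {K : ℝ × ℝ → ℝ} {p : ℝ × ℝ} (hK : DifferentiableAt ℝ K p) {c : ℝ}
    (h : HasDerivAt (fun t => K (t, p.2)) c p.1) : pd 0 K p = c := by
  have h1 : HasDerivAt (fun t : ℝ => ((t, p.2) : ℝ × ℝ)) (1, 0) p.1 :=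
    (hasDerivAt_id p.1).prodMk (hasDerivAt_const p.1 p.2)
  have h2 : HasDerivAt (fun t => K (t, p.2)) (fderiv ℝ K p (1, 0)) p.1 :=
    HasFDerivAt.comp_hasDerivAt (f := fun t : ℝ => ((t, p.2) : ℝ × ℝ)) p.1 hK.hasFDerivAt h1
  exact h2.unique h

lemma exists_pd_zero_eq {k : WithTop ℕ∞} (hk : k = ∞ ∨ k = ω) {h : ℝ × ℝ → ℝ} {p₀ : ℝ × ℝ}
    (hh : NearCk k p₀ h) : ∃ K, NearCk k p₀ K ∧ ∀ᶠ p in 𝓝 p₀, pd 0 K p = h p := by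
  have hk1 : 1 ≤ k := by rcases hk with rfl | rfl <;> simp
  have hK : NearCk k p₀ (primU h p₀.1) := by
    filter_upwards [nearCk_meanU hk hh] with p hp
    exact (contDiffAt_fst.sub contDiffAt_const).mul hp
  refine ⟨primU h p₀.1, hK, ?_⟩
  obtain ⟨r, hr, hball⟩ := Metric.eventually_nhds_iff_ball.1 hh
  filter_upwards [hK, Metric.ball_mem_nhds p₀ hr] with p hp hpr
  exact pd_zero_eq_deriv (hp.differentiableAt (by rintro rfl; simp at hk1))
    (hasDerivAt_primU (fun q hq => (hball q hq).continuousAt.continuousWithinAt) hpr)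

end B2Deformation
end

noncomputable section

namespace B2Deformation

/-! ### Rules for partial derivatives -/

section PartialDerivatives

variable {a b : ℝ × ℝ → ℝ} {p : ℝ × ℝ}

lemma pd_const (c : ℝ) (j : Fin 2) : pd j (fun _ => c) p = 0 := by simp [pd]

lemma pd_add (ha : DifferentiableAt ℝ a p) (hb : DifferentiableAt ℝ b p) (j : Fin 2) :
    pd j (fun p => a p + b p) p = pd j a p + pd j b p := by
  simp only [pd]; rw [fderiv_fun_add ha hb]; rfl

lemma pd_mul (ha : DifferentiableAt ℝ a p) (hb : DifferentiableAt ℝ b p) (j : Fin 2) :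
    pd j (fun p => a p * b p) p = pd j a p * b p + a p * pd j b p := by
  simp only [pd]; rw [fderiv_fun_mul ha hb]; simp; ring

lemma pd_comp {F : ℝ → ℝ} {F' : ℝ} (hF : HasDerivAt F F' (a p)) (ha : DifferentiableAt ℝ a p)
    (j : Fin 2) : pd j (fun p => F (a p)) p = F' * pd j a p := by
  have h : HasFDerivAt (fun p => F (a p)) _ p := hF.comp_hasFDerivAt p ha.hasFDerivAt
  simp only [pd]; rw [h.fderiv]; simp

lemma pd_zero_fst : pd 0 (fun p => p.1) p = 1 := by simp [pd, fderiv_fst]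

lemma pd_one_fst : pd 1 (fun p => p.1) p = 0 := by simp [pd, fderiv_fst]

lemma pd_zero_snd : pd 0 (fun p => p.2) p = 0 := by simp [pd, fderiv_snd]

lemma pd_one_snd : pd 1 (fun p => p.2) p = 1 := by simp [pd, fderiv_snd]

lemma hasFDerivAt_rad : HasFDerivAt (fun p : ℝ × ℝ => p.1 ^ 2 / 2 + p.2)
    (p.1 • ContinuousLinearMap.fst ℝ ℝ ℝ + ContinuousLinearMap.snd ℝ ℝ ℝ) p := by
  have h1 : HasDerivAt (fun x : ℝ => x ^ 2 / 2) p.1 p.1 := by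
    simpa using (hasDerivAt_pow 2 p.1).div_const 2
  exact (h1.comp_hasFDerivAt p hasFDerivAt_fst).add hasFDerivAt_snd

lemma pd_zero_rad : pd 0 (fun p => p.1 ^ 2 / 2 + p.2) p = p.1 := by
  simp only [pd]; rw [hasFDerivAt_rad.fderiv]; simp

lemma pd_one_rad : pd 1 (fun p => p.1 ^ 2 / 2 + p.2) p = 1 := by
  simp only [pd]; rw [hasFDerivAt_rad.fderiv]; simp

lemma pd_eq_of_eqOn {U : Set (ℝ × ℝ)} (hU : IsOpen U) (h : Set.EqOn a b U) (hp : p ∈ U)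
    (j : Fin 2) : pd j a p = pd j b p :=
  (pd_congr (h.eventuallyEq_of_mem (hU.mem_nhds hp)) j).self_of_nhds

lemma pd_eqOn {U : Set (ℝ × ℝ)} (hU : IsOpen U) (h : Set.EqOn a b U) (j : Fin 2) :
    Set.EqOn (pd j a) (pd j b) U := fun _ hp => pd_eq_of_eqOn hU h hp j

end PartialDerivatives

/-- The orders of differentiability in question are stable under differentiation. -/
lemma add_one_le_of_order {k : WithTop ℕ∞} (hk : k = ∞ ∨ k = ω) : k + 1 ≤ k := by
  rcases hk with rfl | rfl <;> simp

lemma infty_le_of_order {k : WithTop ℕ∞} (hk : k = ∞ ∨ k = ω) : ∞ ≤ k := by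
  rcases hk with rfl | rfl <;> simp

lemma ne_zero_of_order {k : WithTop ℕ∞} (hk : k = ∞ ∨ k = ω) : k ≠ 0 := by
  rcases hk with rfl | rfl <;> simp

lemma contDiffAt_iterate_deriv {k : WithTop ℕ∞} (hk : k = ∞ ∨ k = ω) {F : ℝ → ℝ} {x : ℝ}
    (hF : ContDiffAt ℝ k F x) (n : ℕ) : ContDiffAt ℝ k (deriv^[n] F) x := by
  induction n with
  | zero => exact hF
  | succ n ih =>
    rw [Function.iterate_succ_apply']
    exact (ih.fderiv_right (add_one_le_of_order hk)).clm_apply contDiffAt_const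

/-! ### Expressions with formal partial derivatives -/

/-- Expressions in `u`, `v`, `1/u`, functions of `u²/2 + v`, functions of `v`, general functions
`a(u, v)`, and the `v`-derivatives of a function `s` with `s_u = u s_v + ψ'(v)`. -/
inductive Ex : Type
  | c (c : ℝ)
  | u
  | v
  | uinv
  | rad (F : ℝ → ℝ) (n : ℕ)
  | ver (H : ℝ → ℝ) (n : ℕ)
  | fn (a : ℝ × ℝ → ℝ)
  | sig (s : ℝ × ℝ → ℝ) (ψ : ℝ → ℝ) (n : ℕ)
  | add (e f : Ex)
  | mul (e f : Ex)

namespace Ex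

instance : Add Ex := ⟨add⟩
instance : Mul Ex := ⟨mul⟩
instance : Sub Ex := ⟨fun e f => add e (mul (c (-1)) f)⟩

/-- The function which an expression denotes. -/
def eval : Ex → ℝ × ℝ → ℝ
  | c x => fun _ => x
  | u => fun p => p.1
  | v => fun p => p.2
  | uinv => fun p => p.1⁻¹
  | rad F n => fun p => deriv^[n] F (p.1 ^ 2 / 2 + p.2)
  | ver H n => fun p => deriv^[n] H p.2
  | fn a => a
  | sig s _ n => (pd 1)^[n] s
  | add e f => fun p => e.eval p + f.eval p
  | mul e f => fun p => e.eval p * f.eval p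

/-- The partial derivatives of an expression. -/
def d (j : Fin 2) : Ex → Ex
  | c _ => c 0
  | u => c (if j = 0 then 1 else 0)
  | v => c (if j = 0 then 0 else 1)
  | uinv => if j = 0 then mul (c (-1)) (mul uinv uinv) else c 0
  | rad F n => if j = 0 then mul u (rad F (n + 1)) else rad F (n + 1)
  | ver H n => if j = 0 then c 0 else ver H (n + 1)
  | fn a => fn (pd j a)
  | sig s ψ n => if j = 0 then add (mul u (sig s ψ (n + 1))) (ver ψ (n + 1)) else sig s ψ (n + 1)
  | add e f => add (d j e) (d j f)
  | mul e f => add (mul (d j e) f) (mul e (d j f))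

/-- The constituents of an expression are of class `C^k` on `U`. -/
def Valid (k : WithTop ℕ∞) (U : Set (ℝ × ℝ)) : Ex → Prop
  | c _ => True
  | u => True
  | v => True
  | uinv => ∀ p ∈ U, p.1 ≠ 0
  | rad F _ => ∀ p ∈ U, ContDiffAt ℝ k F (p.1 ^ 2 / 2 + p.2)
  | ver H _ => ∀ p ∈ U, ContDiffAt ℝ k H p.2
  | fn a => CkOn k U a
  | sig s ψ _ => CkOn k U s ∧ (∀ p ∈ U, ContDiffAt ℝ k ψ p.2) ∧
      ∀ p ∈ U, pd 0 s p = p.1 * pd 1 s p + deriv ψ p.2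
  | add e f => e.Valid k U ∧ f.Valid k U
  | mul e f => e.Valid k U ∧ f.Valid k U

lemma eval_add (e f : Ex) (p : ℝ × ℝ) : (e + f).eval p = e.eval p + f.eval p := rfl
lemma eval_mul (e f : Ex) (p : ℝ × ℝ) : (e * f).eval p = e.eval p * f.eval p := rfl
lemma eval_sub (e f : Ex) (p : ℝ × ℝ) : (e - f).eval p = e.eval p - f.eval p := by
  change e.eval p + (-1) * f.eval p = _; ring
lemma eval_c (x : ℝ) (p : ℝ × ℝ) : (c x).eval p = x := rfl
lemma eval_u (p : ℝ × ℝ) : u.eval p = p.1 := rfl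
lemma eval_v (p : ℝ × ℝ) : v.eval p = p.2 := rfl
lemma eval_uinv (p : ℝ × ℝ) : uinv.eval p = p.1⁻¹ := rfl
lemma eval_fn (a : ℝ × ℝ → ℝ) (p : ℝ × ℝ) : (fn a).eval p = a p := rfl

lemma d_add (j : Fin 2) (e f : Ex) : (e + f).d j = e.d j + f.d j := rfl
lemma d_mul (j : Fin 2) (e f : Ex) : (e * f).d j = e.d j * f + e * f.d j := rfl
lemma d_sub (j : Fin 2) (e f : Ex) : (e - f).d j = e.d j + (c 0 * f + c (-1) * f.d j) := rfl
lemma d_c (j : Fin 2) (x : ℝ) : (c x).d j = c 0 := rfl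
lemma d_zero_u : u.d 0 = c 1 := rfl
lemma d_one_u : u.d 1 = c 0 := rfl
lemma d_zero_v : v.d 0 = c 0 := rfl
lemma d_one_v : v.d 1 = c 1 := rfl
lemma d_zero_uinv : uinv.d 0 = c (-1) * (uinv * uinv) := rfl
lemma d_one_uinv : uinv.d 1 = c 0 := rfl
lemma d_zero_rad (F : ℝ → ℝ) (n : ℕ) : (rad F n).d 0 = u * rad F (n + 1) := rfl
lemma d_one_rad (F : ℝ → ℝ) (n : ℕ) : (rad F n).d 1 = rad F (n + 1) := rfl
lemma d_zero_ver (F : ℝ → ℝ) (n : ℕ) : (ver F n).d 0 = c 0 := rfl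
lemma d_one_ver (F : ℝ → ℝ) (n : ℕ) : (ver F n).d 1 = ver F (n + 1) := rfl
lemma d_zero_sig (s : ℝ × ℝ → ℝ) (ψ : ℝ → ℝ) (n : ℕ) :
    (sig s ψ n).d 0 = u * sig s ψ (n + 1) + ver ψ (n + 1) := rfl
lemma d_one_sig (s : ℝ × ℝ → ℝ) (ψ : ℝ → ℝ) (n : ℕ) : (sig s ψ n).d 1 = sig s ψ (n + 1) := rfl
lemma d_fn (j : Fin 2) (a : ℝ × ℝ → ℝ) : (fn a).d j = fn (pd j a) := rfl

variable {k : WithTop ℕ∞} {U : Set (ℝ × ℝ)}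

lemma valid_add {e f : Ex} : (e + f).Valid k U ↔ e.Valid k U ∧ f.Valid k U := Iff.rfl
lemma valid_mul {e f : Ex} : (e * f).Valid k U ↔ e.Valid k U ∧ f.Valid k U := Iff.rfl
lemma valid_sub {e f : Ex} : (e - f).Valid k U ↔ e.Valid k U ∧ f.Valid k U := by
  change _ ∧ True ∧ _ ↔ _; simp
lemma valid_c (x : ℝ) : (c x).Valid k U := trivial
lemma valid_u : u.Valid k U := trivial
lemma valid_v : v.Valid k U := trivial

/-- No order of differentiability is lost because k + 1 ≤ k for both admissible classes. -/
lemma Valid.d (hk : k = ∞ ∨ k = ω) {e : Ex} (h : e.Valid k U) (j : Fin 2) : (e.d j).Valid k U := by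
  induction e with
  | c | u | v => trivial
  | uinv =>
    unfold Ex.d
    split
    · exact ⟨trivial, h, h⟩
    · trivial
  | rad F n =>
    unfold Ex.d
    split
    · exact ⟨trivial, h⟩
    · exact h
  | ver H n =>
    unfold Ex.d
    split
    · trivial
    · exact h
  | fn a => exact CkOn.pd h (add_one_le_of_order hk) j
  | sig s ψ n =>
    unfold Ex.d
    split
    · exact ⟨⟨trivial, h⟩, h.2.1⟩
    · exact h
  | add e f ihe ihf => exact ⟨ihe h.1, ihf h.2⟩
  | mul e f ihe ihf => exact ⟨⟨ihe h.1, h.2⟩, h.1, ihf h.2⟩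

lemma Valid.ckOn (hk : k = ∞ ∨ k = ω) {e : Ex} (h : e.Valid k U) : CkOn k U e.eval := by
  induction e with
  | c => exact fun p _ => contDiffAt_const
  | u => exact fun p _ => contDiffAt_fst
  | v => exact fun p _ => contDiffAt_snd
  | uinv => exact fun p hp => contDiffAt_fst.inv (h p hp)
  | rad F n =>
    intro p hp
    exact (contDiffAt_iterate_deriv hk (h p hp) n).comp p
      (f := fun p : ℝ × ℝ => p.1 ^ 2 / 2 + p.2)
      (((contDiffAt_fst.pow 2).div_const 2).add contDiffAt_snd)
  | ver H n =>
    intro p hp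
    exact (contDiffAt_iterate_deriv hk (h p hp) n).comp p contDiffAt_snd
  | fn a => exact h
  | sig s ψ n =>
    change CkOn k U ((B2Deformation.pd 1)^[n] s)
    induction n with
    | zero => exact h.1
    | succ n ih =>
      rw [Function.iterate_succ_apply']
      exact CkOn.pd (ih h) (add_one_le_of_order hk) 1
  | add e f ihe ihf => exact fun p hp => (ihe h.1 p hp).add (ihf h.2 p hp)
  | mul e f ihe ihf => exact fun p hp => (ihe h.1 p hp).mul (ihf h.2 p hp)

lemma Valid.differentiableAt (hk : k = ∞ ∨ k = ω) {e : Ex} (h : e.Valid k U) {p : ℝ × ℝ}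
    (hp : p ∈ U) : DifferentiableAt ℝ e.eval p :=
  (h.ckOn hk p hp).differentiableAt (ne_zero_of_order hk)

lemma hasDerivAt_iterate_deriv (hk : k = ∞ ∨ k = ω) {F : ℝ → ℝ} {x : ℝ} (hF : ContDiffAt ℝ k F x)
    (n : ℕ) : HasDerivAt (deriv^[n] F) (deriv^[n + 1] F x) x := by
  rw [Function.iterate_succ_apply']
  exact ((contDiffAt_iterate_deriv hk hF n).differentiableAt (ne_zero_of_order hk)).hasDerivAt

lemma pd_eval_rad (hk : k = ∞ ∨ k = ω) {F : ℝ → ℝ} {n : ℕ} (h : (rad F n).Valid k U)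
    {p : ℝ × ℝ} (hp : p ∈ U) (j : Fin 2) : pd j (rad F n).eval p =
      deriv^[n + 1] F (p.1 ^ 2 / 2 + p.2) * pd j (fun p => p.1 ^ 2 / 2 + p.2) p :=
  pd_comp (hasDerivAt_iterate_deriv hk (h p hp) n) (by fun_prop) j

lemma pd_eval_ver (hk : k = ∞ ∨ k = ω) {F : ℝ → ℝ} {n : ℕ} (h : (ver F n).Valid k U)
    {p : ℝ × ℝ} (hp : p ∈ U) (j : Fin 2) : pd j (ver F n).eval p =
      deriv^[n + 1] F p.2 * pd j (fun p => p.2) p :=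
  pd_comp (hasDerivAt_iterate_deriv hk (h p hp) n) (by fun_prop) j

/-- Only the case n = 0 is assumed of `s`. Applying ∂_v to the formula for n and exchanging the
partials gives the one for n + 1, so the v-derivatives of `s` and the derivatives of ψ are closed
under both partials. -/
lemma pd_zero_eval_sig (hk : k = ∞ ∨ k = ω) (hU : IsOpen U) {s : ℝ × ℝ → ℝ} {ψ : ℝ → ℝ} {n : ℕ}
    (h : (sig s ψ n).Valid k U) {p : ℝ × ℝ} (hp : p ∈ U) : pd 0 (sig s ψ n).eval p =
      p.1 * (sig s ψ (n + 1)).eval p + deriv^[n + 1] ψ p.2 := by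
  induction n generalizing p with
  | zero => exact h.2.2 p hp
  | succ n ih =>
    have hn : (sig s ψ n).Valid k U := h
    have hn1 : (sig s ψ (n + 1)).Valid k U := h
    have hv : (ver ψ (n + 1)).Valid k U := h.2.1
    have e1 : (sig s ψ (n + 1)).eval = pd 1 (sig s ψ n).eval := Function.iterate_succ_apply' ..
    have e2 : (sig s ψ (n + 1 + 1)).eval = pd 1 (sig s ψ (n + 1)).eval :=
      Function.iterate_succ_apply' ..
    rw [e1, pd_comm ((hn.ckOn hk p hp).of_le (two_le_infty.trans (infty_le_of_order hk))) 0 1,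
      pd_eq_of_eqOn hU (fun q hq => ih hn hq) hp, e2,
      pd_add (a := fun q => q.1 * (sig s ψ (n + 1)).eval q) (b := fun q => deriv^[n + 1] ψ q.2)
        (differentiableAt_fst.mul (hn1.differentiableAt hk hp)) (hv.differentiableAt hk hp),
      pd_mul differentiableAt_fst (hn1.differentiableAt hk hp), pd_one_fst]
    have := pd_eval_ver hk hv hp 1
    rw [pd_one_snd, mul_one] at this
    change _ + pd 1 (fun q : ℝ × ℝ => deriv^[n + 1] ψ q.2) p = _
    change pd 1 (fun q : ℝ × ℝ => deriv^[n + 1] ψ q.2) p = _ at this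
    rw [this]; ring

/-- The formal partial derivatives are the partial derivatives. -/
lemma pd_eval (hk : k = ∞ ∨ k = ω) (hU : IsOpen U) {e : Ex} (h : e.Valid k U) (j : Fin 2) :
    Set.EqOn (pd j e.eval) (e.d j).eval U := by
  intro p hp
  have hj : j = 0 ∨ j = 1 := by fin_cases j <;> simp
  induction e with
  | c x => exact pd_const x j
  | u => rcases hj with rfl | rfl
         · exact pd_zero_fst
         · exact pd_one_fst
  | v => rcases hj with rfl | rfl
         · exact pd_zero_snd
         · exact pd_one_snd
  | uinv =>
    have h1 := pd_comp (a := fun p : ℝ × ℝ => p.1) (hasDerivAt_inv (h p hp)) differentiableAt_fst j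
    refine h1.trans ?_
    rcases hj with rfl | rfl
    · rw [pd_zero_fst, d_zero_uinv, eval_mul, eval_mul, eval_c, eval_uinv]
      field_simp
    · rw [pd_one_fst, mul_zero]; rfl
  | rad F n =>
    rw [pd_eval_rad hk h hp]
    rcases hj with rfl | rfl
    · rw [pd_zero_rad, mul_comm]; rfl
    · rw [pd_one_rad, mul_one]; rfl
  | ver H n =>
    rw [pd_eval_ver hk h hp]
    rcases hj with rfl | rfl
    · rw [pd_zero_snd, mul_zero]; rfl
    · rw [pd_one_snd, mul_one]; rfl
  | fn a => rfl
  | sig s ψ n =>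
    rcases hj with rfl | rfl
    · exact pd_zero_eval_sig hk hU h hp
    · change _ = (pd 1)^[n + 1] s p
      rw [Function.iterate_succ_apply']; rfl
  | add e f ihe ihf =>
    refine (pd_add (h.1.differentiableAt hk hp) (h.2.differentiableAt hk hp) j).trans ?_
    rw [ihe h.1, ihf h.2]; rfl
  | mul e f ihe ihf =>
    refine (pd_mul (h.1.differentiableAt hk hp) (h.2.differentiableAt hk hp) j).trans ?_
    rw [ihe h.1, ihf h.2]; rfl

/-- This is how a coefficient that has been solved for on `U` is differentiated: its partials may be
replaced by formal ones. -/
lemma pd_eq_eval (hk : k = ∞ ∨ k = ω) (hU : IsOpen U) {a : ℝ × ℝ → ℝ} {e : Ex}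
    (ha : Set.EqOn a e.eval U) (h : e.Valid k U) (j : Fin 2) :
    Set.EqOn (pd j a) (e.d j).eval U :=
  (pd_eqOn hU ha j).trans (pd_eval hk hU h j)

end Ex

end B2Deformation
end

noncomputable section

namespace B2Deformation

variable {k : WithTop ℕ∞} {p₀ : ℝ × ℝ}

/-! ### First order equations along `∂_u` and `∂_u - u ∂_v` -/

lemma NearCk.comp_contDiff {E E' : Type*} [NormedAddCommGroup E] [NormedSpace ℝ E]
    [NormedAddCommGroup E'] [NormedSpace ℝ E'] {a : E' → ℝ} {φ : E → E'} {x : E}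
    (ha : NearCk k (φ x) a) (hφ : ContDiff ℝ k φ) : NearCk k x fun y => a (φ y) := by
  filter_upwards [hφ.continuous.continuousAt.eventually ha] with y hy
  exact hy.comp y hφ.contDiffAt

lemma NearCk.differentiableAt (hk : k = ∞ ∨ k = ω) {a : ℝ × ℝ → ℝ} (ha : NearCk k p₀ a) :
    ∀ᶠ p in 𝓝 p₀, DifferentiableAt ℝ a p := by
  filter_upwards [ha] with p hp using hp.differentiableAt (ne_zero_of_order hk)

/-- A function with `a_u = 0` is a function of `v`. -/
lemma exists_eq_ver (hk : k = ∞ ∨ k = ω) {a : ℝ × ℝ → ℝ} (ha : NearCk k p₀ a)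
    (h0 : ∀ᶠ p in 𝓝 p₀, pd 0 a p = 0) :
    ∃ H : ℝ → ℝ, NearCk k p₀.2 H ∧ ∀ᶠ p in 𝓝 p₀, a p = H p.2 := by
  -- `H` is the restriction of `a` to the vertical line through p₀; on a ball every point is joined
  -- to that line horizontally, along which `a` is constant.
  refine ⟨fun y => a (p₀.1, y), NearCk.comp_contDiff (φ := fun y : ℝ => (p₀.1, y)) ha
    (by fun_prop), ?_⟩
  obtain ⟨r, hr, hball⟩ := Metric.eventually_nhds_iff_ball.1 ((ha.differentiableAt hk).and h0)
  filter_upwards [Metric.ball_mem_nhds p₀ hr] with p hp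
  rw [Metric.mem_ball, Prod.dist_eq, max_lt_iff] at hp
  have hmem : ∀ t ∈ Metric.ball p₀.1 r, ((t, p.2) : ℝ × ℝ) ∈ Metric.ball p₀ r := by
    intro t ht
    rw [Metric.mem_ball, Prod.dist_eq, max_lt_iff]
    exact ⟨ht, hp.2⟩
  have hder : ∀ t ∈ Metric.ball p₀.1 r, HasDerivAt (fun t => a (t, p.2)) 0 t := by
    intro t ht
    obtain ⟨hd, h0⟩ := hball _ (hmem t ht)
    have h1 : HasDerivAt (fun t : ℝ => ((t, p.2) : ℝ × ℝ)) (1, 0) t :=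
      (hasDerivAt_id t).prodMk (hasDerivAt_const t p.2)
    have h2 : HasDerivAt (fun t => a (t, p.2)) (fderiv ℝ a (t, p.2) (1, 0)) t :=
      HasFDerivAt.comp_hasDerivAt (f := fun t : ℝ => ((t, p.2) : ℝ × ℝ)) t hd.hasFDerivAt h1
    have h3 : fderiv ℝ a (t, p.2) (1, 0) = 0 := h0
    rwa [h3] at h2
  exact Metric.isOpen_ball.is_const_of_deriv_eq_zero (convex_ball p₀.1 r).isPreconnected
    (fun t ht => (hder t ht).differentiableAt.differentiableWithinAt)
    (fun t ht => (hder t ht).deriv) (x := p.1) hp.1 (Metric.mem_ball_self hr)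

/-- The change of coordinates `(u, v) ↦ (u, u²/2 + v)`. -/
def straighten (p : ℝ × ℝ) : ℝ × ℝ := (p.1, p.1 ^ 2 / 2 + p.2)

/-- The inverse of `straighten`. -/
def unstraighten (q : ℝ × ℝ) : ℝ × ℝ := (q.1, q.2 - q.1 ^ 2 / 2)

lemma unstraighten_straighten (p : ℝ × ℝ) : unstraighten (straighten p) = p := by
  ext <;> simp [straighten, unstraighten]

lemma straighten_unstraighten (p : ℝ × ℝ) : straighten (unstraighten p) = p := by
  ext <;> simp [straighten, unstraighten]

lemma contDiff_straighten : ContDiff ℝ k straighten := by unfold straighten; fun_prop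

lemma contDiff_unstraighten : ContDiff ℝ k unstraighten := by unfold unstraighten; fun_prop

lemma hasFDerivAt_straighten (p : ℝ × ℝ) : HasFDerivAt straighten
    ((ContinuousLinearMap.fst ℝ ℝ ℝ).prod
      (p.1 • ContinuousLinearMap.fst ℝ ℝ ℝ + ContinuousLinearMap.snd ℝ ℝ ℝ)) p :=
  hasFDerivAt_fst.prodMk hasFDerivAt_rad

/-- Subtracting u times the second identity from the first shows that ∂_u - u∂_v becomes the first
partial derivative in the coordinates (u, u²/2 + v). -/
lemma pd_comp_straighten {K : ℝ × ℝ → ℝ} {p : ℝ × ℝ} (hK : DifferentiableAt ℝ K (straighten p)) :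
    pd 0 (fun p => K (straighten p)) p = pd 0 K (straighten p) + p.1 * pd 1 K (straighten p) ∧
      pd 1 (fun p => K (straighten p)) p = pd 1 K (straighten p) := by
  have h : HasFDerivAt (fun p => K (straighten p)) _ p :=
    hK.hasFDerivAt.comp p (hasFDerivAt_straighten p)
  constructor
  · rw [pd, h.fderiv, ContinuousLinearMap.comp_apply, fderiv_eq_pd]
    simp; ring
  · rw [pd, h.fderiv, ContinuousLinearMap.comp_apply, fderiv_eq_pd]
    simp

lemma tendsto_straighten : Tendsto straighten (𝓝 p₀) (𝓝 (straighten p₀)) :=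
  (contDiff_straighten (k := 0)).continuous.continuousAt

/-- In the straightened coordinates the equation is ∂_u K = h. The change of coordinates is
polynomial with polynomial inverse, so it preserves both regularity classes. -/
lemma exists_charDeriv_eq (hk : k = ∞ ∨ k = ω) {h : ℝ × ℝ → ℝ} (hh : NearCk k p₀ h) :
    ∃ K, NearCk k p₀ K ∧ ∀ᶠ p in 𝓝 p₀, pd 0 K p - p.1 * pd 1 K p = h p := by
  rw [← unstraighten_straighten p₀] at hh
  obtain ⟨K, hK, hK0⟩ := exists_pd_zero_eq hk (hh.comp_contDiff contDiff_unstraighten)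
  refine ⟨fun p => K (straighten p), hK.comp_contDiff contDiff_straighten, ?_⟩
  filter_upwards [tendsto_straighten.eventually (hK.differentiableAt hk),
    tendsto_straighten.eventually hK0] with p h1 h2
  rw [(pd_comp_straighten h1).1, (pd_comp_straighten h1).2, h2, unstraighten_straighten]
  ring

/-- A function with `a_u = u a_v` is a function of `u²/2 + v`. -/
lemma exists_eq_rad (hk : k = ∞ ∨ k = ω) {a : ℝ × ℝ → ℝ} (ha : NearCk k p₀ a)
    (h0 : ∀ᶠ p in 𝓝 p₀, pd 0 a p - p.1 * pd 1 a p = 0) :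
    ∃ F : ℝ → ℝ, NearCk k (p₀.1 ^ 2 / 2 + p₀.2) F ∧
      ∀ᶠ p in 𝓝 p₀, a p = F (p.1 ^ 2 / 2 + p.2) := by
  have hb : NearCk k (straighten p₀) fun q => a (unstraighten q) := by
    refine NearCk.comp_contDiff ?_ contDiff_unstraighten
    rwa [unstraighten_straighten]
  have hun : Tendsto unstraighten (𝓝 (straighten p₀)) (𝓝 p₀) := by
    have := (contDiff_unstraighten (k := 0)).continuous.continuousAt (x := straighten p₀)
    rwa [ContinuousAt, unstraighten_straighten] at this
  have hb0 : ∀ᶠ q in 𝓝 (straighten p₀), pd 0 (fun q => a (unstraighten q)) q = 0 := by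
    filter_upwards [hb.differentiableAt hk, hun.eventually h0] with q hq hq0
    have h1 := pd_comp_straighten (p := unstraighten q) (K := fun q => a (unstraighten q))
      (by rwa [straighten_unstraighten])
    simp only [unstraighten_straighten, straighten_unstraighten] at h1
    rw [h1.1, h1.2] at hq0
    linarith
  obtain ⟨F, hF, hF0⟩ := exists_eq_ver hk hb hb0
  refine ⟨F, hF, ?_⟩
  filter_upwards [tendsto_straighten.eventually hF0] with p hp
  rwa [unstraighten_straighten] at hp

end B2Deformation
end

noncomputable section

namespace B2Deformation

namespace Ex

/-! ### The normal form and the extensions of the symmetries as expressions -/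

/-- The fluxes of the `(2,1)` flow. -/
def fluxA : Fin 2 → Ex := ![u * v + c (1 / 3) * u * u * u, c (1 / 2) * v * v]

/-- The first order coefficients of the normal form. -/
def nfB (F : ℝ → ℝ) : Fin 2 → Fin 2 → Ex :=
  ![![c 0,
      c 0],
    ![rad F 0 * u * u,
      rad F 0 * u]]

/-- The coefficients of second derivatives in the normal form. -/
def nfC (F G H : ℝ → ℝ) : Fin 2 → Fin 2 → Ex :=
  ![![c 0,
      c 0],
    ![c (1/3) * rad F 0 * rad F 0 * u + rad G 0 * u * u * u,
      c (1/3) * rad F 0 * rad F 0 + rad G 0 * u * u + ver H 0]]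

/-- The coefficients of products in the normal form. -/
def nfD (F G H : ℝ → ℝ) : Fin 2 → Fin 2 → Fin 2 → Ex :=
  ![![![c 0,
       c (-2/3) * rad F 0 * rad F 1 + c (1/3) * rad F 0 * rad F 2 * u * u +
       c (2/3) * rad F 0 * rad F 0 * uinv * uinv + c (1/3) * rad F 1 * rad F 1 * u * u +
       c (-4) * rad G 1 * u * u + c (-1) * rad G 2 * u * u * u * u],
     ![c 0,
       c (-2/3) * rad F 0 * rad F 1 * uinv + c (1/3) * rad F 0 * rad F 2 * u +
       c (2/3) * rad F 0 * rad F 0 * uinv * uinv * uinv + c (1/3) * rad F 1 * rad F 1 * u +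
       c (-4) * rad G 1 * u + c (-1) * rad G 2 * u * u * u + ver H 0 * uinv * uinv * uinv +
       c (1/2) * ver H 1 * uinv]],
    ![![c (-1/3) * rad F 0 * rad F 1 * u * u + c (5/6) * rad F 0 * rad F 0 +
        c (3) * rad G 0 * u * u + rad G 1 * u * u * u * u,
        c (1/3) * rad F 0 * rad F 1 * u + c (-1/3) * rad F 0 * rad F 2 * u * u * u +
        c (-1/3) * rad F 0 * rad F 0 * uinv + c (-1/3) * rad F 1 * rad F 1 * u * u * u +
        c (3) * rad G 0 * u + c (6) * rad G 1 * u * u * u + rad G 2 * u * u * u * u * u],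
      ![c 0,
        c (1/3) * rad F 0 * rad F 1 + c (-1/3) * rad F 0 * rad F 2 * u * u +
        c (-1/3) * rad F 0 * rad F 0 * uinv * uinv + c (-1/3) * rad F 1 * rad F 1 * u * u +
        c (3) * rad G 0 + c (6) * rad G 1 * u * u + rad G 2 * u * u * u * u]]]

section Symmetry

variable (F G H : ℝ → ℝ) (s : ℝ × ℝ → ℝ) (ψ : ℝ → ℝ)

/-- The fluxes of a symmetry. -/
def symA : Fin 2 → Ex := ![sig s ψ 0, ver ψ 0]

/-- The first order coefficients of the extension of a symmetry. -/
def symB : Fin 2 → Fin 2 → Ex :=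
  ![![c (1/2) * rad F 0 * ver ψ 2 * u + c (-1/2) * rad F 0 * sig s ψ 1 +
      c (1/2) * rad F 0 * sig s ψ 2 * u * u,
      c (1/2) * rad F 0 * ver ψ 2 + c (-1/2) * rad F 0 * sig s ψ 1 * uinv +
      c (1/2) * rad F 0 * sig s ψ 2 * u],
    ![rad F 0 * sig s ψ 1 * u,
      rad F 0 * sig s ψ 1]]

/-- The coefficients of second derivatives in the extension of a symmetry. -/
def symC : Fin 2 → Fin 2 → Ex :=
  ![![c (-1/6) * rad F 0 * rad F 0 * ver ψ 2 + c (1/6) * rad F 0 * rad F 0 * ver ψ 3 * u * u +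
      c (1/6) * rad F 0 * rad F 0 * sig s ψ 1 * uinv +
      c (1/6) * rad F 0 * rad F 0 * sig s ψ 3 * u * u * u + c (1/2) * rad G 0 * ver ψ 2 * u * u +
      c (-1/2) * rad G 0 * sig s ψ 1 * u + c (1/2) * rad G 0 * sig s ψ 2 * u * u * u,
      c (-1/6) * rad F 0 * rad F 0 * ver ψ 2 * uinv + c (1/6) * rad F 0 * rad F 0 * ver ψ 3 * u +
      c (1/6) * rad F 0 * rad F 0 * sig s ψ 1 * uinv * uinv +
      c (1/6) * rad F 0 * rad F 0 * sig s ψ 3 * u * u + c (1/2) * rad G 0 * ver ψ 2 * u +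
      c (-1/2) * rad G 0 * sig s ψ 1 + c (1/2) * rad G 0 * sig s ψ 2 * u * u +
      c (-1) * ver H 0 * ver ψ 2 * uinv + ver H 0 * sig s ψ 1 * uinv * uinv],
    ![c (1/2) * rad F 0 * rad F 0 * ver ψ 2 * u + c (-1/6) * rad F 0 * rad F 0 * sig s ψ 1 +
      c (1/2) * rad F 0 * rad F 0 * sig s ψ 2 * u * u + rad G 0 * sig s ψ 1 * u * u,
      c (1/2) * rad F 0 * rad F 0 * ver ψ 2 + c (-1/6) * rad F 0 * rad F 0 * sig s ψ 1 * uinv +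
      c (1/2) * rad F 0 * rad F 0 * sig s ψ 2 * u + rad G 0 * sig s ψ 1 * u + ver H 0 * ver ψ 2]]

/-- The coefficients of products in the extension of a symmetry. -/
def symD : Fin 2 → Fin 2 → Fin 2 → Ex :=
  ![![![c (-5/12) * rad F 0 * rad F 1 * ver ψ 2 * u +
       c (1/4) * rad F 0 * rad F 1 * ver ψ 3 * u * u * u +
       c (5/12) * rad F 0 * rad F 1 * sig s ψ 1 + c (-1/6) * rad F 0 * rad F 1 * sig s ψ 2 * u * u +
       c (1/4) * rad F 0 * rad F 1 * sig s ψ 3 * u * u * u * u +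
       c (-1/6) * rad F 0 * rad F 0 * ver ψ 2 * uinv + c (1/8) * rad F 0 * rad F 0 * ver ψ 3 * u +
       c (1/8) * rad F 0 * rad F 0 * ver ψ 4 * u * u * u +
       c (1/6) * rad F 0 * rad F 0 * sig s ψ 1 * uinv * uinv +
       c (5/24) * rad F 0 * rad F 0 * sig s ψ 2 + c (1/4) * rad F 0 * rad F 0 * sig s ψ 3 * u * u +
       c (1/8) * rad F 0 * rad F 0 * sig s ψ 4 * u * u * u * u + c (3/4) * rad G 0 * ver ψ 2 * u +
       c (1/4) * rad G 0 * ver ψ 3 * u * u * u + c (-3/4) * rad G 0 * sig s ψ 1 +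
       rad G 0 * sig s ψ 2 * u * u + c (1/4) * rad G 0 * sig s ψ 3 * u * u * u * u +
       c (1/2) * rad G 1 * ver ψ 2 * u * u * u + c (-1/2) * rad G 1 * sig s ψ 1 * u * u +
       c (1/2) * rad G 1 * sig s ψ 2 * u * u * u * u,
       c (-5/6) * rad F 0 * rad F 1 * ver ψ 2 + c (1/2) * rad F 0 * rad F 1 * ver ψ 3 * u * u +
       c (1/6) * rad F 0 * rad F 1 * sig s ψ 1 * uinv +
       c (-1/3) * rad F 0 * rad F 1 * sig s ψ 2 * u +
       c (1/2) * rad F 0 * rad F 1 * sig s ψ 3 * u * u * u +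
       c (1/3) * rad F 0 * rad F 2 * sig s ψ 1 * u +
       c (1/6) * rad F 0 * rad F 0 * ver ψ 2 * uinv * uinv +
       c (-1/4) * rad F 0 * rad F 0 * ver ψ 3 + c (1/4) * rad F 0 * rad F 0 * ver ψ 4 * u * u +
       c (1/2) * rad F 0 * rad F 0 * sig s ψ 1 * uinv * uinv * uinv +
       c (5/12) * rad F 0 * rad F 0 * sig s ψ 2 * uinv +
       c (1/4) * rad F 0 * rad F 0 * sig s ψ 4 * u * u * u +
       c (1/3) * rad F 1 * rad F 1 * sig s ψ 1 * u + c (1/2) * rad G 0 * ver ψ 3 * u * u +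
       c (1/2) * rad G 0 * sig s ψ 2 * u + c (1/2) * rad G 0 * sig s ψ 3 * u * u * u +
       rad G 1 * ver ψ 2 * u * u + c (-5) * rad G 1 * sig s ψ 1 * u +
       rad G 1 * sig s ψ 2 * u * u * u + c (-1) * rad G 2 * sig s ψ 1 * u * u * u],
     ![c 0,
       c (-1/12) * rad F 0 * rad F 1 * ver ψ 2 * uinv + c (1/4) * rad F 0 * rad F 1 * ver ψ 3 * u +
       c (-7/12) * rad F 0 * rad F 1 * sig s ψ 1 * uinv * uinv +
       c (-1/6) * rad F 0 * rad F 1 * sig s ψ 2 + c (1/4) * rad F 0 * rad F 1 * sig s ψ 3 * u * u +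
       c (1/3) * rad F 0 * rad F 2 * sig s ψ 1 +
       c (-1/3) * rad F 0 * rad F 0 * ver ψ 2 * uinv * uinv * uinv +
       c (-5/24) * rad F 0 * rad F 0 * ver ψ 3 * uinv + c (1/8) * rad F 0 * rad F 0 * ver ψ 4 * u +
       rad F 0 * rad F 0 * sig s ψ 1 * uinv * uinv * uinv * uinv +
       c (5/24) * rad F 0 * rad F 0 * sig s ψ 2 * uinv * uinv +
       c (-1/12) * rad F 0 * rad F 0 * sig s ψ 3 + c (1/8) * rad F 0 * rad F 0 * sig s ψ 4 * u * u +
       c (1/3) * rad F 1 * rad F 1 * sig s ψ 1 + c (-9/4) * rad G 0 * ver ψ 2 * uinv +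
       c (1/4) * rad G 0 * ver ψ 3 * u + c (9/4) * rad G 0 * sig s ψ 1 * uinv * uinv +
       c (1/4) * rad G 0 * sig s ψ 3 * u * u + c (-1/2) * rad G 1 * ver ψ 2 * u +
       c (-7/2) * rad G 1 * sig s ψ 1 + c (1/2) * rad G 1 * sig s ψ 2 * u * u +
       c (-1) * rad G 2 * sig s ψ 1 * u * u + c (-1/2) * ver H 0 * ver ψ 2 * uinv * uinv * uinv +
       c (-1/2) * ver H 0 * ver ψ 3 * uinv +
       c (3/2) * ver H 0 * sig s ψ 1 * uinv * uinv * uinv * uinv +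
       c (1/2) * ver H 1 * sig s ψ 1 * uinv * uinv]],
    ![![c (1/2) * rad F 0 * rad F 1 * ver ψ 2 * u * u +
        c (-5/6) * rad F 0 * rad F 1 * sig s ψ 1 * u +
        c (1/2) * rad F 0 * rad F 1 * sig s ψ 2 * u * u * u +
        c (5/6) * rad F 0 * rad F 0 * ver ψ 2 + c (1/2) * rad F 0 * rad F 0 * ver ψ 3 * u * u +
        c (5/6) * rad F 0 * rad F 0 * sig s ψ 2 * u +
        c (1/2) * rad F 0 * rad F 0 * sig s ψ 3 * u * u * u + rad G 0 * ver ψ 2 * u * u +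
        c (2) * rad G 0 * sig s ψ 1 * u + rad G 0 * sig s ψ 2 * u * u * u +
        rad G 1 * sig s ψ 1 * u * u * u,
        rad F 0 * rad F 1 * ver ψ 2 * u + c (-2/3) * rad F 0 * rad F 1 * sig s ψ 1 +
        rad F 0 * rad F 1 * sig s ψ 2 * u * u + c (-1/3) * rad F 0 * rad F 2 * sig s ψ 1 * u * u +
        c (1/6) * rad F 0 * rad F 0 * ver ψ 2 * uinv + rad F 0 * rad F 0 * ver ψ 3 * u +
        c (-1/2) * rad F 0 * rad F 0 * sig s ψ 1 * uinv * uinv +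
        c (1/6) * rad F 0 * rad F 0 * sig s ψ 2 + rad F 0 * rad F 0 * sig s ψ 3 * u * u +
        c (-1/3) * rad F 1 * rad F 1 * sig s ψ 1 * u * u + c (2) * rad G 0 * ver ψ 2 * u +
        rad G 0 * sig s ψ 1 + c (2) * rad G 0 * sig s ψ 2 * u * u +
        c (6) * rad G 1 * sig s ψ 1 * u * u + rad G 2 * sig s ψ 1 * u * u * u * u],
      ![c 0,
        c (1/6) * rad F 0 * rad F 1 * ver ψ 2 + c (1/6) * rad F 0 * rad F 1 * sig s ψ 1 * uinv +
        c (1/2) * rad F 0 * rad F 1 * sig s ψ 2 * u + c (-1/3) * rad F 0 * rad F 2 * sig s ψ 1 * u +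
        c (1/3) * rad F 0 * rad F 0 * ver ψ 2 * uinv * uinv +
        c (1/2) * rad F 0 * rad F 0 * ver ψ 3 +
        c (-2/3) * rad F 0 * rad F 0 * sig s ψ 1 * uinv * uinv * uinv +
        c (-1/6) * rad F 0 * rad F 0 * sig s ψ 2 * uinv +
        c (1/2) * rad F 0 * rad F 0 * sig s ψ 3 * u + c (-1/3) * rad F 1 * rad F 1 * sig s ψ 1 * u +
        c (3) * rad G 0 * ver ψ 2 + rad G 0 * sig s ψ 2 * u + rad G 1 * ver ψ 2 * u * u +
        c (5) * rad G 1 * sig s ψ 1 * u + rad G 2 * sig s ψ 1 * u * u * u +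
        c (1/2) * ver H 0 * ver ψ 3]]]

end Symmetry

variable {k : WithTop ℕ∞} {U : Set (ℝ × ℝ)}

/-- Together with the next two lemmas this replaces the actual partials, up to third order, by
formal ones. A differential identity then becomes a rational identity in independent symbols, with u
≠ 0. -/
lemma pd_eval_eq (hk : k = ∞ ∨ k = ω) (hU : IsOpen U) {e : Ex} (h : e.Valid k U) {p : ℝ × ℝ}
    (hp : p ∈ U) (j : Fin 2) : pd j e.eval p = (e.d j).eval p :=
  pd_eval hk hU h j hp

lemma pd_pd_eval_eq (hk : k = ∞ ∨ k = ω) (hU : IsOpen U) {e : Ex} (h : e.Valid k U) {p : ℝ × ℝ}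
    (hp : p ∈ U) (j l : Fin 2) : pd l (pd j e.eval) p = ((e.d j).d l).eval p :=
  pd_eq_eval hk hU (pd_eval hk hU h j) (h.d hk j) l hp

lemma pd_pd_pd_eval_eq (hk : k = ∞ ∨ k = ω) (hU : IsOpen U) {e : Ex} (h : e.Valid k U)
    {p : ℝ × ℝ} (hp : p ∈ U) (j l m : Fin 2) :
    pd m (pd l (pd j e.eval)) p = (((e.d j).d l).d m).eval p :=
  pd_eq_eval hk hU (pd_eq_eval hk hU (pd_eval hk hU h j) (h.d hk j) l) ((h.d hk j).d hk l) m hp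

/-- The functions which a vector of expressions denotes. -/
def evals (A : Fin 2 → Ex) : Fin 2 → ℝ × ℝ → ℝ := fun i => (A i).eval

/-- The functions which a matrix of expressions denotes. -/
def evals₂ (B : Fin 2 → Fin 2 → Ex) : Fin 2 → Fin 2 → ℝ × ℝ → ℝ := fun i j => (B i j).eval

/-- The functions which a family of expressions denotes. -/
def evals₃ (D : Fin 2 → Fin 2 → Fin 2 → Ex) : Fin 2 → Fin 2 → Fin 2 → ℝ × ℝ → ℝ :=
  fun i j l => (D i j l).eval

variable {F G H ψ : ℝ → ℝ} {s : ℝ × ℝ → ℝ}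

/-- Regularity of the functional parameters. -/
structure Admissible (k : WithTop ℕ∞) (U : Set (ℝ × ℝ)) (F G H : ℝ → ℝ) : Prop where
  ne : ∀ p ∈ U, p.1 ≠ 0
  contDiffAt_F : ∀ p ∈ U, ContDiffAt ℝ k F (p.1 ^ 2 / 2 + p.2)
  contDiffAt_G : ∀ p ∈ U, ContDiffAt ℝ k G (p.1 ^ 2 / 2 + p.2)
  contDiffAt_H : ∀ p ∈ U, ContDiffAt ℝ k H p.2

/-- `s` and `ψ(v)` are the fluxes of a symmetry. -/
structure IsSymmetry (k : WithTop ℕ∞) (U : Set (ℝ × ℝ)) (s : ℝ × ℝ → ℝ) (ψ : ℝ → ℝ) : Prop where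
  ckOn_s : CkOn k U s
  contDiffAt_ψ : ∀ p ∈ U, ContDiffAt ℝ k ψ p.2
  eq : ∀ p ∈ U, pd 0 s p = p.1 * pd 1 s p + deriv ψ p.2

lemma valid_fluxA (i : Fin 2) : (fluxA i).Valid k U := by
  fin_cases i <;> simp [fluxA, valid_add, valid_mul, valid_c, valid_u, valid_v]

lemma valid_rad (h : Admissible k U F G H) (n : ℕ) : (rad F n).Valid k U ∧ (rad G n).Valid k U ∧
    (ver H n).Valid k U ∧ uinv.Valid k U := ⟨h.contDiffAt_F, h.contDiffAt_G, h.contDiffAt_H, h.ne⟩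

lemma valid_sig (h : IsSymmetry k U s ψ) (n : ℕ) : (sig s ψ n).Valid k U ∧ (ver ψ n).Valid k U :=
  ⟨⟨h.ckOn_s, h.contDiffAt_ψ, h.eq⟩, h.contDiffAt_ψ⟩

lemma valid_nfB (h : Admissible k U F G H) (i j : Fin 2) : (nfB F i j).Valid k U := by
  fin_cases i <;> fin_cases j <;>
    simp [nfB, valid_mul, valid_c, valid_u, (valid_rad h _).1]

lemma valid_nfC (h : Admissible k U F G H) (i j : Fin 2) : (nfC F G H i j).Valid k U := by
  fin_cases i <;> fin_cases j <;>
    simp [nfC, valid_add, valid_mul, valid_c, valid_u, valid_rad h]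

lemma valid_nfD (h : Admissible k U F G H) (i j l : Fin 2) : (nfD F G H i j l).Valid k U := by
  fin_cases i <;> fin_cases j <;> fin_cases l <;>
    simp [nfD, valid_add, valid_mul, valid_c, valid_u, (valid_rad h 0).2.2.2, valid_rad h]

lemma valid_symA (h : IsSymmetry k U s ψ) (i : Fin 2) : (symA s ψ i).Valid k U := by
  fin_cases i <;> simp [symA, valid_sig h]

lemma valid_symB (h : Admissible k U F G H) (hs : IsSymmetry k U s ψ) (i j : Fin 2) :
    (symB F s ψ i j).Valid k U := by
  fin_cases i <;> fin_cases j <;>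
    simp [symB, valid_add, valid_mul, valid_c, valid_u, (valid_rad h 0).2.2.2, (valid_rad h _).1,
      valid_sig hs]

lemma valid_symC (h : Admissible k U F G H) (hs : IsSymmetry k U s ψ) (i j : Fin 2) :
    (symC F G H s ψ i j).Valid k U := by
  fin_cases i <;> fin_cases j <;>
    simp [symC, valid_add, valid_mul, valid_c, valid_u, (valid_rad h 0).2.2.2, valid_rad h,
      valid_sig hs]

lemma valid_symD (h : Admissible k U F G H) (hs : IsSymmetry k U s ψ) (i j l : Fin 2) :
    (symD F G H s ψ i j l).Valid k U := by
  fin_cases i <;> fin_cases j <;> fin_cases l <;>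
    simp [symD, valid_add, valid_mul, valid_c, valid_u, (valid_rad h 0).2.2.2, valid_rad h,
      valid_sig hs]

lemma brB_sym (hk : k = ∞ ∨ k = ω) (hU : IsOpen U) (hs : IsSymmetry k U s ψ) {p : ℝ × ℝ}
    (hp : p ∈ U) (i j : Fin 2) : brB (evals fluxA) (evals (symA s ψ)) i j p = 0 := by
  have hA := valid_fluxA (k := k) (U := U)
  have hS := valid_symA hs
  simp only [brB, evals, Fin.sum_univ_two, pd_eval_eq hk hU (hA _) hp, pd_eval_eq hk hU (hS _) hp]
  revert i j
  simp only [Fin.forall_fin_two]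
  refine ⟨⟨?_, ?_⟩, ?_, ?_⟩ <;>
  · simp only [fluxA, symA, Matrix.cons_val_zero, Matrix.cons_val_one, d_add, d_mul, d_c, d_zero_u,
      d_one_u, d_zero_v, d_one_v, d_zero_ver, d_one_ver, d_zero_sig, d_one_sig, eval_add, eval_mul,
      eval_c, eval_u, eval_v, zero_add]
    ring

/-- The extension is linear in (s, ψ), and for the flow's own symmetry, where s_v = u and ψ'' = 1,
its corrections reduce to those of the normal form. For s = u²/2 + v and ψ = 0 its first order part
is the `radB` found in the reduction. -/
lemma ord₁C_sym (hk : k = ∞ ∨ k = ω) (hU : IsOpen U) (h : Admissible k U F G H)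
    (hs : IsSymmetry k U s ψ) {p : ℝ × ℝ} (hp : p ∈ U) (i j : Fin 2) :
    ord₁C (evals fluxA) (evals (symA s ψ)) (evals₂ (nfB F)) (evals₂ (symB F s ψ)) p i j = 0 := by
  have hA := valid_fluxA (k := k) (U := U)
  have hS := valid_symA hs
  have hp0 := h.ne p hp
  simp only [ord₁C, brC, evals, evals₂, Fin.sum_univ_two, pd_eval_eq hk hU (hA _) hp,
    pd_eval_eq hk hU (hS _) hp]
  revert i j
  simp only [Fin.forall_fin_two]
  refine ⟨⟨?_, ?_⟩, ?_, ?_⟩ <;>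
  · simp only [fluxA, symA, nfB, symB, Matrix.cons_val_zero, Matrix.cons_val_one, d_add, d_mul, d_c,
      d_zero_u, d_one_u, d_zero_v, d_one_v, d_zero_ver, d_one_ver, d_zero_sig, d_one_sig, eval_add,
      eval_mul, eval_c, eval_u, eval_v, eval_uinv, zero_add, mul_zero, zero_mul, add_zero, one_mul,
      mul_one]
    field_simp
    ring

/-- The monomial u_x v_x arises under two index orders, so the two mixed coefficients are required
to cancel only in sum. -/
lemma ord₁D_sym (hk : k = ∞ ∨ k = ω) (hU : IsOpen U) (h : Admissible k U F G H)
    (hs : IsSymmetry k U s ψ) {p : ℝ × ℝ} (hp : p ∈ U) (i : Fin 2) :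
    ord₁D (evals fluxA) (evals (symA s ψ)) (evals₂ (nfB F)) (evals₂ (symB F s ψ)) p i 0 0 = 0 ∧
    ord₁D (evals fluxA) (evals (symA s ψ)) (evals₂ (nfB F)) (evals₂ (symB F s ψ)) p i 0 1 +
      ord₁D (evals fluxA) (evals (symA s ψ)) (evals₂ (nfB F)) (evals₂ (symB F s ψ)) p i 1 0 = 0 ∧
    ord₁D (evals fluxA) (evals (symA s ψ)) (evals₂ (nfB F)) (evals₂ (symB F s ψ)) p i 1 1 = 0 := by
  have hA := valid_fluxA (k := k) (U := U)
  have hS := valid_symA hs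
  have hB := valid_nfB h
  have hP := valid_symB h hs
  have hp0 := h.ne p hp
  simp only [ord₁D, brD, evals, evals₂, Fin.sum_univ_two,
    pd_pd_eval_eq hk hU (hA _) hp, pd_pd_eval_eq hk hU (hS _) hp,
    pd_eval_eq hk hU (hA _) hp, pd_eval_eq hk hU (hS _) hp, pd_eval_eq hk hU (hB _ _) hp,
    pd_eval_eq hk hU (hP _ _) hp]
  revert i
  simp only [Fin.forall_fin_two]
  refine ⟨⟨?_, ?_, ?_⟩, ?_, ?_, ?_⟩ <;>
  · simp only [fluxA, symA, nfB, symB, Matrix.cons_val_zero, Matrix.cons_val_one,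
       d_add, d_mul, d_c, d_zero_u, d_one_u, d_zero_v, d_one_v, d_zero_uinv,
      d_one_uinv, d_zero_rad, d_one_rad, d_zero_ver, d_one_ver, d_zero_sig, d_one_sig, eval_add,
      eval_mul, eval_c, eval_u, eval_v, eval_uinv, zero_add, mul_zero, zero_mul, add_zero, one_mul,
      mul_one, Nat.reduceAdd]
    field_simp
    ring

lemma ord₂C_sym (hk : k = ∞ ∨ k = ω) (hU : IsOpen U) (h : Admissible k U F G H)
    (hs : IsSymmetry k U s ψ) {p : ℝ × ℝ} (hp : p ∈ U) (i j : Fin 2) :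
    ord₂C (evals fluxA) (evals (symA s ψ)) (evals₂ (nfB F)) (evals₂ (symB F s ψ))
      (evals₂ (nfC F G H)) (evals₂ (symC F G H s ψ)) p i j = 0 := by
  have hA := valid_fluxA (k := k) (U := U)
  have hS := valid_symA hs
  have hp0 := h.ne p hp
  simp only [ord₂C, quad₃, lin₃, evals, evals₂, Fin.sum_univ_two,
    pd_eval_eq hk hU (hA _) hp, pd_eval_eq hk hU (hS _) hp]
  revert i j
  simp only [Fin.forall_fin_two]
  refine ⟨⟨?_, ?_⟩, ?_, ?_⟩ <;>
  · simp only [fluxA, symA, nfB, symB, nfC, symC, Matrix.cons_val_zero,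
      Matrix.cons_val_one, d_add, d_mul, d_c, d_zero_u, d_one_u, d_zero_v, d_one_v,
      d_zero_ver, d_one_ver, d_zero_sig, d_one_sig, eval_add,
      eval_mul, eval_c, eval_u, eval_v, eval_uinv, zero_add, mul_zero, zero_mul, add_zero, one_mul,
      mul_one]
    field_simp
    ring

-- The monomials uʲ_x uᵏ_xx are pairwise different, so here all eight coefficients have to vanish
-- separately, with no symmetrization.
set_option maxHeartbeats 2000000 in
lemma ord₂D_sym (hk : k = ∞ ∨ k = ω) (hU : IsOpen U) (h : Admissible k U F G H)
    (hs : IsSymmetry k U s ψ) {p : ℝ × ℝ} (hp : p ∈ U) (i j l : Fin 2) :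
    ord₂D (evals fluxA) (evals (symA s ψ)) (evals₂ (nfB F)) (evals₂ (symB F s ψ))
      (evals₂ (nfC F G H)) (evals₂ (symC F G H s ψ)) (evals₃ (nfD F G H))
      (evals₃ (symD F G H s ψ)) p i j l = 0 := by
  have hA := valid_fluxA (k := k) (U := U)
  have hS := valid_symA hs
  have hB := valid_nfB h
  have hP := valid_symB h hs
  have hC := valid_nfC h
  have hC' := valid_symC h hs
  have hp0 := h.ne p hp
  simp only [ord₂D, quad₂, lin₂, evals, evals₂, evals₃, Fin.sum_univ_two,
    pd_pd_eval_eq hk hU (hA _) hp, pd_pd_eval_eq hk hU (hS _) hp,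
    pd_eval_eq hk hU (hA _) hp, pd_eval_eq hk hU (hS _) hp, pd_eval_eq hk hU (hB _ _) hp,
    pd_eval_eq hk hU (hP _ _) hp, pd_eval_eq hk hU (hC _ _) hp, pd_eval_eq hk hU (hC' _ _) hp]
  revert i j l
  simp only [Fin.forall_fin_two]
  refine ⟨⟨⟨?_, ?_⟩, ?_, ?_⟩, ⟨?_, ?_⟩, ?_, ?_⟩ <;>
  · simp only [fluxA, symA, nfB, symB, nfC, symC, nfD, symD, Matrix.cons_val_zero,
      Matrix.cons_val_one, d_add, d_mul, d_c, d_zero_u, d_one_u, d_zero_v, d_one_v, d_zero_uinv,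
      d_one_uinv, d_zero_rad, d_one_rad, d_zero_ver, d_one_ver, d_zero_sig, d_one_sig, eval_add,
      eval_mul, eval_c, eval_u, eval_v, eval_uinv, zero_add, mul_zero, zero_mul, add_zero, one_mul,
      mul_one, Nat.reduceAdd]
    field_simp
    ring

end Ex

end B2Deformation
end

/-! ### The terms cubic in first derivatives of the second order relation for a symmetry -/

noncomputable section

namespace B2Deformation

namespace Ex

variable {k : WithTop ℕ∞} {U : Set (ℝ × ℝ)} {F G H ψ : ℝ → ℝ} {s : ℝ × ℝ → ℝ}

/-- The third order part of the second order commutation relation for a symmetry. -/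
def symE (F G H : ℝ → ℝ) (s : ℝ × ℝ → ℝ) (ψ : ℝ → ℝ) (p : ℝ × ℝ) (i j l m : Fin 2) : ℝ :=
  ord₂E (evals fluxA) (evals (symA s ψ)) (evals₂ (nfB F)) (evals₂ (symB F s ψ))
    (evals₂ (nfC F G H)) (evals₂ (symC F G H s ψ)) (evals₃ (nfD F G H))
    (evals₃ (symD F G H s ψ)) p i j l m

set_option maxHeartbeats 2000000 in
lemma symE_zero_zero_zero (hk : k = ∞ ∨ k = ω) (hU : IsOpen U) (h : Admissible k U F G H)
    (hs : IsSymmetry k U s ψ) {p : ℝ × ℝ} (hp : p ∈ U) (i : Fin 2) :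
    symE F G H s ψ p i 0 0 0 = 0 := by
  have hA := valid_fluxA (k := k) (U := U)
  have hS := valid_symA hs
  have hB := valid_nfB h
  have hP := valid_symB h hs
  have hC := valid_nfC h
  have hC' := valid_symC h hs
  have hD := valid_nfD h
  have hD' := valid_symD h hs
  have hp0 := h.ne p hp
  simp only [symE, ord₂E, quad₁, lin₁, evals, evals₂, evals₃, Fin.sum_univ_two,
    pd_pd_pd_eval_eq hk hU (hA _) hp, pd_pd_pd_eval_eq hk hU (hS _) hp,
    pd_pd_eval_eq hk hU (hA _) hp, pd_pd_eval_eq hk hU (hS _) hp,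
    pd_pd_eval_eq hk hU (hB _ _) hp, pd_pd_eval_eq hk hU (hP _ _) hp,
    pd_eval_eq hk hU (hA _) hp, pd_eval_eq hk hU (hS _) hp, pd_eval_eq hk hU (hB _ _) hp,
    pd_eval_eq hk hU (hP _ _) hp, pd_eval_eq hk hU (hD _ _ _) hp, pd_eval_eq hk hU (hD' _ _ _) hp]
  revert i
  simp only [Fin.forall_fin_two]
  refine ⟨?_, ?_⟩ <;>
  · simp only [fluxA, symA, nfB, symB, nfC, symC, nfD, symD, Matrix.cons_val_zero,
      Matrix.cons_val_one, d_add, d_mul, d_c, d_zero_u, d_one_u, d_zero_v, d_one_v, d_zero_uinv,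
      d_one_uinv, d_zero_rad, d_one_rad, d_zero_ver, d_one_ver, d_zero_sig, d_one_sig, eval_add,
      eval_mul, eval_c, eval_u, eval_v, eval_uinv, zero_add, mul_zero, zero_mul, add_zero, one_mul,
      mul_one, Nat.reduceAdd]
    field_simp
    ring

-- The three index orders belong to the one monomial u_x² v_x, and only their sum vanishes in
-- general.
set_option maxHeartbeats 2000000 in
lemma symE_zero_zero_one (hk : k = ∞ ∨ k = ω) (hU : IsOpen U) (h : Admissible k U F G H)
    (hs : IsSymmetry k U s ψ) {p : ℝ × ℝ} (hp : p ∈ U) (i : Fin 2) :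
    symE F G H s ψ p i 0 0 1 + symE F G H s ψ p i 0 1 0 + symE F G H s ψ p i 1 0 0 = 0 := by
  have hA := valid_fluxA (k := k) (U := U)
  have hS := valid_symA hs
  have hB := valid_nfB h
  have hP := valid_symB h hs
  have hC := valid_nfC h
  have hC' := valid_symC h hs
  have hD := valid_nfD h
  have hD' := valid_symD h hs
  have hp0 := h.ne p hp
  simp only [symE, ord₂E, quad₁, lin₁, evals, evals₂, evals₃, Fin.sum_univ_two,
    pd_pd_pd_eval_eq hk hU (hA _) hp, pd_pd_pd_eval_eq hk hU (hS _) hp,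
    pd_pd_eval_eq hk hU (hA _) hp, pd_pd_eval_eq hk hU (hS _) hp,
    pd_pd_eval_eq hk hU (hB _ _) hp, pd_pd_eval_eq hk hU (hP _ _) hp,
    pd_eval_eq hk hU (hA _) hp, pd_eval_eq hk hU (hS _) hp, pd_eval_eq hk hU (hB _ _) hp,
    pd_eval_eq hk hU (hP _ _) hp, pd_eval_eq hk hU (hD _ _ _) hp, pd_eval_eq hk hU (hD' _ _ _) hp]
  revert i
  simp only [Fin.forall_fin_two]
  refine ⟨?_, ?_⟩ <;>
  · simp only [fluxA, symA, nfB, symB, nfC, symC, nfD, symD, Matrix.cons_val_zero,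
      Matrix.cons_val_one, d_add, d_mul, d_c, d_zero_u, d_one_u, d_zero_v, d_one_v, d_zero_uinv,
      d_one_uinv, d_zero_rad, d_one_rad, d_zero_ver, d_one_ver, d_zero_sig, d_one_sig, eval_add,
      eval_mul, eval_c, eval_u, eval_v, eval_uinv, zero_add, mul_zero, zero_mul, add_zero, one_mul,
      mul_one, Nat.reduceAdd]
    field_simp
    ring

set_option maxHeartbeats 2000000 in
lemma symE_zero_one_one (hk : k = ∞ ∨ k = ω) (hU : IsOpen U) (h : Admissible k U F G H)
    (hs : IsSymmetry k U s ψ) {p : ℝ × ℝ} (hp : p ∈ U) (i : Fin 2) :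
    symE F G H s ψ p i 0 1 1 + symE F G H s ψ p i 1 0 1 + symE F G H s ψ p i 1 1 0 = 0 := by
  have hA := valid_fluxA (k := k) (U := U)
  have hS := valid_symA hs
  have hB := valid_nfB h
  have hP := valid_symB h hs
  have hC := valid_nfC h
  have hC' := valid_symC h hs
  have hD := valid_nfD h
  have hD' := valid_symD h hs
  have hp0 := h.ne p hp
  simp only [symE, ord₂E, quad₁, lin₁, evals, evals₂, evals₃, Fin.sum_univ_two,
    pd_pd_pd_eval_eq hk hU (hA _) hp, pd_pd_pd_eval_eq hk hU (hS _) hp,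
    pd_pd_eval_eq hk hU (hA _) hp, pd_pd_eval_eq hk hU (hS _) hp,
    pd_pd_eval_eq hk hU (hB _ _) hp, pd_pd_eval_eq hk hU (hP _ _) hp,
    pd_eval_eq hk hU (hA _) hp, pd_eval_eq hk hU (hS _) hp, pd_eval_eq hk hU (hB _ _) hp,
    pd_eval_eq hk hU (hP _ _) hp, pd_eval_eq hk hU (hD _ _ _) hp, pd_eval_eq hk hU (hD' _ _ _) hp]
  revert i
  simp only [Fin.forall_fin_two]
  refine ⟨?_, ?_⟩ <;>
  · simp only [fluxA, symA, nfB, symB, nfC, symC, nfD, symD, Matrix.cons_val_zero,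
      Matrix.cons_val_one, d_add, d_mul, d_c, d_zero_u, d_one_u, d_zero_v, d_one_v, d_zero_uinv,
      d_one_uinv, d_zero_rad, d_one_rad, d_zero_ver, d_one_ver, d_zero_sig, d_one_sig, eval_add,
      eval_mul, eval_c, eval_u, eval_v, eval_uinv, zero_add, mul_zero, zero_mul, add_zero, one_mul,
      mul_one, Nat.reduceAdd]
    field_simp
    ring

set_option maxHeartbeats 2000000 in
lemma symE_one_one_one (hk : k = ∞ ∨ k = ω) (hU : IsOpen U) (h : Admissible k U F G H)
    (hs : IsSymmetry k U s ψ) {p : ℝ × ℝ} (hp : p ∈ U) (i : Fin 2) :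
    symE F G H s ψ p i 1 1 1 = 0 := by
  have hA := valid_fluxA (k := k) (U := U)
  have hS := valid_symA hs
  have hB := valid_nfB h
  have hP := valid_symB h hs
  have hC := valid_nfC h
  have hC' := valid_symC h hs
  have hD := valid_nfD h
  have hD' := valid_symD h hs
  have hp0 := h.ne p hp
  simp only [symE, ord₂E, quad₁, lin₁, evals, evals₂, evals₃, Fin.sum_univ_two,
    pd_pd_pd_eval_eq hk hU (hA _) hp, pd_pd_pd_eval_eq hk hU (hS _) hp,
    pd_pd_eval_eq hk hU (hA _) hp, pd_pd_eval_eq hk hU (hS _) hp,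
    pd_pd_eval_eq hk hU (hB _ _) hp, pd_pd_eval_eq hk hU (hP _ _) hp,
    pd_eval_eq hk hU (hA _) hp, pd_eval_eq hk hU (hS _) hp, pd_eval_eq hk hU (hB _ _) hp,
    pd_eval_eq hk hU (hP _ _) hp, pd_eval_eq hk hU (hD _ _ _) hp, pd_eval_eq hk hU (hD' _ _ _) hp]
  revert i
  simp only [Fin.forall_fin_two]
  refine ⟨?_, ?_⟩ <;>
  · simp only [fluxA, symA, nfB, symB, nfC, symC, nfD, symD, Matrix.cons_val_zero,
      Matrix.cons_val_one, d_add, d_mul, d_c, d_zero_u, d_one_u, d_zero_v, d_one_v, d_zero_uinv,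
      d_one_uinv, d_zero_rad, d_one_rad, d_zero_ver, d_one_ver, d_zero_sig, d_one_sig, eval_add,
      eval_mul, eval_c, eval_u, eval_v, eval_uinv, zero_add, mul_zero, zero_mul, add_zero, one_mul,
      mul_one, Nat.reduceAdd]
    field_simp
    ring

end Ex

end B2Deformation
end

noncomputable section

namespace B2Deformation

variable {k : WithTop ℕ∞} {U : Set (ℝ × ℝ)} {F G H ψ : ℝ → ℝ} {s : ℝ × ℝ → ℝ} {p₀ : ℝ × ℝ}

/-! ### The normal form is integrable -/

lemma dv_eq_pd {a : ℝ × ℝ → ℝ} {p : ℝ × ℝ} (h : DifferentiableAt ℝ a p) : dv a p = pd 1 a p := by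
  have h1 : HasDerivAt (fun t : ℝ => ((p.1, t) : ℝ × ℝ)) (0, 1) p.2 :=
    (hasDerivAt_const p.2 p.1).prodMk (hasDerivAt_id p.2)
  exact (HasFDerivAt.comp_hasDerivAt (f := fun t : ℝ => ((p.1, t) : ℝ × ℝ)) p.2
    h.hasFDerivAt h1).deriv

lemma dv_eq_eval (hk : k = ∞ ∨ k = ω) (hU : IsOpen U) {a : ℝ × ℝ → ℝ} {e : Ex}
    (ha : Set.EqOn a e.eval U) (h : e.Valid k U) : Set.EqOn (dv a) (e.d 1).eval U := by
  intro p hp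
  have hd : DifferentiableAt ℝ a p := (h.differentiableAt hk hp).congr_of_eventuallyEq
    (ha.eventuallyEq_of_mem (hU.mem_nhds hp))
  rw [dv_eq_pd hd, Ex.pd_eq_eval hk hU ha h 1 hp]

namespace Ex

lemma fluxB2_eq (i : Fin 2) (p : ℝ × ℝ) : fluxB2 i p = evals fluxA i p := by
  fin_cases i <;>
  · simp [fluxB2, evals, fluxA, eval_add, eval_mul, eval_u, eval_v, eval_c]
    ring

lemma valid_nfF (h : Admissible k U F G H) : (rad F 0 * u).Valid k U :=
  ⟨(valid_rad h 0).1, valid_u⟩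

lemma nfG_eqOn (h : Admissible k U F G H) : Set.EqOn (nfG F G) (nfC F G H 1 0).eval U := by
  intro p hp
  have := h.ne p hp
  simp only [nfG, nfF, nfC, Matrix.cons_val_zero, Matrix.cons_val_one, eval_add, eval_mul, eval_c,
    eval_u]
  change _ = 1 / 3 * F _ * F _ * p.1 + G _ * p.1 * p.1 * p.1
  field_simp
  ring

lemma nfH_eqOn (h : Admissible k U F G H) : Set.EqOn (nfH F G H) (nfC F G H 1 1).eval U := by
  intro p hp
  have := h.ne p hp
  rw [nfH, nfG_eqOn h hp]
  simp only [nfC, Matrix.cons_val_zero, Matrix.cons_val_one, eval_add, eval_mul, eval_c, eval_u]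
  change (1 / 3 * F _ * F _ * p.1 + G _ * p.1 * p.1 * p.1) / p.1 + H _ =
    1 / 3 * F _ * F _ + G _ * p.1 * p.1 + H _
  field_simp

lemma nfB_eqOn (i j : Fin 2) : Set.EqOn ((normalForm F G H).B i j) (evals₂ (nfB F) i j) U := by
  intro p _
  revert i j
  simp only [Fin.forall_fin_two]
  refine ⟨⟨rfl, rfl⟩, ?_, rfl⟩
  simp only [normalForm, normalFormOf, nfF, evals₂, nfB, Matrix.cons_val_zero, Matrix.cons_val_one,
    eval_mul, eval_u]
  change p.1 * (F _ * p.1) = F _ * p.1 * p.1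
  ring

lemma nfC_eqOn (h : Admissible k U F G H) (i j : Fin 2) :
    Set.EqOn ((normalForm F G H).C i j) (evals₂ (nfC F G H) i j) U := by
  revert i j
  simp only [Fin.forall_fin_two]
  exact ⟨⟨fun _ _ => rfl, fun _ _ => rfl⟩, nfG_eqOn h, nfH_eqOn h⟩

/-- The coefficients a₁₆, a₁₇, a₂₅, a₂₆ are given through f, g, h and their v-derivatives. With f =
Fu, g = F²u/3 + Gu³ and h = F²/3 + Gu² + H inserted they become expressions in u, F, G, H, for which
commutation can be checked formally. -/
lemma nfD_eqOn (hk : k = ∞ ∨ k = ω) (hU : IsOpen U) (h : Admissible k U F G H) (i j l : Fin 2) :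
    Set.EqOn ((normalForm F G H).D i j l) (evals₃ (nfD F G H) i j l) U := by
  have vf := valid_nfF h
  have vg := valid_nfC h 1 0
  have vh := valid_nfC h 1 1
  have ef : Set.EqOn (nfF F) (rad F 0 * u).eval U := fun p _ => rfl
  have ef1 := dv_eq_eval hk hU ef vf
  have ef2 := dv_eq_eval hk hU ef1 (vf.d hk 1)
  have eg := nfG_eqOn h
  have eg1 := dv_eq_eval hk hU eg vg
  have eg2 := dv_eq_eval hk hU eg1 (vg.d hk 1)
  have eh := nfH_eqOn h
  have eh1 := dv_eq_eval hk hU eh vh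
  intro p hp
  have hp0 := h.ne p hp
  revert i j l
  simp only [Fin.forall_fin_two]
  refine ⟨⟨⟨rfl, ?_⟩, rfl, ?_⟩, ⟨?_, ?_⟩, rfl, ?_⟩ <;>
  · simp only [normalForm, normalFormOf, evals₃, Matrix.cons_val_zero, Matrix.cons_val_one, a17,
      a16, a25, a26, ef hp, ef1 hp, ef2 hp, eg hp, eg1 hp, eg2 hp, eh hp, eh1 hp]
    simp only [nfC, nfD, Matrix.cons_val_zero,
      Matrix.cons_val_one, d_add, d_mul, d_c, d_one_u, d_one_rad, d_one_ver, eval_add,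
      eval_mul, eval_c, eval_u, eval_uinv, zero_add, mul_zero, zero_mul, add_zero, Nat.reduceAdd]
    field_simp
    ring

/-- A system whose coefficients are expressions. -/
def system (A : Fin 2 → Ex) (B C : Fin 2 → Fin 2 → Ex) (D : Fin 2 → Fin 2 → Fin 2 → Ex) :
    ConsSystem := ⟨evals A, evals₂ B, evals₂ C, evals₃ D⟩

end Ex

namespace ConsSystem

lemma flux_congr {X Y : ConsSystem} (hA : ∀ i, Set.EqOn (X.A i) (Y.A i) U)
    (hB : ∀ i j, Set.EqOn (X.B i j) (Y.B i j) U) (hC : ∀ i j, Set.EqOn (X.C i j) (Y.C i j) U)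
    (hD : ∀ i j l, Set.EqOn (X.D i j l) (Y.D i j l) U) (ε : ℝ) :
    FluxEq U (X.flux ε) (Y.flux ε) := by
  intro i z hz
  simp only [flux, hA i hz, hB i _ hz, hC i _ hz, hD i _ _ hz]

lemma bracket_congr (hU : IsOpen U) {X X' Y Y' : ConsSystem} {ε : ℝ}
    (hX : FluxEq U (X.flux ε) (X'.flux ε)) (hY : FluxEq U (Y.flux ε) (Y'.flux ε)) (i : Fin 2) :
    Set.EqOn (bracket X Y ε i) (bracket X' Y' ε i) (jetsOver U) := by
  intro z hz
  rw [bracket_eq, bracket_eq, br_congr hU hX hY i hz]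

/-- The commutation relation of the dispersionless limits. -/
lemma brB_eq_zero {A S : Fin 2 → ℝ × ℝ → ℝ} (hA : ∀ i, CkOn ∞ U (A i))
    (hS : ∀ i, CkOn ∞ U (S i))
    (h : ∀ p ∈ U, ∀ z : Jet, z.base = p → ∀ i,
      bracket (dispersionless A) (dispersionless S) 0 i z = 0) {p : ℝ × ℝ} (hp : p ∈ U)
    (i j : Fin 2) : brB A S i j p = 0 := by
  have e : ∀ A : Fin 2 → ℝ × ℝ → ℝ, (dispersionless A).flux 0 = baseFlux A := by
    intro A; funext i z; simp [flux, dispersionless, baseFlux]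
  have key : ∀ x : Fin 2 → ℝ, brB A S i 0 p * x 0 + brB A S i 1 p * x 1 = 0 := by
    intro x
    have hz : mkJet p x 0 0 ∈ jetsOver U := hp
    have := h p hp (mkJet p x 0 0) rfl i
    rw [bracket_eq, e, e, br_baseFlux_baseFlux hA hS i hz] at this
    simp only [linFlux, linPoly, Fin.sum_univ_two] at this
    exact this
  have h0 := key ![1, 0]
  have h1 := key ![0, 1]
  simp at h0 h1
  fin_cases j
  exacts [h0, h1]

end ConsSystem

open ConsSystem Ex

lemma ckOn_fluxB2 (i : Fin 2) : CkOn k U (fluxB2 i) := by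
  intro p _
  fin_cases i
  · exact (contDiff_fst.mul contDiff_snd).contDiffAt.add
      ((contDiff_fst.pow 3).div_const 3).contDiffAt
  · exact ((contDiff_snd.pow 2).div_const 2).contDiffAt

lemma pd_fluxB2 (p : ℝ × ℝ) : pd 0 (fluxB2 0) p = p.2 + p.1 ^ 2 ∧ pd 1 (fluxB2 0) p = p.1 ∧
    pd 0 (fluxB2 1) p = 0 ∧ pd 1 (fluxB2 1) p = p.2 := by
  have e : ∀ i, fluxB2 i = (fluxA i).eval := fun i => funext fun p => fluxB2_eq i p
  simp only [e, pd_eval_eq (k := ω) (Or.inr rfl) isOpen_univ (valid_fluxA _) (Set.mem_univ p)]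
  simp only [fluxA, Matrix.cons_val_zero, Matrix.cons_val_one, d_add, d_mul, d_c, d_zero_u,
    d_one_u, d_zero_v, d_one_v, eval_add, eval_mul, eval_c, eval_u, eval_v]
  refine ⟨?_, ?_, ?_, ?_⟩ <;> ring

/-- The invariant u²/2 + v moves with speed v + u² and v with speed v. Both the independence of the
differentials and the difference of the speeds amount to u ≠ 0. -/
lemma hasRiemannInvariants_fluxB2 (hp₀ : p₀.1 ≠ 0) : HasRiemannInvariants k p₀ fluxB2 := by
  refine ⟨![fun p => p.1 ^ 2 / 2 + p.2, fun p => p.2], ![fun p => p.2 + p.1 ^ 2, fun p => p.2],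
    ?_, ?_, ?_⟩
  · simp only [Fin.forall_fin_two]
    refine ⟨.of_forall fun p => ContDiff.contDiffAt ?_, .of_forall fun p => contDiffAt_snd⟩
    change ContDiff ℝ k fun p : ℝ × ℝ => p.1 ^ 2 / 2 + p.2
    fun_prop
  · simp only [Fin.forall_fin_two]
    refine ⟨.of_forall fun p => ContDiff.contDiffAt ?_, .of_forall fun p => contDiffAt_snd⟩
    change ContDiff ℝ k fun p : ℝ × ℝ => p.2 + p.1 ^ 2
    fun_prop
  · filter_upwards [continuousAt_fst.eventually_ne hp₀] with p hp
    have e0 : fderiv ℝ (fun p : ℝ × ℝ => p.1 ^ 2 / 2 + p.2) p =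
        p.1 • ContinuousLinearMap.fst ℝ ℝ ℝ + ContinuousLinearMap.snd ℝ ℝ ℝ := hasFDerivAt_rad.fderiv
    have e1 : fderiv ℝ (fun p : ℝ × ℝ => p.2) p = ContinuousLinearMap.snd ℝ ℝ ℝ := fderiv_snd
    refine ⟨?_, by simpa using hp, ?_⟩
    · refine Fintype.linearIndependent_iff.2 fun g hg => ?_
      have h0 := congrArg (fun l : ℝ × ℝ →L[ℝ] ℝ => l (1, 0)) hg
      have h1 := congrArg (fun l : ℝ × ℝ →L[ℝ] ℝ => l (0, 1)) hg
      simp only [Fin.sum_univ_two, Matrix.cons_val_zero, Matrix.cons_val_one, e0, e1] at h0 h1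
      simp [hp] at h0 h1
      rw [h0, zero_add] at h1
      exact Fin.forall_fin_two.2 ⟨h0, h1⟩
    · obtain ⟨h1, h2, h3, h4⟩ := pd_fluxB2 p
      simp only [Fin.forall_fin_two, fderiv_eq_pd (fluxB2 _), h1, h2, h3, h4, Matrix.cons_val_zero,
        Matrix.cons_val_one, e0, e1]
      refine ⟨fun w => ?_, fun w => ?_⟩
      · simp; ring
      · simp

/-- The symmetries of the `(2,1)` flow. -/
lemma exists_isSymmetry (hk : k = ∞ ∨ k = ω) (hp₀ : p₀.1 ≠ 0) {S : Fin 2 → ℝ × ℝ → ℝ}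
    (hS : ∀ i, B2Deformation.NearCk k p₀ (S i)) (h : CommuteDispersionless p₀ fluxB2 S) :
    ∃ ψ : ℝ → ℝ, ∃ U, IsOpen U ∧ p₀ ∈ U ∧ IsSymmetry k U (S 0) ψ ∧
      ∀ i, Set.EqOn (S i) (evals (symA (S 0) ψ) i) U := by
  obtain ⟨V, hV, hVo, hpV⟩ := eventually_nhds_iff.1
    ((((hS 0).and (hS 1)).and h).and (continuousAt_fst.eventually_ne hp₀))
  have hS0 : CkOn k V (S 0) := fun p hp => (hV p hp).1.1.1
  have hS1 : CkOn k V (S 1) := fun p hp => (hV p hp).1.1.2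
  have hSi : ∀ i, CkOn ∞ V (S i) := by
    intro i p hp
    fin_cases i
    exacts [(hS0 p hp).of_le (infty_le_of_order hk), (hS1 p hp).of_le (infty_le_of_order hk)]
  have hb : ∀ p ∈ V, pd 0 (S 1) p = 0 ∧ pd 0 (S 0) p = p.1 * pd 1 (S 0) p + pd 1 (S 1) p := by
    intro p hp
    have key := brB_eq_zero ckOn_fluxB2 hSi (fun p hp => (hV p hp).1.2) hp
    have hp0 := (hV p hp).2
    obtain ⟨h1, h2, h3, h4⟩ := pd_fluxB2 p
    -- Dispersionless commutation says that the Jacobian matrices of the fluxes commute. The entry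
    -- (1, 0) is -u² ∂_u S¹, with S¹ the flux of v; the entry (0, 1) is u times the defect of s_u =
    -- u s_v + ψ'.
    have k10 := key 1 0
    have k01 := key 0 1
    simp only [brB, Fin.sum_univ_two, h1, h2, h3, h4] at k10 k01
    have e1 : pd 0 (S 1) p = 0 := by
      have : p.1 ^ 2 * pd 0 (S 1) p = 0 := by linear_combination -k10
      simpa [hp0] using this
    refine ⟨e1, ?_⟩
    have : p.1 * (pd 0 (S 0) p - (p.1 * pd 1 (S 0) p + pd 1 (S 1) p)) = 0 := by
      linear_combination -k01
    exact sub_eq_zero.1 ((mul_eq_zero.1 this).resolve_left hp0)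
  obtain ⟨ψ, hψ, hψS⟩ := exists_eq_ver hk (hS 1)
    (by filter_upwards [hVo.mem_nhds hpV] with p hp using (hb p hp).1)
  obtain ⟨U, hU, hUo, hpU⟩ := eventually_nhds_iff.1
    ((hVo.eventually_mem hpV).and (hψS.and (continuousAt_snd.eventually hψ)))
  have e1 : Set.EqOn (S 1) (ver ψ 0).eval U := fun p hp => (hU p hp).2.1
  have hv : (ver ψ 0).Valid k U := fun p hp => (hU p hp).2.2
  refine ⟨ψ, U, hUo, hpU, ⟨fun p hp => hS0 p (hU p hp).1, hv, fun p hp => ?_⟩, ?_⟩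
  · rw [(hb p (hU p hp).1).2, pd_eq_eval hk hUo e1 hv 1 hp]; rfl
  · simp only [Fin.forall_fin_two]
    exact ⟨fun p _ => rfl, e1⟩

lemma eventually_admissible (hp₀ : p₀.1 ≠ 0)
    (hF : B2Deformation.NearCk k (p₀.1 ^ 2 / 2 + p₀.2) F)
    (hG : B2Deformation.NearCk k (p₀.1 ^ 2 / 2 + p₀.2) G) (hH : B2Deformation.NearCk k p₀.2 H) :
    ∀ᶠ p in 𝓝 p₀, p.1 ≠ 0 ∧ ContDiffAt ℝ k F (p.1 ^ 2 / 2 + p.2) ∧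
      ContDiffAt ℝ k G (p.1 ^ 2 / 2 + p.2) ∧ ContDiffAt ℝ k H p.2 := by
  have hr : ContinuousAt (fun p : ℝ × ℝ => p.1 ^ 2 / 2 + p.2) p₀ := by fun_prop
  filter_upwards [continuousAt_fst.eventually_ne hp₀, hr.eventually hF, hr.eventually hG,
    continuousAt_snd.eventually hH] with p h1 h2 h3 h4 using ⟨h1, h2, h3, h4⟩

lemma Ex.IsSymmetry.mono {V : Set (ℝ × ℝ)} (h : IsSymmetry k V s ψ) (hUV : U ⊆ V) :
    IsSymmetry k U s ψ :=
  ⟨fun p hp => h.ckOn_s p (hUV hp), fun p hp => h.contDiffAt_ψ p (hUV hp),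
    fun p hp => h.eq p (hUV hp)⟩

lemma commute_normalForm (hk : k = ∞ ∨ k = ω) (hU : IsOpen U) (h : Admissible k U F G H)
    (hs : IsSymmetry k U s ψ) {Y : ConsSystem}
    (hA : ∀ i, Set.EqOn (Y.A i) (evals (symA s ψ) i) U) (hB : Y.B = evals₂ (symB F s ψ))
    (hC : Y.C = evals₂ (symC F G H s ψ)) (hD : Y.D = evals₃ (symD F G H s ψ)) {z : Jet}
    (hz : z ∈ jetsOver U) (i : Fin 2) :
    (fun ε : ℝ => bracket (normalForm F G H) Y ε i z) =O[𝓝 0] fun ε : ℝ => ε ^ 3 := by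
  have hX : ∀ ε, FluxEq U ((normalForm F G H).flux ε)
      ((Ex.system fluxA (nfB F) (nfC F G H) (nfD F G H)).flux ε) :=
    flux_congr (fun i p _ => fluxB2_eq i p) nfB_eqOn (nfC_eqOn h) (nfD_eqOn hk hU h)
  have hY : ∀ ε, FluxEq U (Y.flux ε)
      ((Ex.system (symA s ψ) (symB F s ψ) (symC F G H s ψ) (symD F G H s ψ)).flux ε) :=
    flux_congr hA (fun i j p _ => by rw [hB]; rfl) (fun i j p _ => by rw [hC]; rfl)
      (fun i j l p _ => by rw [hD]; rfl)
  simp only [fun ε => bracket_congr hU (hX ε) (hY ε) i hz]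
  have top : ∀ {e : Ex}, e.Valid k U → CkOn ∞ U e.eval := fun he p hp =>
    (he.ckOn hk p hp).of_le (infty_le_of_order hk)
  have sX : (Ex.system fluxA (nfB F) (nfC F G H) (nfD F G H)).SmoothOver U :=
    ⟨fun _ => top (valid_fluxA _), fun _ _ => top (valid_nfB h _ _),
      fun _ _ => top (valid_nfC h _ _), fun _ _ _ => top (valid_nfD h _ _ _)⟩
  have sY : (Ex.system (symA s ψ) (symB F s ψ) (symC F G H s ψ) (symD F G H s ψ)).SmoothOver U :=
    ⟨fun _ => top (valid_symA hs _), fun _ _ => top (valid_symB h hs _ _),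
      fun _ _ => top (valid_symC h hs _ _), fun _ _ _ => top (valid_symD h hs _ _ _)⟩
  refine (bracket_isBigO_iff hU sX sY hz i).2 ⟨?_, ?_, ?_⟩
  · rw [br_baseFlux_baseFlux sX.A sY.A i hz]
    have e := fun j => brB_sym hk hU hs hz i j
    simp only [linFlux, linPoly, Ex.system, e, zero_mul, Finset.sum_const_zero]
  · rw [order_one_eq hU sX.A sY.A sX.B sY.B hz]
    have e := fun j => ord₁C_sym hk hU h hs hz i j
    obtain ⟨e0, e1, e2⟩ := ord₁D_sym hk hU h hs hz i
    simp only [Ex.system, e, Fin.sum_univ_two]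
    linear_combination e0 * z 1 0 ^ 2 + e1 * z 1 0 * z 1 1 + e2 * z 1 1 ^ 2
  · rw [order_two_eq hU sX.A sY.A sX.B sY.B sX.C sY.C sX.D sY.D hz]
    exact cubForm_eq_zero (fun j => ord₂C_sym hk hU h hs hz i j)
      (fun j l => ord₂D_sym hk hU h hs hz i j l) (symE_zero_zero_zero hk hU h hs hz i)
      (symE_zero_zero_one hk hU h hs hz i) (symE_zero_one_one hk hU h hs hz i)
      (symE_one_one_one hk hU h hs hz i) z

theorem integrable_normalForm (hk : k = ∞ ∨ k = ω) (hp₀ : p₀.1 ≠ 0)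
    (hF : B2Deformation.NearCk k (p₀.1 ^ 2 / 2 + p₀.2) F)
    (hG : B2Deformation.NearCk k (p₀.1 ^ 2 / 2 + p₀.2) G) (hH : B2Deformation.NearCk k p₀.2 H) :
    (normalForm F G H).IntegrableUpToTwo k p₀ := by
  refine ⟨hasRiemannInvariants_fluxB2 hp₀, fun S hS hcomm => ?_⟩
  obtain ⟨ψ, V, hV, hpV, hs, hSs⟩ := exists_isSymmetry hk hp₀ hS hcomm
  obtain ⟨U, hU, hUo, hpU⟩ := eventually_nhds_iff.1
    ((eventually_admissible hp₀ hF hG hH).and (hV.eventually_mem hpV))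
  have had : Admissible k U F G H := ⟨fun p hp => (hU p hp).1.1, fun p hp => (hU p hp).1.2.1,
    fun p hp => (hU p hp).1.2.2.1, fun p hp => (hU p hp).1.2.2.2⟩
  have hs' := hs.mono fun p hp => (hU p hp).2
  -- The leading flux must be `S` everywhere, so `S` itself is used; it agrees with the formal
  -- fluxes (s, ψ(v)) only near p₀, which is enough.
  refine ⟨⟨S, evals₂ (symB F (S 0) ψ), evals₂ (symC F G H (S 0) ψ), evals₃ (symD F G H (S 0) ψ)⟩,
    ⟨hS, ?_, ?_, ?_⟩, rfl, ?_⟩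
  · intro i j
    filter_upwards [hUo.mem_nhds hpU] with p hp using (valid_symB had hs' i j).ckOn hk p hp
  · intro i j
    filter_upwards [hUo.mem_nhds hpU] with p hp using (valid_symC had hs' i j).ckOn hk p hp
  · intro i j l
    filter_upwards [hUo.mem_nhds hpU] with p hp using (valid_symD had hs' i j l).ckOn hk p hp
  · filter_upwards [hUo.mem_nhds hpU] with p hp z hz i
    subst hz
    exact commute_normalForm hk hUo had hs' (fun i p hp => hSs i (hU p hp).2) rfl rfl rfl hp i

end B2Deformation
end

noncomputable section

namespace B2Deformation

open Ex

variable {k : WithTop ℕ∞} {U : Set (ℝ × ℝ)} {p₀ : ℝ × ℝ}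

/-! ### The first order part of a normalized integrable system -/

/-- The fluxes `(u²/2 + v, 0)` of a symmetry of the `(2,1)` flow. -/
def radA : Fin 2 → Ex := ![c (1 / 2) * u * u + v, c 0]

lemma valid_radA (i : Fin 2) : (radA i).Valid k U := by
  fin_cases i <;> simp [radA, valid_add, valid_mul, valid_c, valid_u, valid_v]

/-- The conditions on the first order terms which the first Miura transformation achieves. -/
structure FirstNormal (U : Set (ℝ × ℝ)) (B : Fin 2 → Fin 2 → ℝ × ℝ → ℝ) : Prop where
  zero_zero : ∀ p ∈ U, B 0 0 p = 0
  one_one : ∀ p ∈ U, B 1 1 p = B 1 0 p * p.1⁻¹ - p.1 * B 0 1 p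

/-- The first order commutation relation. -/
structure FirstCommute (U : Set (ℝ × ℝ)) (A S : Fin 2 → ℝ × ℝ → ℝ)
    (B P : Fin 2 → Fin 2 → ℝ × ℝ → ℝ) : Prop where
  c : ∀ p ∈ U, ∀ i j, ord₁C A S B P p i j = 0
  zero_zero : ∀ p ∈ U, ∀ i, ord₁D A S B P p i 0 0 = 0
  zero_one : ∀ p ∈ U, ∀ i, ord₁D A S B P p i 0 1 + ord₁D A S B P p i 1 0 = 0
  one_one : ∀ p ∈ U, ∀ i, ord₁D A S B P p i 1 1 = 0

/-- The relations are solved for the symmetry first: P₁₀, P₀₀, P₁₁ and P₀₁ each occur algebraically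
once the earlier ones are known. The remaining relations are then conditions on the system itself,
and the final one is the equation that produces F. -/
lemma first_order (hk : k = ∞ ∨ k = ω) (hU : IsOpen U) (hne : ∀ p ∈ U, p.1 ≠ 0)
    {B P : Fin 2 → Fin 2 → ℝ × ℝ → ℝ} (hB : ∀ i j, CkOn k U (B i j))
    (hn : FirstNormal U B) (h : FirstCommute U (evals fluxA) (evals radA) B P) :
    (∀ p ∈ U, B 0 1 p = 0 ∧ P 1 0 p = B 1 0 p * p.1⁻¹ ∧
      P 0 0 p = -1 / 2 * B 1 0 p * p.1⁻¹ ^ 2 ∧ P 1 1 p = B 1 0 p * p.1⁻¹ ^ 2 ∧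
      P 0 1 p = -1 / 2 * B 1 0 p * p.1⁻¹ ^ 3) ∧
    ∀ p ∈ U, pd 0 (fun p => B 1 0 p * p.1⁻¹ * p.1⁻¹) p -
      p.1 * pd 1 (fun p => B 1 0 p * p.1⁻¹ * p.1⁻¹) p = 0 := by
  have vu : uinv.Valid k U := hne
  have vb : (fn (B 1 0)).Valid k U := hB 1 0
  have vb' : (fn (B 0 1)).Valid k U := hB 0 1
  have hA := valid_fluxA (k := k) (U := U)
  have hS := valid_radA (k := k) (U := U)
  have eB0 : ∀ j, Set.EqOn (pd j (B 0 0)) ((Ex.c 0).d j).eval U := fun j =>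
    pd_eq_eval (e := Ex.c 0) hk hU (fun p hp => hn.zero_zero p hp) trivial j
  have eB1 : ∀ j, Set.EqOn (pd j (B 1 1)) ((fn (B 1 0) * uinv - u * fn (B 0 1)).d j).eval U :=
    fun j => pd_eq_eval (e := fn (B 1 0) * uinv - u * fn (B 0 1)) hk hU (fun p hp => by
      rw [hn.one_one p hp, eval_sub, eval_mul, eval_mul]; rfl)
      (valid_sub.2 ⟨valid_mul.2 ⟨vb, vu⟩, valid_mul.2 ⟨trivial, vb'⟩⟩) j
  have raw : ∀ p ∈ U, _ := fun p hp =>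
    (⟨h.c p hp 0 1, h.c p hp 1 0, h.zero_zero p hp 0, h.zero_one p hp 0, h.one_one p hp 0,
      h.zero_one p hp 1, h.one_one p hp 1⟩ : _ ∧ _ ∧ _ ∧ _ ∧ _ ∧ _ ∧ _)
  have raw' : ∀ p ∈ U, _ := fun p hp => by
    have := raw p hp
    simp only [ord₁C, ord₁D, brC, brD, Fin.sum_univ_two, evals,
      pd_pd_eval_eq hk hU (hA _) hp, pd_pd_eval_eq hk hU (hS _) hp, pd_eval_eq hk hU (hA _) hp,
      pd_eval_eq hk hU (hS _) hp, eB0 _ hp, eB1 _ hp, hn.zero_zero p hp, hn.one_one p hp] at this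
    simp only [fluxA, radA, Matrix.cons_val_zero, Matrix.cons_val_one, d_add, d_mul, d_sub, d_c,
      d_zero_u, d_one_u, d_zero_v, d_one_v, d_zero_uinv, d_one_uinv, d_fn, eval_add, eval_mul,
      eval_c, eval_u, eval_v, eval_uinv, eval_fn, zero_add, mul_zero, zero_mul, add_zero,
      mul_one, one_mul, sub_zero, zero_sub] at this
    exact this
  clear raw
  have P10 : ∀ p ∈ U, P 1 0 p = (fn (B 1 0) * uinv).eval p := by
    intro p hp
    have hp0 := hne p hp
    obtain ⟨-, h1, -⟩ := raw' p hp
    simp only [eval_mul, eval_fn, eval_uinv]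
    linear_combination (norm := (field_simp; ring)) -p.1⁻¹ ^ 2 * h1
  have v10 : (fn (B 1 0) * uinv).Valid k U := ⟨vb, vu⟩
  have P10' := fun j => pd_eq_eval hk hU P10 v10 j
  have P00 : ∀ p ∈ U, P 0 0 p = (c (-1 / 2) * fn (B 1 0) * uinv * uinv).eval p := by
    intro p hp
    have hp0 := hne p hp
    obtain ⟨-, -, h2, -⟩ := raw' p hp
    rw [P10' 0 hp] at h2
    simp only [d_mul, d_fn, d_zero_uinv, eval_add, eval_mul, eval_fn, eval_uinv, eval_c] at h2 ⊢
    linear_combination (norm := (field_simp; ring)) -(1 / 2) * p.1⁻¹ * h2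
  have v00 : (c (-1 / 2) * fn (B 1 0) * uinv * uinv).Valid k U := ⟨⟨⟨trivial, vb⟩, vu⟩, vu⟩
  have P00' := fun j => pd_eq_eval hk hU P00 v00 j
  have P11 : ∀ p ∈ U, P 1 1 p = (fn (B 1 0) * uinv * uinv).eval p := by
    intro p hp
    have hp0 := hne p hp
    obtain ⟨-, -, -, -, -, h5, h6⟩ := raw' p hp
    rw [P10 p hp, P10' 0 hp, P10' 1 hp] at h5
    simp only [d_mul, d_fn, d_zero_uinv, d_one_uinv, eval_add, eval_mul, eval_fn, eval_uinv,
      eval_c] at h5 h6 ⊢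
    linear_combination (norm := (field_simp; ring)) p.1⁻¹ * h5 - h6
  have v11 : (fn (B 1 0) * uinv * uinv).Valid k U := ⟨⟨vb, vu⟩, vu⟩
  have P11' := fun j => pd_eq_eval hk hU P11 v11 j
  have P01 : ∀ p ∈ U, P 0 1 p = (c (-1 / 2) * fn (B 1 0) * uinv * uinv * uinv).eval p := by
    intro p hp
    have hp0 := hne p hp
    obtain ⟨h0, -⟩ := raw' p hp
    rw [P00 p hp, P11 p hp] at h0
    simp only [eval_mul, eval_fn, eval_uinv, eval_c] at h0 ⊢
    linear_combination (norm := (field_simp; ring)) p.1⁻¹ ^ 2 * h0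
  have P01' := fun j => pd_eq_eval hk hU P01 ⟨v00, vu⟩ j
  have key : ∀ p ∈ U, B 0 1 p = 0 ∧ ((fn (B 1 0) * uinv * uinv).d 0).eval p -
      p.1 * ((fn (B 1 0) * uinv * uinv).d 1).eval p = 0 := by
    intro p hp
    have hp0 := hne p hp
    obtain ⟨-, -, -, h3, h4, -, h6⟩ := raw' p hp
    rw [P00 p hp, P00' 0 hp, P00' 1 hp, P10' 1 hp, P11' 0 hp, P01' 0 hp] at h3
    rw [P01 p hp, P01' 0 hp, P01' 1 hp, P11' 1 hp] at h4
    rw [P11 p hp, P11' 0 hp, P11' 1 hp] at h6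
    simp only [d_mul, d_fn, d_c, d_zero_uinv, d_one_uinv, eval_add, eval_mul, eval_fn, eval_uinv,
      eval_c] at h3 h4 h6 ⊢
    -- After insertion of P, the combination h3 - u h4 leaves B₀₁ alone, while h3 + h6 is a multiple
    -- of the derivative of B₁₀/u² along ∂_u - u∂_v.
    constructor
    · linear_combination (norm := (field_simp; ring)) h3 - p.1 * h4
    · linear_combination (norm := (field_simp; ring)) 2 * p.1⁻¹ * (h3 + h6)
  refine ⟨fun p hp => ⟨(key p hp).1, P10 p hp, ?_, ?_, ?_⟩, fun p hp => ?_⟩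
  · rw [P00 p hp]
    simp only [eval_mul, eval_fn, eval_uinv, eval_c]
    ring
  · rw [P11 p hp]
    simp only [eval_mul, eval_fn, eval_uinv]
    ring
  · rw [P01 p hp]
    simp only [eval_mul, eval_fn, eval_uinv, eval_c]
    ring
  · have e : (fun p => B 1 0 p * p.1⁻¹ * p.1⁻¹) = (fn (B 1 0) * uinv * uinv).eval := rfl
    rw [e, pd_eval hk hU v11 0 hp, pd_eval hk hU v11 1 hp]
    exact (key p hp).2

end B2Deformation
end

noncomputable section

namespace B2Deformation

open Ex

variable {k : WithTop ℕ∞} {U : Set (ℝ × ℝ)} {p₀ : ℝ × ℝ} {F G H : ℝ → ℝ}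

set_option linter.unusedSimpArgs false

/-! ### The second order part of a normalized integrable system -/

/-- The unknown coefficients in the second order part of a normalized system (`g`, `h`, `a₁₆`,
`a₁₇`, `a₂₅`, `a₂₆`) and of its symmetry (`cᵢⱼ` and `dᵢⱼ`). -/
structure SecondCoeffs where
  (g h a16 a17 a25 a26 c00 c01 c10 c11 d00 d01 d02 d10 d11 d12 : ℝ × ℝ → ℝ)

namespace SecondCoeffs

/-- The coefficients of second derivatives in a normalized system. -/
def sysC (q : SecondCoeffs) : Fin 2 → Fin 2 → Ex := ![![c 0, c 0], ![fn q.g, fn q.h]]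

/-- The coefficients of products in a normalized system. -/
def sysD (q : SecondCoeffs) : Fin 2 → Fin 2 → Fin 2 → Ex :=
  ![![![c 0, fn q.a17], ![c 0, fn q.a16]], ![![fn q.a25, u * fn q.a26], ![c 0, fn q.a26]]]

/-- The coefficients of first derivatives in the symmetry. -/
def radB (F : ℝ → ℝ) : Fin 2 → Fin 2 → Ex :=
  ![![c (-1 / 2) * rad F 0, c (-1 / 2) * rad F 0 * uinv], ![rad F 0 * u, rad F 0]]

/-- The coefficients of second derivatives in the symmetry. -/
def radC (q : SecondCoeffs) : Fin 2 → Fin 2 → Ex :=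
  ![![fn q.c00, fn q.c01], ![fn q.c10, fn q.c11]]

/-- The coefficients of products in the symmetry. -/
def radD (q : SecondCoeffs) : Fin 2 → Fin 2 → Fin 2 → Ex :=
  ![![![fn q.d00, fn q.d01], ![c 0, fn q.d02]], ![![fn q.d10, fn q.d11], ![c 0, fn q.d12]]]

/-- All coefficients are of class `C^k` on `U`. -/
structure Regular (k : WithTop ℕ∞) (U : Set (ℝ × ℝ)) (q : SecondCoeffs) : Prop where
  sysC : ∀ i j, (q.sysC i j).Valid k U
  sysD : ∀ i j l, (q.sysD i j l).Valid k U
  radC : ∀ i j, (q.radC i j).Valid k U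
  radD : ∀ i j l, (q.radD i j l).Valid k U

end SecondCoeffs

open SecondCoeffs

/-- The second order commutation relation. -/
structure SecondCommute (U : Set (ℝ × ℝ)) (A S : Fin 2 → ℝ × ℝ → ℝ)
    (B P C C' : Fin 2 → Fin 2 → ℝ × ℝ → ℝ) (D D' : Fin 2 → Fin 2 → Fin 2 → ℝ × ℝ → ℝ) :
    Prop where
  c : ∀ p ∈ U, ∀ i j, ord₂C A S B P C C' p i j = 0
  d : ∀ p ∈ U, ∀ i j l, ord₂D A S B P C C' D D' p i j l = 0
  zero : ∀ p ∈ U, ∀ i, ord₂E A S B P C C' D D' p i 0 0 0 = 0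
  one : ∀ p ∈ U, ∀ i, ord₂E A S B P C C' D D' p i 0 0 1 + ord₂E A S B P C C' D D' p i 0 1 0 +
    ord₂E A S B P C C' D D' p i 1 0 0 = 0
  two : ∀ p ∈ U, ∀ i, ord₂E A S B P C C' D D' p i 0 1 1 + ord₂E A S B P C C' D D' p i 1 0 1 +
    ord₂E A S B P C C' D D' p i 1 1 0 = 0
  three : ∀ p ∈ U, ∀ i, ord₂E A S B P C C' D D' p i 1 1 1 = 0

/-- The second order commutation relation of a normalized system with its symmetry. -/
structure SecondRelations (F : ℝ → ℝ) (q : SecondCoeffs) (p : ℝ × ℝ) : Prop where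
  xxx_zero_zero :
    1 / 2 * (rad F 0).eval p ^ 2 * p.1 + q.c10 p * p.1 - q.g p = 0
  xxx_zero_one :
    1 / 2 * (rad F 0).eval p ^ 2 - q.c00 p * p.1 + q.c01 p * p.1 ^ 2 + q.c11 p * p.1 - q.h p = 0
  x_xx_zero_zero_zero :
    2 * (rad F 0).eval p * (rad F 1).eval p * p.1 ^ 2 + 3 * (rad F 0).eval p ^ 2 - 2 * q.a25 p -
    6 * q.c00 p * p.1 + pd 0 q.c10 p * p.1 + 2 * q.d10 p * p.1 - pd 0 q.g p = 0
  x_xx_zero_one_zero :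
    2 * (rad F 0).eval p * (rad F 1).eval p * p.1 + 1 / 2 * (rad F 0).eval p ^ 2 * p.1⁻¹ -
    q.a26 p * p.1 - 3 * q.c00 p + pd 1 q.c00 p * p.1 ^ 2 - pd 0 q.c00 p * p.1 + pd 1 q.c10 p * p.1 +
    q.d11 p * p.1 - pd 1 q.g p = 0
  x_xx_zero_zero_one :
    2 * (rad F 0).eval p * (rad F 1).eval p * p.1 + (rad F 0).eval p ^ 2 * p.1⁻¹ - q.a17 p * p.1 -
    q.a26 p * p.1 - 3 * q.c00 p + pd 0 q.c11 p * p.1 - 2 * q.d00 p * p.1 + q.d01 p * p.1 ^ 2 +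
    q.d11 p * p.1 - pd 0 q.h p = 0
  x_xx_zero_one_one :
    2 * (rad F 0).eval p * (rad F 1).eval p - 2 * q.a16 p * p.1 + q.a17 p - 2 * q.a26 p -
    3 * q.c01 p + pd 1 q.c01 p * p.1 ^ 2 - pd 0 q.c01 p * p.1 + pd 1 q.c11 p * p.1 - q.d01 p * p.1 +
    2 * q.d02 p * p.1 ^ 2 + 2 * q.d12 p * p.1 - pd 1 q.h p = 0
  x_xx_one_zero_zero :
    -2 * (rad F 0).eval p * (rad F 1).eval p * p.1 ^ 3 - 4 * (rad F 0).eval p ^ 2 * p.1 +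
    2 * q.a25 p * p.1 - 6 * q.c10 p * p.1 - pd 0 q.c10 p * p.1 ^ 2 - 2 * q.d10 p * p.1 ^ 2 +
    3 * q.g p + pd 0 q.g p * p.1 = 0
  x_xx_one_one_zero :
    -2 * (rad F 0).eval p * (rad F 1).eval p * p.1 ^ 2 - (rad F 0).eval p ^ 2 + q.a26 p * p.1 ^ 2 -
    3 * q.c10 p - pd 0 q.c10 p * p.1 - q.d11 p * p.1 ^ 2 + pd 0 q.g p = 0
  x_xx_one_zero_one :
    -2 * (rad F 0).eval p * (rad F 1).eval p * p.1 ^ 2 - 2 * (rad F 0).eval p ^ 2 + 2 * q.a25 p -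
    3 * q.c10 p - pd 0 q.c11 p * p.1 ^ 2 - 2 * q.d10 p * p.1 + pd 0 q.h p * p.1 = 0
  x_xx_one_one_one :
    -2 * (rad F 0).eval p * (rad F 1).eval p * p.1 - 1 / 2 * (rad F 0).eval p ^ 2 * p.1⁻¹ +
    q.a26 p * p.1 - 3 * q.c11 p - pd 0 q.c11 p * p.1 - q.d11 p * p.1 + pd 0 q.h p = 0
  x_x_x_zero_zero :
    7 / 2 * (rad F 0).eval p * (rad F 1).eval p * p.1 +
    1 / 2 * (rad F 0).eval p * (rad F 2).eval p * p.1 ^ 3 + (rad F 0).eval p ^ 2 * p.1⁻¹ +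
    1 / 2 * (rad F 1).eval p ^ 2 * p.1 ^ 3 - pd 0 q.a25 p - 2 * q.c00 p - 4 * q.d00 p * p.1 +
    pd 0 q.d10 p * p.1 = 0
  x_x_x_zero_one :
    5 * (rad F 0).eval p * (rad F 1).eval p +
    3 / 2 * (rad F 0).eval p * (rad F 2).eval p * p.1 ^ 2 + 3 / 2 * (rad F 1).eval p ^ 2 * p.1 ^ 2 +
    q.a17 p - pd 1 q.a25 p - q.a26 p - pd 0 q.a26 p * p.1 - 4 * q.d00 p + pd 1 q.d00 p * p.1 ^ 2 -
    pd 0 q.d00 p * p.1 - 2 * q.d01 p * p.1 + pd 1 q.d10 p * p.1 + pd 0 q.d11 p * p.1 = 0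
  x_x_x_zero_three :
    1 / 2 * (rad F 0).eval p * (rad F 2).eval p + 1 / 2 * (rad F 1).eval p ^ 2 -
    pd 1 q.a16 p * p.1 + pd 0 q.a16 p - pd 1 q.a26 p - 2 * q.d02 p + pd 1 q.d02 p * p.1 ^ 2 -
    pd 0 q.d02 p * p.1 + pd 1 q.d12 p * p.1 = 0
  x_x_x_one_zero :
    -9 / 2 * (rad F 0).eval p * (rad F 1).eval p * p.1 ^ 2 -
    1 / 2 * (rad F 0).eval p * (rad F 2).eval p * p.1 ^ 4 - 2 * (rad F 0).eval p ^ 2 -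
    1 / 2 * (rad F 1).eval p ^ 2 * p.1 ^ 4 + 2 * q.a25 p + pd 0 q.a25 p * p.1 - 2 * q.c10 p -
    4 * q.d10 p * p.1 - pd 0 q.d10 p * p.1 ^ 2 = 0
  x_x_x_one_two :
    -7 / 2 * (rad F 0).eval p * (rad F 1).eval p -
    3 / 2 * (rad F 0).eval p * (rad F 2).eval p * p.1 ^ 2 +
    1 / 2 * (rad F 0).eval p ^ 2 * p.1⁻¹ ^ 2 - 3 / 2 * (rad F 1).eval p ^ 2 * p.1 ^ 2 + q.a26 p +
    2 * pd 0 q.a26 p * p.1 - 3 * q.d11 p - pd 0 q.d11 p * p.1 - pd 0 q.d12 p * p.1 ^ 2 = 0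
  x_x_x_one_three :
    -1 / 2 * (rad F 0).eval p * (rad F 1).eval p * p.1⁻¹ -
    1 / 2 * (rad F 0).eval p * (rad F 2).eval p * p.1 - 1 / 2 * (rad F 1).eval p ^ 2 * p.1 +
    pd 0 q.a26 p - 2 * q.d12 p - pd 0 q.d12 p * p.1 = 0

-- Only the relations used in the elimination are extracted. In the names the first index is the
-- component; after `x_xx` the other two are those of the first and of the second derivative, and
-- after `x_x_x` a single index counts the factors v_x.
set_option maxHeartbeats 2000000 in
lemma SecondCommute.relations (hk : k = ∞ ∨ k = ω) (hU : IsOpen U) (hne : ∀ p ∈ U, p.1 ≠ 0)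
    (vF : ∀ n, (rad F n).Valid k U) {q : SecondCoeffs} (hq : q.Regular k U)
    (h : SecondCommute U (evals fluxA) (evals radA) (evals₂ (nfB F)) (evals₂ (radB F))
      (evals₂ q.sysC) (evals₂ q.radC) (evals₃ q.sysD) (evals₃ q.radD)) {p : ℝ × ℝ} (hp : p ∈ U) :
    SecondRelations F q p := by
  have hp0 := hne p hp
  have vu : uinv.Valid k U := hne
  have hA := valid_fluxA (k := k) (U := U)
  have hS := valid_radA (k := k) (U := U)
  have hB : ∀ i j, (nfB F i j).Valid k U := by
    simp only [Fin.forall_fin_two]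
    simp [nfB, valid_mul, valid_c, valid_u, vF]
  have hP : ∀ i j, (radB F i j).Valid k U := by
    simp only [Fin.forall_fin_two]
    simp [radB, valid_mul, valid_c, valid_u, vF, vu]
  have hC := hq.sysC
  have hC' := hq.radC
  have hD := hq.sysD
  have hD' := hq.radD
  constructor
  · have e := h.c p hp 0 0
    simp only [ord₂C, ord₂D, ord₂E, quad₃, quad₂, quad₁, lin₃, lin₂, lin₁, evals, evals₂, evals₃,
      Fin.sum_univ_two, pd_pd_pd_eval_eq hk hU (hA _) hp, pd_pd_pd_eval_eq hk hU (hS _) hp,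
      pd_pd_eval_eq hk hU (hA _) hp, pd_pd_eval_eq hk hU (hS _) hp,
      pd_pd_eval_eq hk hU (hB _ _) hp, pd_pd_eval_eq hk hU (hP _ _) hp,
      pd_eval_eq hk hU (hA _) hp, pd_eval_eq hk hU (hS _) hp, pd_eval_eq hk hU (hB _ _) hp,
      pd_eval_eq hk hU (hP _ _) hp, pd_eval_eq hk hU (hC _ _) hp, pd_eval_eq hk hU (hC' _ _) hp,
      pd_eval_eq hk hU (hD _ _ _) hp, pd_eval_eq hk hU (hD' _ _ _) hp] at e
    simp only [fluxA, radA, nfB, radB, sysC, radC, sysD, radD, Matrix.cons_val_zero,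
      Matrix.cons_val_one, d_add, d_mul, d_c, d_zero_u, d_one_u, d_zero_v, d_one_v, d_zero_uinv,
      d_one_uinv, d_zero_rad, d_one_rad, d_fn, eval_add, eval_mul, eval_c, eval_u, eval_v,
      eval_uinv, eval_fn, zero_add, mul_zero, zero_mul, add_zero, one_mul, mul_one,
      Nat.reduceAdd] at e
    linear_combination (norm := (field_simp; ring)) e
  · have e := h.c p hp 0 1
    simp only [ord₂C, ord₂D, ord₂E, quad₃, quad₂, quad₁, lin₃, lin₂, lin₁, evals, evals₂, evals₃,
      Fin.sum_univ_two, pd_pd_pd_eval_eq hk hU (hA _) hp, pd_pd_pd_eval_eq hk hU (hS _) hp,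
      pd_pd_eval_eq hk hU (hA _) hp, pd_pd_eval_eq hk hU (hS _) hp,
      pd_pd_eval_eq hk hU (hB _ _) hp, pd_pd_eval_eq hk hU (hP _ _) hp,
      pd_eval_eq hk hU (hA _) hp, pd_eval_eq hk hU (hS _) hp, pd_eval_eq hk hU (hB _ _) hp,
      pd_eval_eq hk hU (hP _ _) hp, pd_eval_eq hk hU (hC _ _) hp, pd_eval_eq hk hU (hC' _ _) hp,
      pd_eval_eq hk hU (hD _ _ _) hp, pd_eval_eq hk hU (hD' _ _ _) hp] at e
    simp only [fluxA, radA, nfB, radB, sysC, radC, sysD, radD, Matrix.cons_val_zero,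
      Matrix.cons_val_one, d_add, d_mul, d_c, d_zero_u, d_one_u, d_zero_v, d_one_v, d_zero_uinv,
      d_one_uinv, d_zero_rad, d_one_rad, d_fn, eval_add, eval_mul, eval_c, eval_u, eval_v,
      eval_uinv, eval_fn, zero_add, mul_zero, zero_mul, add_zero, one_mul, mul_one,
      Nat.reduceAdd] at e
    linear_combination (norm := (field_simp; ring)) e
  · have e := h.d p hp 0 0 0
    simp only [ord₂C, ord₂D, ord₂E, quad₃, quad₂, quad₁, lin₃, lin₂, lin₁, evals, evals₂, evals₃,
      Fin.sum_univ_two, pd_pd_pd_eval_eq hk hU (hA _) hp, pd_pd_pd_eval_eq hk hU (hS _) hp,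
      pd_pd_eval_eq hk hU (hA _) hp, pd_pd_eval_eq hk hU (hS _) hp,
      pd_pd_eval_eq hk hU (hB _ _) hp, pd_pd_eval_eq hk hU (hP _ _) hp,
      pd_eval_eq hk hU (hA _) hp, pd_eval_eq hk hU (hS _) hp, pd_eval_eq hk hU (hB _ _) hp,
      pd_eval_eq hk hU (hP _ _) hp, pd_eval_eq hk hU (hC _ _) hp, pd_eval_eq hk hU (hC' _ _) hp,
      pd_eval_eq hk hU (hD _ _ _) hp, pd_eval_eq hk hU (hD' _ _ _) hp] at e
    simp only [fluxA, radA, nfB, radB, sysC, radC, sysD, radD, Matrix.cons_val_zero,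
      Matrix.cons_val_one, d_add, d_mul, d_c, d_zero_u, d_one_u, d_zero_v, d_one_v, d_zero_uinv,
      d_one_uinv, d_zero_rad, d_one_rad, d_fn, eval_add, eval_mul, eval_c, eval_u, eval_v,
      eval_uinv, eval_fn, zero_add, mul_zero, zero_mul, add_zero, one_mul, mul_one,
      Nat.reduceAdd] at e
    linear_combination (norm := (field_simp; ring)) e
  · have e := h.d p hp 0 1 0
    simp only [ord₂C, ord₂D, ord₂E, quad₃, quad₂, quad₁, lin₃, lin₂, lin₁, evals, evals₂, evals₃,
      Fin.sum_univ_two, pd_pd_pd_eval_eq hk hU (hA _) hp, pd_pd_pd_eval_eq hk hU (hS _) hp,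
      pd_pd_eval_eq hk hU (hA _) hp, pd_pd_eval_eq hk hU (hS _) hp,
      pd_pd_eval_eq hk hU (hB _ _) hp, pd_pd_eval_eq hk hU (hP _ _) hp,
      pd_eval_eq hk hU (hA _) hp, pd_eval_eq hk hU (hS _) hp, pd_eval_eq hk hU (hB _ _) hp,
      pd_eval_eq hk hU (hP _ _) hp, pd_eval_eq hk hU (hC _ _) hp, pd_eval_eq hk hU (hC' _ _) hp,
      pd_eval_eq hk hU (hD _ _ _) hp, pd_eval_eq hk hU (hD' _ _ _) hp] at e
    simp only [fluxA, radA, nfB, radB, sysC, radC, sysD, radD, Matrix.cons_val_zero,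
      Matrix.cons_val_one, d_add, d_mul, d_c, d_zero_u, d_one_u, d_zero_v, d_one_v, d_zero_uinv,
      d_one_uinv, d_zero_rad, d_one_rad, d_fn, eval_add, eval_mul, eval_c, eval_u, eval_v,
      eval_uinv, eval_fn, zero_add, mul_zero, zero_mul, add_zero, one_mul, mul_one,
      Nat.reduceAdd] at e
    linear_combination (norm := (field_simp; ring)) e
  · have e := h.d p hp 0 0 1
    simp only [ord₂C, ord₂D, ord₂E, quad₃, quad₂, quad₁, lin₃, lin₂, lin₁, evals, evals₂, evals₃,
      Fin.sum_univ_two, pd_pd_pd_eval_eq hk hU (hA _) hp, pd_pd_pd_eval_eq hk hU (hS _) hp,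
      pd_pd_eval_eq hk hU (hA _) hp, pd_pd_eval_eq hk hU (hS _) hp,
      pd_pd_eval_eq hk hU (hB _ _) hp, pd_pd_eval_eq hk hU (hP _ _) hp,
      pd_eval_eq hk hU (hA _) hp, pd_eval_eq hk hU (hS _) hp, pd_eval_eq hk hU (hB _ _) hp,
      pd_eval_eq hk hU (hP _ _) hp, pd_eval_eq hk hU (hC _ _) hp, pd_eval_eq hk hU (hC' _ _) hp,
      pd_eval_eq hk hU (hD _ _ _) hp, pd_eval_eq hk hU (hD' _ _ _) hp] at e
    simp only [fluxA, radA, nfB, radB, sysC, radC, sysD, radD, Matrix.cons_val_zero,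
      Matrix.cons_val_one, d_add, d_mul, d_c, d_zero_u, d_one_u, d_zero_v, d_one_v, d_zero_uinv,
      d_one_uinv, d_zero_rad, d_one_rad, d_fn, eval_add, eval_mul, eval_c, eval_u, eval_v,
      eval_uinv, eval_fn, zero_add, mul_zero, zero_mul, add_zero, one_mul, mul_one,
      Nat.reduceAdd] at e
    linear_combination (norm := (field_simp; ring)) e
  · have e := h.d p hp 0 1 1
    simp only [ord₂C, ord₂D, ord₂E, quad₃, quad₂, quad₁, lin₃, lin₂, lin₁, evals, evals₂, evals₃,
      Fin.sum_univ_two, pd_pd_pd_eval_eq hk hU (hA _) hp, pd_pd_pd_eval_eq hk hU (hS _) hp,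
      pd_pd_eval_eq hk hU (hA _) hp, pd_pd_eval_eq hk hU (hS _) hp,
      pd_pd_eval_eq hk hU (hB _ _) hp, pd_pd_eval_eq hk hU (hP _ _) hp,
      pd_eval_eq hk hU (hA _) hp, pd_eval_eq hk hU (hS _) hp, pd_eval_eq hk hU (hB _ _) hp,
      pd_eval_eq hk hU (hP _ _) hp, pd_eval_eq hk hU (hC _ _) hp, pd_eval_eq hk hU (hC' _ _) hp,
      pd_eval_eq hk hU (hD _ _ _) hp, pd_eval_eq hk hU (hD' _ _ _) hp] at e
    simp only [fluxA, radA, nfB, radB, sysC, radC, sysD, radD, Matrix.cons_val_zero,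
      Matrix.cons_val_one, d_add, d_mul, d_c, d_zero_u, d_one_u, d_zero_v, d_one_v, d_zero_uinv,
      d_one_uinv, d_zero_rad, d_one_rad, d_fn, eval_add, eval_mul, eval_c, eval_u, eval_v,
      eval_uinv, eval_fn, zero_add, mul_zero, zero_mul, add_zero, one_mul, mul_one,
      Nat.reduceAdd] at e
    linear_combination (norm := (field_simp; ring)) e
  · have e := h.d p hp 1 0 0
    simp only [ord₂C, ord₂D, ord₂E, quad₃, quad₂, quad₁, lin₃, lin₂, lin₁, evals, evals₂, evals₃,
      Fin.sum_univ_two, pd_pd_pd_eval_eq hk hU (hA _) hp, pd_pd_pd_eval_eq hk hU (hS _) hp,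
      pd_pd_eval_eq hk hU (hA _) hp, pd_pd_eval_eq hk hU (hS _) hp,
      pd_pd_eval_eq hk hU (hB _ _) hp, pd_pd_eval_eq hk hU (hP _ _) hp,
      pd_eval_eq hk hU (hA _) hp, pd_eval_eq hk hU (hS _) hp, pd_eval_eq hk hU (hB _ _) hp,
      pd_eval_eq hk hU (hP _ _) hp, pd_eval_eq hk hU (hC _ _) hp, pd_eval_eq hk hU (hC' _ _) hp,
      pd_eval_eq hk hU (hD _ _ _) hp, pd_eval_eq hk hU (hD' _ _ _) hp] at e
    simp only [fluxA, radA, nfB, radB, sysC, radC, sysD, radD, Matrix.cons_val_zero,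
      Matrix.cons_val_one, d_add, d_mul, d_c, d_zero_u, d_one_u, d_zero_v, d_one_v, d_zero_uinv,
      d_one_uinv, d_zero_rad, d_one_rad, d_fn, eval_add, eval_mul, eval_c, eval_u, eval_v,
      eval_uinv, eval_fn, zero_add, mul_zero, zero_mul, add_zero, one_mul, mul_one,
      Nat.reduceAdd] at e
    linear_combination (norm := (field_simp; ring)) e
  · have e := h.d p hp 1 1 0
    simp only [ord₂C, ord₂D, ord₂E, quad₃, quad₂, quad₁, lin₃, lin₂, lin₁, evals, evals₂, evals₃,
      Fin.sum_univ_two, pd_pd_pd_eval_eq hk hU (hA _) hp, pd_pd_pd_eval_eq hk hU (hS _) hp,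
      pd_pd_eval_eq hk hU (hA _) hp, pd_pd_eval_eq hk hU (hS _) hp,
      pd_pd_eval_eq hk hU (hB _ _) hp, pd_pd_eval_eq hk hU (hP _ _) hp,
      pd_eval_eq hk hU (hA _) hp, pd_eval_eq hk hU (hS _) hp, pd_eval_eq hk hU (hB _ _) hp,
      pd_eval_eq hk hU (hP _ _) hp, pd_eval_eq hk hU (hC _ _) hp, pd_eval_eq hk hU (hC' _ _) hp,
      pd_eval_eq hk hU (hD _ _ _) hp, pd_eval_eq hk hU (hD' _ _ _) hp] at e
    simp only [fluxA, radA, nfB, radB, sysC, radC, sysD, radD, Matrix.cons_val_zero,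
      Matrix.cons_val_one, d_add, d_mul, d_c, d_zero_u, d_one_u, d_zero_v, d_one_v, d_zero_uinv,
      d_one_uinv, d_zero_rad, d_one_rad, d_fn, eval_add, eval_mul, eval_c, eval_u, eval_v,
      eval_uinv, eval_fn, zero_add, mul_zero, zero_mul, add_zero, one_mul, mul_one,
      Nat.reduceAdd] at e
    linear_combination (norm := (field_simp; ring)) e
  · have e := h.d p hp 1 0 1
    simp only [ord₂C, ord₂D, ord₂E, quad₃, quad₂, quad₁, lin₃, lin₂, lin₁, evals, evals₂, evals₃,
      Fin.sum_univ_two, pd_pd_pd_eval_eq hk hU (hA _) hp, pd_pd_pd_eval_eq hk hU (hS _) hp,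
      pd_pd_eval_eq hk hU (hA _) hp, pd_pd_eval_eq hk hU (hS _) hp,
      pd_pd_eval_eq hk hU (hB _ _) hp, pd_pd_eval_eq hk hU (hP _ _) hp,
      pd_eval_eq hk hU (hA _) hp, pd_eval_eq hk hU (hS _) hp, pd_eval_eq hk hU (hB _ _) hp,
      pd_eval_eq hk hU (hP _ _) hp, pd_eval_eq hk hU (hC _ _) hp, pd_eval_eq hk hU (hC' _ _) hp,
      pd_eval_eq hk hU (hD _ _ _) hp, pd_eval_eq hk hU (hD' _ _ _) hp] at e
    simp only [fluxA, radA, nfB, radB, sysC, radC, sysD, radD, Matrix.cons_val_zero,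
      Matrix.cons_val_one, d_add, d_mul, d_c, d_zero_u, d_one_u, d_zero_v, d_one_v, d_zero_uinv,
      d_one_uinv, d_zero_rad, d_one_rad, d_fn, eval_add, eval_mul, eval_c, eval_u, eval_v,
      eval_uinv, eval_fn, zero_add, mul_zero, zero_mul, add_zero, one_mul, mul_one,
      Nat.reduceAdd] at e
    linear_combination (norm := (field_simp; ring)) e
  · have e := h.d p hp 1 1 1
    simp only [ord₂C, ord₂D, ord₂E, quad₃, quad₂, quad₁, lin₃, lin₂, lin₁, evals, evals₂, evals₃,
      Fin.sum_univ_two, pd_pd_pd_eval_eq hk hU (hA _) hp, pd_pd_pd_eval_eq hk hU (hS _) hp,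
      pd_pd_eval_eq hk hU (hA _) hp, pd_pd_eval_eq hk hU (hS _) hp,
      pd_pd_eval_eq hk hU (hB _ _) hp, pd_pd_eval_eq hk hU (hP _ _) hp,
      pd_eval_eq hk hU (hA _) hp, pd_eval_eq hk hU (hS _) hp, pd_eval_eq hk hU (hB _ _) hp,
      pd_eval_eq hk hU (hP _ _) hp, pd_eval_eq hk hU (hC _ _) hp, pd_eval_eq hk hU (hC' _ _) hp,
      pd_eval_eq hk hU (hD _ _ _) hp, pd_eval_eq hk hU (hD' _ _ _) hp] at e
    simp only [fluxA, radA, nfB, radB, sysC, radC, sysD, radD, Matrix.cons_val_zero,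
      Matrix.cons_val_one, d_add, d_mul, d_c, d_zero_u, d_one_u, d_zero_v, d_one_v, d_zero_uinv,
      d_one_uinv, d_zero_rad, d_one_rad, d_fn, eval_add, eval_mul, eval_c, eval_u, eval_v,
      eval_uinv, eval_fn, zero_add, mul_zero, zero_mul, add_zero, one_mul, mul_one,
      Nat.reduceAdd] at e
    linear_combination (norm := (field_simp; ring)) e
  · have e := h.zero p hp 0
    simp only [ord₂C, ord₂D, ord₂E, quad₃, quad₂, quad₁, lin₃, lin₂, lin₁, evals, evals₂, evals₃,
      Fin.sum_univ_two, pd_pd_pd_eval_eq hk hU (hA _) hp, pd_pd_pd_eval_eq hk hU (hS _) hp,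
      pd_pd_eval_eq hk hU (hA _) hp, pd_pd_eval_eq hk hU (hS _) hp,
      pd_pd_eval_eq hk hU (hB _ _) hp, pd_pd_eval_eq hk hU (hP _ _) hp,
      pd_eval_eq hk hU (hA _) hp, pd_eval_eq hk hU (hS _) hp, pd_eval_eq hk hU (hB _ _) hp,
      pd_eval_eq hk hU (hP _ _) hp, pd_eval_eq hk hU (hC _ _) hp, pd_eval_eq hk hU (hC' _ _) hp,
      pd_eval_eq hk hU (hD _ _ _) hp, pd_eval_eq hk hU (hD' _ _ _) hp] at e
    simp only [fluxA, radA, nfB, radB, sysC, radC, sysD, radD, Matrix.cons_val_zero,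
      Matrix.cons_val_one, d_add, d_mul, d_c, d_zero_u, d_one_u, d_zero_v, d_one_v, d_zero_uinv,
      d_one_uinv, d_zero_rad, d_one_rad, d_fn, eval_add, eval_mul, eval_c, eval_u, eval_v,
      eval_uinv, eval_fn, zero_add, mul_zero, zero_mul, add_zero, one_mul, mul_one,
      Nat.reduceAdd] at e
    linear_combination (norm := (field_simp; ring)) e
  · have e := h.one p hp 0
    simp only [ord₂C, ord₂D, ord₂E, quad₃, quad₂, quad₁, lin₃, lin₂, lin₁, evals, evals₂, evals₃,
      Fin.sum_univ_two, pd_pd_pd_eval_eq hk hU (hA _) hp, pd_pd_pd_eval_eq hk hU (hS _) hp,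
      pd_pd_eval_eq hk hU (hA _) hp, pd_pd_eval_eq hk hU (hS _) hp,
      pd_pd_eval_eq hk hU (hB _ _) hp, pd_pd_eval_eq hk hU (hP _ _) hp,
      pd_eval_eq hk hU (hA _) hp, pd_eval_eq hk hU (hS _) hp, pd_eval_eq hk hU (hB _ _) hp,
      pd_eval_eq hk hU (hP _ _) hp, pd_eval_eq hk hU (hC _ _) hp, pd_eval_eq hk hU (hC' _ _) hp,
      pd_eval_eq hk hU (hD _ _ _) hp, pd_eval_eq hk hU (hD' _ _ _) hp] at e
    simp only [fluxA, radA, nfB, radB, sysC, radC, sysD, radD, Matrix.cons_val_zero,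
      Matrix.cons_val_one, d_add, d_mul, d_c, d_zero_u, d_one_u, d_zero_v, d_one_v, d_zero_uinv,
      d_one_uinv, d_zero_rad, d_one_rad, d_fn, eval_add, eval_mul, eval_c, eval_u, eval_v,
      eval_uinv, eval_fn, zero_add, mul_zero, zero_mul, add_zero, one_mul, mul_one,
      Nat.reduceAdd] at e
    linear_combination (norm := (field_simp; ring)) e
  · have e := h.three p hp 0
    simp only [ord₂C, ord₂D, ord₂E, quad₃, quad₂, quad₁, lin₃, lin₂, lin₁, evals, evals₂, evals₃,
      Fin.sum_univ_two, pd_pd_pd_eval_eq hk hU (hA _) hp, pd_pd_pd_eval_eq hk hU (hS _) hp,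
      pd_pd_eval_eq hk hU (hA _) hp, pd_pd_eval_eq hk hU (hS _) hp,
      pd_pd_eval_eq hk hU (hB _ _) hp, pd_pd_eval_eq hk hU (hP _ _) hp,
      pd_eval_eq hk hU (hA _) hp, pd_eval_eq hk hU (hS _) hp, pd_eval_eq hk hU (hB _ _) hp,
      pd_eval_eq hk hU (hP _ _) hp, pd_eval_eq hk hU (hC _ _) hp, pd_eval_eq hk hU (hC' _ _) hp,
      pd_eval_eq hk hU (hD _ _ _) hp, pd_eval_eq hk hU (hD' _ _ _) hp] at e
    simp only [fluxA, radA, nfB, radB, sysC, radC, sysD, radD, Matrix.cons_val_zero,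
      Matrix.cons_val_one, d_add, d_mul, d_c, d_zero_u, d_one_u, d_zero_v, d_one_v, d_zero_uinv,
      d_one_uinv, d_zero_rad, d_one_rad, d_fn, eval_add, eval_mul, eval_c, eval_u, eval_v,
      eval_uinv, eval_fn, zero_add, mul_zero, zero_mul, add_zero, one_mul, mul_one,
      Nat.reduceAdd] at e
    linear_combination (norm := (field_simp; ring)) e
  · have e := h.zero p hp 1
    simp only [ord₂C, ord₂D, ord₂E, quad₃, quad₂, quad₁, lin₃, lin₂, lin₁, evals, evals₂, evals₃,
      Fin.sum_univ_two, pd_pd_pd_eval_eq hk hU (hA _) hp, pd_pd_pd_eval_eq hk hU (hS _) hp,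
      pd_pd_eval_eq hk hU (hA _) hp, pd_pd_eval_eq hk hU (hS _) hp,
      pd_pd_eval_eq hk hU (hB _ _) hp, pd_pd_eval_eq hk hU (hP _ _) hp,
      pd_eval_eq hk hU (hA _) hp, pd_eval_eq hk hU (hS _) hp, pd_eval_eq hk hU (hB _ _) hp,
      pd_eval_eq hk hU (hP _ _) hp, pd_eval_eq hk hU (hC _ _) hp, pd_eval_eq hk hU (hC' _ _) hp,
      pd_eval_eq hk hU (hD _ _ _) hp, pd_eval_eq hk hU (hD' _ _ _) hp] at e
    simp only [fluxA, radA, nfB, radB, sysC, radC, sysD, radD, Matrix.cons_val_zero,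
      Matrix.cons_val_one, d_add, d_mul, d_c, d_zero_u, d_one_u, d_zero_v, d_one_v, d_zero_uinv,
      d_one_uinv, d_zero_rad, d_one_rad, d_fn, eval_add, eval_mul, eval_c, eval_u, eval_v,
      eval_uinv, eval_fn, zero_add, mul_zero, zero_mul, add_zero, one_mul, mul_one,
      Nat.reduceAdd] at e
    linear_combination (norm := (field_simp; ring)) e
  · have e := h.two p hp 1
    simp only [ord₂C, ord₂D, ord₂E, quad₃, quad₂, quad₁, lin₃, lin₂, lin₁, evals, evals₂, evals₃,
      Fin.sum_univ_two, pd_pd_pd_eval_eq hk hU (hA _) hp, pd_pd_pd_eval_eq hk hU (hS _) hp,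
      pd_pd_eval_eq hk hU (hA _) hp, pd_pd_eval_eq hk hU (hS _) hp,
      pd_pd_eval_eq hk hU (hB _ _) hp, pd_pd_eval_eq hk hU (hP _ _) hp,
      pd_eval_eq hk hU (hA _) hp, pd_eval_eq hk hU (hS _) hp, pd_eval_eq hk hU (hB _ _) hp,
      pd_eval_eq hk hU (hP _ _) hp, pd_eval_eq hk hU (hC _ _) hp, pd_eval_eq hk hU (hC' _ _) hp,
      pd_eval_eq hk hU (hD _ _ _) hp, pd_eval_eq hk hU (hD' _ _ _) hp] at e
    simp only [fluxA, radA, nfB, radB, sysC, radC, sysD, radD, Matrix.cons_val_zero,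
      Matrix.cons_val_one, d_add, d_mul, d_c, d_zero_u, d_one_u, d_zero_v, d_one_v, d_zero_uinv,
      d_one_uinv, d_zero_rad, d_one_rad, d_fn, eval_add, eval_mul, eval_c, eval_u, eval_v,
      eval_uinv, eval_fn, zero_add, mul_zero, zero_mul, add_zero, one_mul, mul_one,
      Nat.reduceAdd] at e
    linear_combination (norm := (field_simp; ring)) e
  · have e := h.three p hp 1
    simp only [ord₂C, ord₂D, ord₂E, quad₃, quad₂, quad₁, lin₃, lin₂, lin₁, evals, evals₂, evals₃,
      Fin.sum_univ_two, pd_pd_pd_eval_eq hk hU (hA _) hp, pd_pd_pd_eval_eq hk hU (hS _) hp,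
      pd_pd_eval_eq hk hU (hA _) hp, pd_pd_eval_eq hk hU (hS _) hp,
      pd_pd_eval_eq hk hU (hB _ _) hp, pd_pd_eval_eq hk hU (hP _ _) hp,
      pd_eval_eq hk hU (hA _) hp, pd_eval_eq hk hU (hS _) hp, pd_eval_eq hk hU (hB _ _) hp,
      pd_eval_eq hk hU (hP _ _) hp, pd_eval_eq hk hU (hC _ _) hp, pd_eval_eq hk hU (hC' _ _) hp,
      pd_eval_eq hk hU (hD _ _ _) hp, pd_eval_eq hk hU (hD' _ _ _) hp] at e
    simp only [fluxA, radA, nfB, radB, sysC, radC, sysD, radD, Matrix.cons_val_zero,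
      Matrix.cons_val_one, d_add, d_mul, d_c, d_zero_u, d_one_u, d_zero_v, d_one_v, d_zero_uinv,
      d_one_uinv, d_zero_rad, d_one_rad, d_fn, eval_add, eval_mul, eval_c, eval_u, eval_v,
      eval_uinv, eval_fn, zero_add, mul_zero, zero_mul, add_zero, one_mul, mul_one,
      Nat.reduceAdd] at e
    linear_combination (norm := (field_simp; ring)) e

/-- The coefficients c₁₀ and c₀₀ of the symmetry are expressed through g and F. A combination of two
relations free of the unknown coefficients of products is then a transport equation for g, and
division by u³ with a correction in F² makes it homogeneous. -/
lemma SecondRelations.g_equation (hk : k = ∞ ∨ k = ω) (hU : IsOpen U) (hne : ∀ p ∈ U, p.1 ≠ 0)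
    (vF : ∀ n, (rad F n).Valid k U) {q : SecondCoeffs} (hq : q.Regular k U)
    (raw : ∀ p ∈ U, SecondRelations F q p) {p : ℝ × ℝ} (hp : p ∈ U) :
    pd 0 (fun p => q.g p * p.1⁻¹ ^ 3 - 1 / 3 * F (p.1 ^ 2 / 2 + p.2) ^ 2 * p.1⁻¹ ^ 2) p -
      p.1 * pd 1 (fun p => q.g p * p.1⁻¹ ^ 3 - 1 / 3 * F (p.1 ^ 2 / 2 + p.2) ^ 2 * p.1⁻¹ ^ 2) p =
        0 := by
  have vu : uinv.Valid k U := hne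
  have vg : (fn q.g).Valid k U := hq.sysC 1 0
  have c10 : ∀ p ∈ U, q.c10 p =
      (c (-1 / 2) * rad F 0 * rad F 0 + fn q.g * uinv).eval p := by
    intro p hp
    have hp0 := hne p hp
    have e := (raw p hp).xxx_zero_zero
    simp only [d_add, d_mul, d_c, d_zero_u, d_one_u,
      d_zero_uinv, d_one_uinv, d_zero_rad, d_one_rad, d_zero_ver, d_one_ver, d_fn, eval_add,
      eval_mul, eval_c, eval_u, eval_uinv, eval_fn, Nat.reduceAdd] at e ⊢
    linear_combination (norm := (field_simp; ring)) p.1⁻¹ * e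
  have c10' := fun j => pd_eq_eval hk hU c10 (by simp [valid_add, valid_mul, valid_c, valid_u, vu,
      vF, vg]) j
  have c00 : ∀ p ∈ U, q.c00 p =
      (c (1 / 3) * rad F 0 * rad F 0 * uinv + c (-1 / 2) * fn q.g * uinv * uinv).eval p := by
    intro p hp
    have hp0 := hne p hp
    have e₁ := (raw p hp).x_xx_one_zero_zero
    have e₂ := (raw p hp).x_xx_zero_zero_zero
    simp only [c10 p hp, c10' 0 hp, d_add, d_mul, d_c, d_zero_u, d_one_u,
      d_zero_uinv, d_one_uinv, d_zero_rad, d_one_rad, d_zero_ver, d_one_ver, d_fn, eval_add,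
      eval_mul, eval_c, eval_u, eval_uinv, eval_fn, Nat.reduceAdd] at e₁ e₂ ⊢
    -- In e₁ + u e₂ both a₂₅ and d₁₀ cancel, leaving c₀₀ algebraically.
    linear_combination (norm := (field_simp; ring)) -1 / 6 * p.1⁻¹ ^ 2 * (e₁ + p.1 * e₂)
  have c00' := fun j => pd_eq_eval hk hU c00 (by simp [valid_add, valid_mul, valid_c, valid_u, vu,
      vF, vg]) j

  have e : Set.EqOn
      (fun p => q.g p * p.1⁻¹ ^ 3 - 1 / 3 * F (p.1 ^ 2 / 2 + p.2) ^ 2 * p.1⁻¹ ^ 2)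
      (fn q.g * uinv * uinv * uinv + c (-1 / 3) * rad F 0 * rad F 0 * uinv * uinv).eval U := by
    intro p _
    simp only [eval_add, eval_mul, eval_c, eval_fn, eval_uinv]
    change _ = _ + -1 / 3 * F _ * F _ * _ * _
    ring
  have e' := fun j => pd_eq_eval hk hU e
    (by simp [valid_add, valid_mul, valid_c, vu, vF, vg]) j
  have hp0 := hne p hp
  have e₁ := (raw p hp).x_xx_one_one_zero
  have e₂ := (raw p hp).x_xx_zero_one_zero
  simp only [e' 0 hp, e' 1 hp, c10 p hp, c10' 0 hp, c10' 1 hp, c00 p hp, c00' 0 hp, c00' 1 hp,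
      d_add, d_mul, d_c, d_zero_u, d_one_u,
      d_zero_uinv, d_one_uinv, d_zero_rad, d_one_rad, d_zero_ver, d_one_ver, d_fn, eval_add,
      eval_mul, eval_c, eval_u, eval_uinv, eval_fn, Nat.reduceAdd] at e₁ e₂ ⊢
  -- In e₁ + u e₂ the unknowns a₂₆ and d₁₁ cancel.
  linear_combination (norm := (field_simp; ring)) 2 * p.1⁻¹ ^ 3 * (e₁ + p.1 * e₂)

/-- The coefficients which are determined by `F` and `G` in the first place. -/
structure ReducedCoeffs (F G : ℝ → ℝ) (q : SecondCoeffs) (U : Set (ℝ × ℝ)) : Prop where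
  c10 : ∀ p ∈ U, q.c10 p =
        (c (-1 / 6) * rad F 0 * rad F 0 + rad G 0 * u * u).eval p
  c00 : ∀ p ∈ U, q.c00 p =
        (c (1 / 6) * rad F 0 * rad F 0 * uinv + c (-1 / 2) * rad G 0 * u).eval p
  d10 : ∀ p ∈ U, q.d10 p =
        (c (-1 / 2) * rad F 0 * rad F 1 * u + c (-5 / 6) * rad F 0 * rad F 0 * uinv +
        c (-1) * rad G 0 * u + fn q.a25 * uinv).eval p
  d11 : ∀ p ∈ U, q.d11 p =
        (c (-1) * rad F 0 * rad F 1 + c (-1 / 6) * rad F 0 * rad F 0 * uinv * uinv +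
        c (-2) * rad G 0 + fn q.a26).eval p
  c11 : ∀ p ∈ U, q.c11 p =
        (c (-1 / 6) * rad F 0 * rad F 0 * uinv + rad G 0 * u).eval p

/-- With g known through F and G, the coefficients c₁₀, c₀₀, c₁₁ are determined outright, and d₁₀,
d₁₁ up to the still unknown a₂₅, a₂₆. -/
lemma SecondRelations.reduced (hk : k = ∞ ∨ k = ω) (hU : IsOpen U) (hne : ∀ p ∈ U, p.1 ≠ 0)
    (vF : ∀ n, (rad F n).Valid k U) (vG : ∀ n, (rad G n).Valid k U) {q : SecondCoeffs}
    (hq : q.Regular k U) (raw : ∀ p ∈ U, SecondRelations F q p)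
    (g : ∀ p ∈ U, q.g p = (nfC F G H 1 0).eval p) : ReducedCoeffs F G q U := by
  have vu : uinv.Valid k U := hne
  have va25 : (fn q.a25).Valid k U := hq.sysD 1 0 0
  have va26 : (fn q.a26).Valid k U := hq.sysD 1 1 1
  simp only [nfC, Matrix.cons_val_zero, Matrix.cons_val_one] at g
  have g' := fun j => pd_eq_eval hk hU g (by simp [valid_add, valid_mul, valid_c, valid_u, vF, vG]) j
  have c10 : ∀ p ∈ U, q.c10 p =
      (c (-1 / 6) * rad F 0 * rad F 0 + rad G 0 * u * u).eval p := by
    intro p hp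
    have hp0 := hne p hp
    have e := (raw p hp).xxx_zero_zero
    simp only [g p hp, d_add, d_mul, d_c, d_zero_u, d_one_u,
      d_zero_uinv, d_one_uinv, d_zero_rad, d_one_rad, d_zero_ver, d_one_ver, d_fn, eval_add,
      eval_mul, eval_c, eval_u, eval_uinv, eval_fn, Nat.reduceAdd] at e ⊢
    linear_combination (norm := (field_simp; ring)) p.1⁻¹ * e
  have c10' := fun j => pd_eq_eval hk hU c10 (by simp [valid_add, valid_mul, valid_c, valid_u, vu,
      vF, vG, va25, va26]) j
  have c00 : ∀ p ∈ U, q.c00 p =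
      (c (1 / 6) * rad F 0 * rad F 0 * uinv + c (-1 / 2) * rad G 0 * u).eval p := by
    intro p hp
    have hp0 := hne p hp
    have e₁ := (raw p hp).x_xx_one_zero_zero
    have e₂ := (raw p hp).x_xx_zero_zero_zero
    simp only [g p hp, g' 0 hp, c10 p hp, c10' 0 hp, d_add, d_mul, d_c, d_zero_u, d_one_u,
      d_zero_uinv, d_one_uinv, d_zero_rad, d_one_rad, d_zero_ver, d_one_ver, d_fn, eval_add,
      eval_mul, eval_c, eval_u, eval_uinv, eval_fn, Nat.reduceAdd] at e₁ e₂ ⊢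
    linear_combination (norm := (field_simp; ring)) -1 / 6 * p.1⁻¹ ^ 2 * (e₁ + p.1 * e₂)
  have c00' := fun j => pd_eq_eval hk hU c00 (by simp [valid_add, valid_mul, valid_c, valid_u, vu,
      vF, vG, va25, va26]) j
  have d10 : ∀ p ∈ U, q.d10 p =
      (c (-1 / 2) * rad F 0 * rad F 1 * u + c (-5 / 6) * rad F 0 * rad F 0 * uinv +
        c (-1) * rad G 0 * u + fn q.a25 * uinv).eval p := by
    intro p hp
    have hp0 := hne p hp
    have e := (raw p hp).x_xx_zero_zero_zero
    simp only [g' 0 hp, c00 p hp, c10' 0 hp, d_add, d_mul, d_c, d_zero_u, d_one_u,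
      d_zero_uinv, d_one_uinv, d_zero_rad, d_one_rad, d_zero_ver, d_one_ver, d_fn, eval_add,
      eval_mul, eval_c, eval_u, eval_uinv, eval_fn, Nat.reduceAdd] at e ⊢
    linear_combination (norm := (field_simp; ring)) 1 / 2 * p.1⁻¹ * e
  have d10' := fun j => pd_eq_eval hk hU d10 (by simp [valid_add, valid_mul, valid_c, valid_u, vu,
      vF, vG, va25, va26]) j
  have d11 : ∀ p ∈ U, q.d11 p =
      (c (-1) * rad F 0 * rad F 1 + c (-1 / 6) * rad F 0 * rad F 0 * uinv * uinv +
        c (-2) * rad G 0 + fn q.a26).eval p := by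
    intro p hp
    have hp0 := hne p hp
    have e := (raw p hp).x_xx_zero_one_zero
    simp only [g' 1 hp, c00 p hp, c00' 0 hp, c00' 1 hp, c10' 1 hp, d_add, d_mul, d_c, d_zero_u,
      d_one_u,
      d_zero_uinv, d_one_uinv, d_zero_rad, d_one_rad, d_zero_ver, d_one_ver, d_fn, eval_add,
      eval_mul, eval_c, eval_u, eval_uinv, eval_fn, Nat.reduceAdd] at e ⊢
    linear_combination (norm := (field_simp; ring)) p.1⁻¹ * e
  have d11' := fun j => pd_eq_eval hk hU d11 (by simp [valid_add, valid_mul, valid_c, valid_u, vu,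
      vF, vG, va25, va26]) j
  have c11 : ∀ p ∈ U, q.c11 p =
      (c (-1 / 6) * rad F 0 * rad F 0 * uinv + rad G 0 * u).eval p := by
    intro p hp
    have hp0 := hne p hp
    have e₁ := (raw p hp).x_xx_one_one_one
    have e₂ := (raw p hp).x_xx_one_zero_one
    simp only [c10 p hp, d10 p hp, c00 p hp, d11 p hp, d_add, d_mul, d_c, d_zero_u, d_one_u,
      d_zero_uinv, d_one_uinv, d_zero_rad, d_one_rad, d_zero_ver, d_one_ver, d_fn, eval_add,
      eval_mul, eval_c, eval_u, eval_uinv, eval_fn, Nat.reduceAdd] at e₁ e₂ ⊢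
    -- The combination e₁ - e₂/u removes the u-derivatives of c₁₁ and h, so c₁₁ is found before h is
    -- known.
    linear_combination (norm := (field_simp; ring)) -1 / 3 * (e₁ - p.1⁻¹ * e₂)
  have c11' := fun j => pd_eq_eval hk hU c11 (by simp [valid_add, valid_mul, valid_c, valid_u, vu,
      vF, vG, va25, va26]) j
  exact ⟨c10, c00, d10, d11, c11⟩

/-- In the coefficient of v_x v_xx in the second equation, a₂₆ cancels against d₁₁ once d₁₁ is
inserted. As c₁₁ is known, the relation gives h_u explicitly. -/
lemma SecondRelations.h_equation (hk : k = ∞ ∨ k = ω) (hU : IsOpen U) (hne : ∀ p ∈ U, p.1 ≠ 0)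
    (vF : ∀ n, (rad F n).Valid k U) (vG : ∀ n, (rad G n).Valid k U) {q : SecondCoeffs}
    (hq : q.Regular k U) (raw : ∀ p ∈ U, SecondRelations F q p) (red : ReducedCoeffs F G q U)
    {p : ℝ × ℝ} (hp : p ∈ U) :
    pd 0 (fun p => q.h p - (1 / 3 * F (p.1 ^ 2 / 2 + p.2) ^ 2 +
      G (p.1 ^ 2 / 2 + p.2) * p.1 ^ 2)) p = 0 := by
  have vu : uinv.Valid k U := hne
  have vh : (fn q.h).Valid k U := hq.sysC 1 1
  have c11' := fun j => pd_eq_eval hk hU red.c11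
    (by simp [valid_add, valid_mul, valid_c, valid_u, vu, vF, vG]) j
  have e : Set.EqOn (fun p => q.h p - (1 / 3 * F (p.1 ^ 2 / 2 + p.2) ^ 2 +
      G (p.1 ^ 2 / 2 + p.2) * p.1 ^ 2))
      (fn q.h + c (-1 / 3) * rad F 0 * rad F 0 + c (-1) * rad G 0 * u * u).eval U := by
    intro p _
    simp only [eval_add, eval_mul, eval_c, eval_fn, eval_u]
    change _ = _ + -1 / 3 * F _ * F _ + -1 * G _ * _ * _
    ring
  have e' := fun j => pd_eq_eval hk hU e
    (by simp [valid_add, valid_mul, valid_c, valid_u, vF, vG, vh]) j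
  have hp0 := hne p hp
  have e₁ := (raw p hp).x_xx_one_one_one
  simp only [e' 0 hp, red.c11 p hp, c11' 0 hp, red.d11 p hp, d_add, d_mul, d_c, d_zero_u, d_one_u,
      d_zero_uinv, d_one_uinv, d_zero_rad, d_one_rad, d_zero_ver, d_one_ver, d_fn, eval_add,
      eval_mul, eval_c, eval_u, eval_uinv, eval_fn, Nat.reduceAdd] at e₁ ⊢
  linear_combination (norm := (field_simp; ring)) e₁

/-- A triangular elimination: c₀₁, a₂₅, d₀₀, d₀₁, d₁₂, a₂₆, a₁₇, d₀₂, a₁₆. Of these d₀₁, d₁₂ and d₀₂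
are first found only modulo a₁₇, a₂₆ and a₁₆. No differential equation is left to solve, so no
further functional parameter appears. -/
lemma SecondRelations.sysD_eq (hk : k = ∞ ∨ k = ω) (hU : IsOpen U) (hne : ∀ p ∈ U, p.1 ≠ 0)
    (vF : ∀ n, (rad F n).Valid k U) (vG : ∀ n, (rad G n).Valid k U)
    (vH : ∀ n, (ver H n).Valid k U) {q : SecondCoeffs} (hq : q.Regular k U)
    (raw : ∀ p ∈ U, SecondRelations F q p) (red : ReducedCoeffs F G q U)
    (hh : ∀ p ∈ U, q.h p = (nfC F G H 1 1).eval p) :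
    ∀ p ∈ U, ∀ i j l, (q.sysD i j l).eval p = (nfD F G H i j l).eval p := by
  have vu : uinv.Valid k U := hne
  have va16 : (fn q.a16).Valid k U := hq.sysD 0 1 1
  have va17 : (fn q.a17).Valid k U := hq.sysD 0 0 1
  have va25 : (fn q.a25).Valid k U := hq.sysD 1 0 0
  have va26 : (fn q.a26).Valid k U := hq.sysD 1 1 1
  obtain ⟨c10, c00, d10, d11, c11⟩ := red
  simp only [nfC, Matrix.cons_val_zero, Matrix.cons_val_one] at hh
  have hh' := fun j => pd_eq_eval hk hU hh
    (by simp [valid_add, valid_mul, valid_c, valid_u, vF, vG, vH]) j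
  have c00' := fun j => pd_eq_eval hk hU c00
    (by simp [valid_add, valid_mul, valid_c, valid_u, vu, vF, vG, va25, va26]) j
  have d10' := fun j => pd_eq_eval hk hU d10
    (by simp [valid_add, valid_mul, valid_c, valid_u, vu, vF, vG, va25, va26]) j
  have d11' := fun j => pd_eq_eval hk hU d11
    (by simp [valid_add, valid_mul, valid_c, valid_u, vu, vF, vG, va25, va26]) j
  have c11' := fun j => pd_eq_eval hk hU c11
    (by simp [valid_add, valid_mul, valid_c, valid_u, vu, vF, vG, va25, va26]) j
  have c01 : ∀ p ∈ U, q.c01 p =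
      (c (1 / 6) * rad F 0 * rad F 0 * uinv * uinv + c (-1 / 2) * rad G 0 +
        ver H 0 * uinv * uinv).eval p := by
    intro p hp
    have hp0 := hne p hp
    have e := (raw p hp).xxx_zero_one
    simp only [hh p hp, c00 p hp, c11 p hp, d_add, d_mul, d_c, d_zero_u, d_one_u,
      d_zero_uinv, d_one_uinv, d_zero_rad, d_one_rad, d_zero_ver, d_one_ver, d_fn, eval_add,
      eval_mul, eval_c, eval_u, eval_uinv, eval_fn, Nat.reduceAdd] at e ⊢
    linear_combination (norm := (field_simp; ring)) p.1⁻¹ ^ 2 * e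
  have c01' := fun j => pd_eq_eval hk hU c01 (by simp [valid_add, valid_mul, valid_c, valid_u, vu,
      vF, vG, vH, va16, va17, va26]) j
  have a25 : ∀ p ∈ U, q.a25 p =
      (c (-1 / 3) * rad F 0 * rad F 1 * u * u + c (5 / 6) * rad F 0 * rad F 0 +
        c 3 * rad G 0 * u * u + rad G 1 * u * u * u * u).eval p := by
    intro p hp
    have hp0 := hne p hp
    have e := (raw p hp).x_x_x_one_zero
    simp only [c10 p hp, d10 p hp, d10' 0 hp, c00 p hp, c00' 0 hp, d_add, d_mul, d_c, d_zero_u,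
      d_one_u,
      d_zero_uinv, d_one_uinv, d_zero_rad, d_one_rad, d_zero_ver, d_one_ver, d_fn, eval_add,
      eval_mul, eval_c, eval_u, eval_uinv, eval_fn, Nat.reduceAdd] at e ⊢
    -- Since d₁₀ contains a₂₅/u, the u-derivatives of a₂₅ cancel and the relation contains just
    -- -a₂₅.
    linear_combination (norm := (field_simp; ring)) -e
  have a25' := fun j => pd_eq_eval hk hU a25 (by simp [valid_add, valid_mul, valid_c, valid_u, vu,
      vF, vG, vH, va16, va17, va26]) j
  have d00 : ∀ p ∈ U, q.d00 p =
      (c (5 / 12) * rad F 0 * rad F 1 + c (1 / 6) * rad F 0 * rad F 0 * uinv * uinv +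
        c (-3 / 4) * rad G 0 + c (-1 / 2) * rad G 1 * u * u).eval p := by
    intro p hp
    have hp0 := hne p hp
    have e := (raw p hp).x_x_x_zero_zero
    simp only [a25' 0 hp, a25 p hp, c00 p hp, c00' 0 hp, d10' 0 hp, d_add, d_mul, d_c, d_zero_u,
      d_one_u,
      d_zero_uinv, d_one_uinv, d_zero_rad, d_one_rad, d_zero_ver, d_one_ver, d_fn, eval_add,
      eval_mul, eval_c, eval_u, eval_uinv, eval_fn, Nat.reduceAdd] at e ⊢
    linear_combination (norm := (field_simp; ring)) -1 / 4 * p.1⁻¹ * e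
  have d00' := fun j => pd_eq_eval hk hU d00 (by simp [valid_add, valid_mul, valid_c, valid_u, vu,
      vF, vG, vH, va16, va17, va26]) j
  have d01 : ∀ p ∈ U, q.d01 p =
      (c (5 / 6) * rad F 0 * rad F 1 * uinv +
        c (-1 / 6) * rad F 0 * rad F 0 * uinv * uinv * uinv + c (-1) * rad G 1 * u +
        fn q.a17 * uinv).eval p := by
    intro p hp
    have hp0 := hne p hp
    have e := (raw p hp).x_xx_zero_zero_one
    simp only [c00 p hp, c11' 0 hp, d00 p hp, d11 p hp, hh' 0 hp, d_add, d_mul, d_c, d_zero_u,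
      d_one_u,
      d_zero_uinv, d_one_uinv, d_zero_rad, d_one_rad, d_zero_ver, d_one_ver, d_fn, eval_add,
      eval_mul, eval_c, eval_u, eval_uinv, eval_fn, Nat.reduceAdd] at e ⊢
    linear_combination (norm := (field_simp; ring)) p.1⁻¹ ^ 2 * e
  have d12 : ∀ p ∈ U, q.d12 p =
      (c (-1 / 6) * rad F 0 * rad F 1 * uinv +
        c (-1 / 3) * rad F 0 * rad F 0 * uinv * uinv * uinv + c (-3) * rad G 0 * uinv +
        c (-1) * rad G 1 * u + fn q.a26 * uinv).eval p := by
    intro p hp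
    have hp0 := hne p hp
    have e₁ := (raw p hp).x_x_x_one_three
    have e₂ := (raw p hp).x_x_x_one_two
    simp only [d11 p hp, d11' 0 hp, d_add, d_mul, d_c, d_zero_u, d_one_u,
      d_zero_uinv, d_one_uinv, d_zero_rad, d_one_rad, d_zero_ver, d_one_ver, d_fn, eval_add,
      eval_mul, eval_c, eval_u, eval_uinv, eval_fn, Nat.reduceAdd] at e₁ e₂ ⊢
    -- The u-derivatives of d₁₂ and of a₂₆ cancel in e₁ - e₂/u.
    linear_combination (norm := (field_simp; ring)) -1 / 2 * (e₁ - p.1⁻¹ * e₂)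
  have d12' := fun j => pd_eq_eval hk hU d12 (by simp [valid_add, valid_mul, valid_c, valid_u, vu,
      vF, vG, vH, va16, va17, va26]) j
  have a26 : ∀ p ∈ U, q.a26 p =
      (c (1 / 3) * rad F 0 * rad F 1 + c (-1 / 3) * rad F 0 * rad F 2 * u * u +
        c (-1 / 3) * rad F 0 * rad F 0 * uinv * uinv + c (-1 / 3) * rad F 1 * rad F 1 * u * u +
        c 3 * rad G 0 + c 6 * rad G 1 * u * u + rad G 2 * u * u * u * u).eval p := by
    intro p hp
    have hp0 := hne p hp
    have e := (raw p hp).x_x_x_one_three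
    simp only [d12 p hp, d12' 0 hp, d_add, d_mul, d_c, d_zero_u, d_one_u,
      d_zero_uinv, d_one_uinv, d_zero_rad, d_one_rad, d_zero_ver, d_one_ver, d_fn, eval_add,
      eval_mul, eval_c, eval_u, eval_uinv, eval_fn, Nat.reduceAdd] at e ⊢
    -- The derivatives of a₂₆ cancel because d₁₂ contains a₂₆/u; the same happens below for a₁₆ and
    -- d₀₂.
    linear_combination (norm := (field_simp; ring)) -p.1 * e
  have a26' := fun j => pd_eq_eval hk hU a26 (by simp [valid_add, valid_mul, valid_c, valid_u, vu,
      vF, vG, vH, va16, va17, va26]) j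
  have a17 : ∀ p ∈ U, q.a17 p =
      (c (-2 / 3) * rad F 0 * rad F 1 + c (1 / 3) * rad F 0 * rad F 2 * u * u +
        c (2 / 3) * rad F 0 * rad F 0 * uinv * uinv + c (1 / 3) * rad F 1 * rad F 1 * u * u +
        c (-4) * rad G 1 * u * u + c (-1) * rad G 2 * u * u * u * u).eval p := by
    intro p hp
    have hp0 := hne p hp
    have e := (raw p hp).x_x_x_zero_one
    simp only [a25' 1 hp, a26 p hp, a26' 0 hp, d00 p hp, d00' 0 hp, d00' 1 hp, d01 p hp,
      d10' 1 hp, d11 p hp, d11' 0 hp, d_add, d_mul, d_c, d_zero_u, d_one_u,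
      d_zero_uinv, d_one_uinv, d_zero_rad, d_one_rad, d_zero_ver, d_one_ver, d_fn, eval_add,
      eval_mul, eval_c, eval_u, eval_uinv, eval_fn, Nat.reduceAdd] at e ⊢
    linear_combination (norm := (field_simp; ring)) -e
  have d02 : ∀ p ∈ U, q.d02 p =
      (c (1 / 12) * rad F 0 * rad F 1 * uinv * uinv +
        c (1 / 3) * rad F 0 * rad F 0 * uinv * uinv * uinv * uinv +
        c (9 / 4) * rad G 0 * uinv * uinv + c (1 / 2) * rad G 1 +
        c (1 / 2) * ver H 0 * uinv * uinv * uinv * uinv + fn q.a16 * uinv).eval p := by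
    intro p hp
    have hp0 := hne p hp
    have e := (raw p hp).x_xx_zero_one_one
    simp only [a17 p hp, a26 p hp, c01 p hp, c01' 0 hp, c01' 1 hp, c11' 1 hp, d01 p hp, d12 p hp,
      hh' 1 hp, d_add, d_mul, d_c, d_zero_u, d_one_u,
      d_zero_uinv, d_one_uinv, d_zero_rad, d_one_rad, d_zero_ver, d_one_ver, d_fn, eval_add,
      eval_mul, eval_c, eval_u, eval_uinv, eval_fn, Nat.reduceAdd] at e ⊢
    linear_combination (norm := (field_simp; ring)) 1 / 2 * p.1⁻¹ ^ 2 * e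
  have d02' := fun j => pd_eq_eval hk hU d02 (by simp [valid_add, valid_mul, valid_c, valid_u, vu,
      vF, vG, vH, va16, va17, va26]) j
  have a16 : ∀ p ∈ U, q.a16 p =
      (c (-2 / 3) * rad F 0 * rad F 1 * uinv + c (1 / 3) * rad F 0 * rad F 2 * u +
        c (2 / 3) * rad F 0 * rad F 0 * uinv * uinv * uinv + c (1 / 3) * rad F 1 * rad F 1 * u +
        c (-4) * rad G 1 * u + c (-1) * rad G 2 * u * u * u + ver H 0 * uinv * uinv * uinv +
        c (1 / 2) * ver H 1 * uinv).eval p := by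
    intro p hp
    have hp0 := hne p hp
    have e := (raw p hp).x_x_x_zero_three
    simp only [a26' 1 hp, d02 p hp, d02' 0 hp, d02' 1 hp, d12' 1 hp, d_add, d_mul, d_c, d_zero_u,
      d_one_u,
      d_zero_uinv, d_one_uinv, d_zero_rad, d_one_rad, d_zero_ver, d_one_ver, d_fn, eval_add,
      eval_mul, eval_c, eval_u, eval_uinv, eval_fn, Nat.reduceAdd] at e ⊢
    linear_combination (norm := (field_simp; ring)) -p.1 * e
  intro p hp
  have hp0 := hne p hp
  simp only [Fin.forall_fin_two]
  refine ⟨⟨⟨rfl, ?_⟩, rfl, ?_⟩, ⟨?_, ?_⟩, rfl, ?_⟩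
  all_goals
    simp only [sysD, nfD, Matrix.cons_val_zero, Matrix.cons_val_one, eval_fn, a16 p hp, a17 p hp,
      a25 p hp, a26 p hp, eval_add, eval_mul, eval_c, eval_u, eval_uinv]
  field_simp

end B2Deformation
end

noncomputable section

namespace B2Deformation

open Ex SecondCoeffs

variable {k : WithTop ℕ∞} {U V : Set (ℝ × ℝ)} {p₀ : ℝ × ℝ} {F G H : ℝ → ℝ}

/-! ### Normalized integrable systems are in normal form -/

lemma linFlux_congr {B B' : Fin 2 → Fin 2 → ℝ × ℝ → ℝ} (h : ∀ i j, Set.EqOn (B i j) (B' i j) U) :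
    FluxEq U (linFlux B) (linFlux B') := by
  intro i z hz
  simp only [linFlux, linPoly, h i _ hz]

lemma quadFlux_congr {C C' : Fin 2 → Fin 2 → ℝ × ℝ → ℝ} {D D' : Fin 2 → Fin 2 → Fin 2 → ℝ × ℝ → ℝ}
    (hC : ∀ i j, Set.EqOn (C i j) (C' i j) U) (hD : ∀ i j l, Set.EqOn (D i j l) (D' i j l) U) :
    FluxEq U (quadFlux C D) (quadFlux C' D') := by
  intro i z hz
  simp only [quadFlux, quadPoly, hC i _ hz, hD i _ _ hz]

lemma firstCommute_of_fluxEq (hU : IsOpen U) {A S : Fin 2 → ℝ × ℝ → ℝ}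
    {B P : Fin 2 → Fin 2 → ℝ × ℝ → ℝ} (hA : ∀ i, CkOn ∞ U (A i)) (hS : ∀ i, CkOn ∞ U (S i))
    (hB : ∀ i j, CkOn ∞ U (B i j)) (hP : ∀ i j, CkOn ∞ U (P i j))
    (h : FluxEq U (br (baseFlux A) (linFlux P) + br (linFlux B) (baseFlux S)) 0) :
    FirstCommute U A S B P := by
  have key := fun p (hp : p ∈ U) (i : Fin 2) => quad_coeffs_eq_zero (p := p)
    (c := ord₁C A S B P p i) (d := ord₁D A S B P p i) fun z hz => by
      subst hz
      rw [← order_one_eq hU hA hS hB hP hp i]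
      exact h i hp
  exact ⟨fun p hp i => (key p hp i).1, fun p hp i => (key p hp i).2.1,
    fun p hp i => (key p hp i).2.2.1, fun p hp i => (key p hp i).2.2.2⟩

lemma secondCommute_of_fluxEq (hU : IsOpen U) {A S : Fin 2 → ℝ × ℝ → ℝ}
    {B P C C' : Fin 2 → Fin 2 → ℝ × ℝ → ℝ} {D D' : Fin 2 → Fin 2 → Fin 2 → ℝ × ℝ → ℝ}
    (hA : ∀ i, CkOn ∞ U (A i)) (hS : ∀ i, CkOn ∞ U (S i))
    (hB : ∀ i j, CkOn ∞ U (B i j)) (hP : ∀ i j, CkOn ∞ U (P i j))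
    (hC : ∀ i j, CkOn ∞ U (C i j)) (hC' : ∀ i j, CkOn ∞ U (C' i j))
    (hD : ∀ i j l, CkOn ∞ U (D i j l)) (hD' : ∀ i j l, CkOn ∞ U (D' i j l))
    (h : FluxEq U (br (baseFlux A) (quadFlux C' D') + br (linFlux B) (linFlux P) +
      br (quadFlux C D) (baseFlux S)) 0) :
    SecondCommute U A S B P C C' D D' := by
  have key := fun p (hp : p ∈ U) (i : Fin 2) => cubForm_coeffs_eq_zero (p := p)
    (c := ord₂C A S B P C C' p i) (d := ord₂D A S B P C C' D D' p i)
    (e := ord₂E A S B P C C' D D' p i) fun z hz => by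
      subst hz
      rw [← order_two_eq hU hA hS hB hP hC hC' hD hD' hp i]
      exact h i hp
  exact ⟨fun p hp i => (key p hp i).1, fun p hp i => (key p hp i).2.1,
    fun p hp i => (key p hp i).2.2.1, fun p hp i => (key p hp i).2.2.2.1,
    fun p hp i => (key p hp i).2.2.2.2.1, fun p hp i => (key p hp i).2.2.2.2.2⟩

/-- The conditions on the second order terms which the second Miura transformation achieves. -/
structure SecondNormal (U : Set (ℝ × ℝ)) (C : Fin 2 → Fin 2 → ℝ × ℝ → ℝ)
    (D : Fin 2 → Fin 2 → Fin 2 → ℝ × ℝ → ℝ) : Prop where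
  zero_left : ∀ j, ∀ p ∈ U, C 0 j p = 0
  zero_zero_zero : ∀ p ∈ U, D 0 0 0 p = 0
  one_zero_one : ∀ p ∈ U, D 1 0 1 p = p.1 * D 1 1 1 p
  symm : ∀ i, ∀ p ∈ U, D i 1 0 p = 0

lemma CkOn.mono {a : ℝ × ℝ → ℝ} (h : CkOn k V a) (hUV : U ⊆ V) : CkOn k U a :=
  fun p hp => h p (hUV hp)

lemma FluxEq.mono {α β : Fin 2 → Jet → ℝ} (h : FluxEq V α β) (hUV : U ⊆ V) : FluxEq U α β :=
  fun i _ hz => h i (hUV hz)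

/-- The coefficients of a normalized system and of its symmetry. -/
def secondCoeffs (C C' : Fin 2 → Fin 2 → ℝ × ℝ → ℝ) (D D' : Fin 2 → Fin 2 → Fin 2 → ℝ × ℝ → ℝ) :
    SecondCoeffs where
  g := C 1 0
  h := C 1 1
  a16 := D 0 1 1
  a17 := D 0 0 1
  a25 := D 1 0 0
  a26 := D 1 1 1
  c00 := C' 0 0
  c01 := C' 0 1
  c10 := C' 1 0
  c11 := C' 1 1
  d00 := D' 0 0 0
  d01 := D' 0 0 1
  d02 := D' 0 1 1
  d10 := D' 1 0 0
  d11 := D' 1 0 1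
  d12 := D' 1 1 1

section

variable {C C' : Fin 2 → Fin 2 → ℝ × ℝ → ℝ} {D D' : Fin 2 → Fin 2 → Fin 2 → ℝ × ℝ → ℝ}

lemma SecondNormal.sysC_eq (h : SecondNormal U C D) (i j : Fin 2) :
    Set.EqOn (C i j) (evals₂ (secondCoeffs C C' D D').sysC i j) U := by
  revert i j
  simp only [Fin.forall_fin_two]
  exact ⟨⟨h.zero_left 0, h.zero_left 1⟩, fun _ _ => rfl, fun _ _ => rfl⟩

lemma SecondNormal.sysD_eq (h : SecondNormal U C D) (i j l : Fin 2) :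
    Set.EqOn (D i j l) (evals₃ (secondCoeffs C C' D D').sysD i j l) U := by
  revert i j l
  simp only [Fin.forall_fin_two]
  exact ⟨⟨⟨h.zero_zero_zero, fun _ _ => rfl⟩, h.symm 0, fun _ _ => rfl⟩,
    ⟨fun _ _ => rfl, h.one_zero_one⟩, h.symm 1, fun _ _ => rfl⟩

lemma radC_eq (i j : Fin 2) : Set.EqOn (C' i j) (evals₂ (secondCoeffs C C' D D').radC i j) U := by
  revert i j
  simp only [Fin.forall_fin_two]
  exact ⟨⟨fun _ _ => rfl, fun _ _ => rfl⟩, fun _ _ => rfl, fun _ _ => rfl⟩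

lemma radD_eq (h : ∀ i, ∀ p ∈ U, D' i 1 0 p = 0) (i j l : Fin 2) :
    Set.EqOn (D' i j l) (evals₃ (secondCoeffs C C' D D').radD i j l) U := by
  revert i j l
  simp only [Fin.forall_fin_two]
  exact ⟨⟨⟨fun _ _ => rfl, fun _ _ => rfl⟩, h 0, fun _ _ => rfl⟩,
    ⟨fun _ _ => rfl, fun _ _ => rfl⟩, h 1, fun _ _ => rfl⟩

lemma regular_secondCoeffs (hC : ∀ i j, CkOn k U (C i j)) (hC' : ∀ i j, CkOn k U (C' i j))
    (hD : ∀ i j l, CkOn k U (D i j l)) (hD' : ∀ i j l, CkOn k U (D' i j l)) :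
    (secondCoeffs C C' D D').Regular k U := by
  constructor <;> simp only [Fin.forall_fin_two]
  · exact ⟨⟨trivial, trivial⟩, hC 1 0, hC 1 1⟩
  · exact ⟨⟨⟨trivial, hD 0 0 1⟩, trivial, hD 0 1 1⟩, ⟨hD 1 0 0, trivial, hD 1 1 1⟩, trivial,
      hD 1 1 1⟩
  · exact ⟨⟨hC' 0 0, hC' 0 1⟩, hC' 1 0, hC' 1 1⟩
  · exact ⟨⟨⟨hD' 0 0 0, hD' 0 0 1⟩, trivial, hD' 0 1 1⟩, ⟨hD' 1 0 0, hD' 1 0 1⟩, trivial,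
      hD' 1 1 1⟩

end

lemma SecondCoeffs.Regular.mono {q : SecondCoeffs} (h : q.Regular k V) (hUV : U ⊆ V) :
    q.Regular k U := by
  have key : ∀ e : Ex, e.Valid k V → e.Valid k U := by
    intro e he
    induction e with
    | c | u | v => trivial
    | uinv | rad | ver | fn => exact fun p hp => he p (hUV hp)
    | sig => exact ⟨fun p hp => he.1 p (hUV hp), fun p hp => he.2.1 p (hUV hp),
        fun p hp => he.2.2 p (hUV hp)⟩
    | add e f ihe ihf => exact ⟨ihe he.1, ihf he.2⟩
    | mul e f ihe ihf => exact ⟨ihe he.1, ihf he.2⟩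
  exact ⟨fun i j => key _ (h.sysC i j), fun i j l => key _ (h.sysD i j l),
    fun i j => key _ (h.radC i j), fun i j l => key _ (h.radD i j l)⟩

lemma eventually_valid_rad (hF : NearCk k (p₀.1 ^ 2 / 2 + p₀.2) F) :
    ∀ᶠ p in 𝓝 p₀, ContDiffAt ℝ k F (p.1 ^ 2 / 2 + p.2) := by
  have hr : ContinuousAt (fun p : ℝ × ℝ => p.1 ^ 2 / 2 + p.2) p₀ := by fun_prop
  exact hr.eventually hF

/-- F, G and H are obtained in this order, since the equation for each involves the previous ones: F
and G as functions constant along ∂_u - u∂_v, H as a function constant along ∂_u. The neighbourhood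
shrinks each time to where the new function is defined and regular. -/
theorem exists_normalForm (hk : k = ∞ ∨ k = ω) (hU : IsOpen U) (hp₀ : p₀ ∈ U)
    (hne : ∀ p ∈ U, p.1 ≠ 0) {B P C C' : Fin 2 → Fin 2 → ℝ × ℝ → ℝ}
    {D D' : Fin 2 → Fin 2 → Fin 2 → ℝ × ℝ → ℝ}
    (hB : ∀ i j, CkOn k U (B i j)) (hP : ∀ i j, CkOn k U (P i j))
    (hC : ∀ i j, CkOn k U (C i j)) (hC' : ∀ i j, CkOn k U (C' i j))
    (hD : ∀ i j l, CkOn k U (D i j l)) (hD' : ∀ i j l, CkOn k U (D' i j l))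
    (n₁ : FirstNormal U B) (n₂ : SecondNormal U C D) (hD'₁ : ∀ i, ∀ p ∈ U, D' i 1 0 p = 0)
    (h₁ : FluxEq U (br (baseFlux (evals fluxA)) (linFlux P) +
      br (linFlux B) (baseFlux (evals radA))) 0)
    (h₂ : FluxEq U (br (baseFlux (evals fluxA)) (quadFlux C' D') + br (linFlux B) (linFlux P) +
      br (quadFlux C D) (baseFlux (evals radA))) 0) :
    ∃ F G H : ℝ → ℝ, NearCk k (p₀.1 ^ 2 / 2 + p₀.2) F ∧ NearCk k (p₀.1 ^ 2 / 2 + p₀.2) G ∧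
      NearCk k p₀.2 H ∧ ∃ V ⊆ U, IsOpen V ∧ p₀ ∈ V ∧
        FluxEq V (linFlux B) (linFlux (normalForm F G H).B) ∧
        FluxEq V (quadFlux C D) (quadFlux (normalForm F G H).C (normalForm F G H).D) := by
  have hle := infty_le_of_order hk
  have top : ∀ {V : Set (ℝ × ℝ)} {a : ℝ × ℝ → ℝ}, CkOn k V a → CkOn ∞ V a :=
    fun ha p hp => (ha p hp).of_le hle
  have vA : ∀ {V : Set (ℝ × ℝ)} i, CkOn ∞ V (evals fluxA i) := fun i =>
    top ((valid_fluxA i).ckOn hk)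
  have vS : ∀ {V : Set (ℝ × ℝ)} i, CkOn ∞ V (evals radA i) := fun i =>
    top ((valid_radA i).ckOn hk)
  obtain ⟨f₁, f₂⟩ := first_order hk hU hne hB n₁ (firstCommute_of_fluxEq hU vA vS
    (fun i j => top (hB i j)) (fun i j => top (hP i j)) h₁)
  have vuinv : uinv.Valid k U := hne
  have near : ∀ {e : Ex}, e.Valid k U → NearCk k p₀ e.eval := fun he =>
    eventually_of_mem (hU.mem_nhds hp₀) (he.ckOn hk)
  -- the function `F`
  obtain ⟨F, hF, hFB⟩ := exists_eq_rad hk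
    (a := fun p => B 1 0 p * p.1⁻¹ * p.1⁻¹)
    (near (e := fn (B 1 0) * uinv * uinv) ⟨⟨hB 1 0, vuinv⟩, vuinv⟩)
    (eventually_of_mem (hU.mem_nhds hp₀) f₂)
  obtain ⟨U₁, hU₁, oU₁, pU₁⟩ := eventually_nhds_iff.1
    ((hU.eventually_mem hp₀).and (hFB.and (eventually_valid_rad hF)))
  have s₁ : U₁ ⊆ U := fun p hp => (hU₁ p hp).1
  have ne₁ : ∀ p ∈ U₁, p.1 ≠ 0 := fun p hp => hne p (s₁ hp)
  have vF₁ : ∀ n, (rad F n).Valid k U₁ := fun n p hp => (hU₁ p hp).2.2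
  have b10 : ∀ p ∈ U₁, B 1 0 p = (rad F 0 * u * u).eval p := by
    intro p hp
    have := (hU₁ p hp).2.1
    have hp0 := ne₁ p hp
    simp only [eval_mul, eval_u]
    change _ = F _ * p.1 * p.1
    rw [← this]
    field_simp
  have eB : ∀ i j, Set.EqOn (B i j) (evals₂ (nfB F) i j) U₁ := by
    simp only [Fin.forall_fin_two]
    refine ⟨⟨fun p hp => n₁.zero_zero p (s₁ hp), fun p hp => (f₁ p (s₁ hp)).1⟩, b10,
      fun p hp => ?_⟩
    have hp0 := ne₁ p hp
    rw [n₁.one_one p (s₁ hp), (f₁ p (s₁ hp)).1, b10 p hp]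
    simp only [evals₂, nfB, Matrix.cons_val_zero, Matrix.cons_val_one, eval_mul, eval_u]
    field_simp
    ring
  have eP : ∀ i j, Set.EqOn (P i j) (evals₂ (radB F) i j) U₁ := by
    simp only [Fin.forall_fin_two]
    refine ⟨⟨fun p hp => ?_, fun p hp => ?_⟩, fun p hp => ?_, fun p hp => ?_⟩
    all_goals
      have hp0 := ne₁ p hp
      obtain ⟨-, e1, e2, e3, e4⟩ := f₁ p (s₁ hp)
      rw [b10 p hp] at e1 e2 e3 e4
      simp only [e1, e2, e3, e4, evals₂, radB, Matrix.cons_val_zero, Matrix.cons_val_one, eval_mul,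
        eval_u, eval_c, eval_uinv]
      field_simp
  -- the second order relations
  set q := secondCoeffs C C' D D' with hq
  have n₂' : SecondNormal U₁ C D := ⟨fun j p hp => n₂.zero_left j p (s₁ hp),
    fun p hp => n₂.zero_zero_zero p (s₁ hp), fun p hp => n₂.one_zero_one p (s₁ hp),
    fun i p hp => n₂.symm i p (s₁ hp)⟩
  have reg : q.Regular k U := regular_secondCoeffs hC hC' hD hD'
  have reg₁ := reg.mono s₁
  have eC := fun i j => n₂'.sysC_eq (C' := C') (D' := D') i j
  have eD := fun i j l => n₂'.sysD_eq (C' := C') (D' := D') i j l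
  have eC' := fun i j => radC_eq (U := U₁) (C := C) (C' := C') (D := D) (D' := D') i j
  have eD' := fun i j l => radD_eq (U := U₁) (C := C) (C' := C') (D := D) (D' := D')
    (fun i p hp => hD'₁ i p (s₁ hp)) i j l
  have h₂' : FluxEq U₁ (br (baseFlux (evals fluxA)) (quadFlux (evals₂ q.radC) (evals₃ q.radD)) +
      br (linFlux (evals₂ (nfB F))) (linFlux (evals₂ (radB F))) +
      br (quadFlux (evals₂ q.sysC) (evals₃ q.sysD)) (baseFlux (evals radA))) 0 := by
    intro i z hz
    have r : ∀ {α : Fin 2 → Jet → ℝ}, FluxEq U₁ α α := fun _ _ _ => rfl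
    rw [← h₂.mono s₁ i hz]
    simp only [Pi.add_apply]
    rw [br_congr oU₁ r (quadFlux_congr eC' eD') i hz,
      br_congr oU₁ (linFlux_congr eB) (linFlux_congr eP) i hz,
      br_congr oU₁ (quadFlux_congr eC eD) r i hz]
  have vB : ∀ i j, (nfB F i j).Valid k U₁ := by
    simp only [Fin.forall_fin_two]
    simp [nfB, valid_mul, valid_c, valid_u, vF₁]
  have vP : ∀ i j, (radB F i j).Valid k U₁ := by
    have vu : uinv.Valid k U₁ := ne₁
    simp only [Fin.forall_fin_two]
    simp [radB, valid_mul, valid_c, valid_u, vF₁, vu]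
  have top' : ∀ {e : Ex}, e.Valid k U₁ → CkOn ∞ U₁ e.eval := fun he => top (he.ckOn hk)
  have comm := secondCommute_of_fluxEq oU₁ vA vS (fun i j => top' (vB i j))
    (fun i j => top' (vP i j)) (fun i j => top' (reg₁.sysC i j)) (fun i j => top' (reg₁.radC i j))
    (fun i j l => top' (reg₁.sysD i j l)) (fun i j l => top' (reg₁.radD i j l)) h₂'
  have raw : ∀ p ∈ U₁, SecondRelations F q p := fun p hp =>
    comm.relations hk oU₁ ne₁ vF₁ reg₁ hp
  -- the function `G`
  have near₁ : ∀ {e : Ex}, e.Valid k U₁ → NearCk k p₀ e.eval := fun he =>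
    eventually_of_mem (oU₁.mem_nhds pU₁) (he.ckOn hk)
  have nG : NearCk k p₀ fun p => q.g p * p.1⁻¹ ^ 3 -
      1 / 3 * F (p.1 ^ 2 / 2 + p.2) ^ 2 * p.1⁻¹ ^ 2 := by
    have vu : uinv.Valid k U₁ := ne₁
    have e : (fun p : ℝ × ℝ => q.g p * p.1⁻¹ ^ 3 -
        1 / 3 * F (p.1 ^ 2 / 2 + p.2) ^ 2 * p.1⁻¹ ^ 2) =
        (fn q.g * uinv * uinv * uinv + c (-1 / 3) * rad F 0 * rad F 0 * uinv * uinv).eval := by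
      funext p
      simp only [eval_add, eval_mul, eval_c, eval_fn, eval_uinv]
      change _ = _ + -1 / 3 * F _ * F _ * _ * _
      ring
    rw [e]
    exact near₁ (by simp [valid_add, valid_mul, valid_c, vu, vF₁, show (fn q.g).Valid k U₁ from
      reg₁.sysC 1 0])
  obtain ⟨G, hG, hGg⟩ := exists_eq_rad hk nG (eventually_of_mem (oU₁.mem_nhds pU₁) fun p hp =>
    SecondRelations.g_equation hk oU₁ ne₁ vF₁ reg₁ raw hp)
  obtain ⟨U₂, hU₂, oU₂, pU₂⟩ := eventually_nhds_iff.1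
    ((oU₁.eventually_mem pU₁).and (hGg.and (eventually_valid_rad hG)))
  have s₂ : U₂ ⊆ U₁ := fun p hp => (hU₂ p hp).1
  have ne₂ : ∀ p ∈ U₂, p.1 ≠ 0 := fun p hp => ne₁ p (s₂ hp)
  have vF₂ : ∀ n, (rad F n).Valid k U₂ := fun n p hp => vF₁ n p (s₂ hp)
  have vG₂ : ∀ n, (rad G n).Valid k U₂ := fun n p hp => (hU₂ p hp).2.2
  have gG : ∀ H : ℝ → ℝ, ∀ p ∈ U₂, q.g p = (nfC F G H 1 0).eval p := by
    intro H p hp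
    have := (hU₂ p hp).2.1
    have hp0 := ne₂ p hp
    simp only [nfC, Matrix.cons_val_zero, Matrix.cons_val_one, eval_add, eval_mul, eval_c, eval_u]
    change _ = 1 / 3 * F _ * F _ * _ + G _ * _ * _ * _
    rw [← this]
    field_simp
    ring
  -- The formula for g does not involve H, so the zero function stands in for the not yet
  -- constructed H.
  have red := SecondRelations.reduced hk oU₂ ne₂ vF₂ vG₂ (reg₁.mono s₂)
    (fun p hp => raw p (s₂ hp)) (gG 0)
  -- the function `H`
  have nH : NearCk k p₀ fun p => q.h p - (1 / 3 * F (p.1 ^ 2 / 2 + p.2) ^ 2 +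
      G (p.1 ^ 2 / 2 + p.2) * p.1 ^ 2) := by
    have e : (fun p : ℝ × ℝ => q.h p - (1 / 3 * F (p.1 ^ 2 / 2 + p.2) ^ 2 +
        G (p.1 ^ 2 / 2 + p.2) * p.1 ^ 2)) =
        (fn q.h + c (-1 / 3) * rad F 0 * rad F 0 + c (-1) * rad G 0 * u * u).eval := by
      funext p
      simp only [eval_add, eval_mul, eval_c, eval_fn, eval_u]
      change _ = _ + -1 / 3 * F _ * F _ + -1 * G _ * _ * _
      ring
    rw [e]
    exact eventually_of_mem (oU₂.mem_nhds pU₂) (Valid.ckOn hk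
      (by simp [valid_add, valid_mul, valid_c, valid_u, vF₂, vG₂, show (fn q.h).Valid k U₂ from
        (reg₁.mono s₂).sysC 1 1]))
  obtain ⟨H, hH, hHh⟩ := exists_eq_ver hk nH (eventually_of_mem (oU₂.mem_nhds pU₂) fun p hp =>
    SecondRelations.h_equation hk oU₂ ne₂ vF₂ vG₂ (reg₁.mono s₂) (fun p hp => raw p (s₂ hp)) red hp)
  obtain ⟨U₃, hU₃, oU₃, pU₃⟩ := eventually_nhds_iff.1
    ((oU₂.eventually_mem pU₂).and (hHh.and (continuousAt_snd.eventually hH)))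
  have s₃ : U₃ ⊆ U₂ := fun p hp => (hU₃ p hp).1
  have ne₃ : ∀ p ∈ U₃, p.1 ≠ 0 := fun p hp => ne₂ p (s₃ hp)
  have vF₃ : ∀ n, (rad F n).Valid k U₃ := fun n p hp => vF₂ n p (s₃ hp)
  have vG₃ : ∀ n, (rad G n).Valid k U₃ := fun n p hp => vG₂ n p (s₃ hp)
  have vH₃ : ∀ n, (ver H n).Valid k U₃ := fun n p hp => (hU₃ p hp).2.2
  have hH' : ∀ p ∈ U₃, q.h p = (nfC F G H 1 1).eval p := by
    intro p hp
    have := (hU₃ p hp).2.1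
    simp only [nfC, Matrix.cons_val_zero, Matrix.cons_val_one, eval_add, eval_mul, eval_c, eval_u]
    change _ = 1 / 3 * F _ * F _ + G _ * _ * _ + H _
    rw [← this]
    ring
  have reg₃ := (reg₁.mono s₂).mono s₃
  have raw₃ : ∀ p ∈ U₃, SecondRelations F q p := fun p hp => raw p (s₂ (s₃ hp))
  have red₃ := SecondRelations.reduced hk oU₃ ne₃ vF₃ vG₃ reg₃ raw₃ fun p hp => gG 0 p (s₃ hp)
  have dD := SecondRelations.sysD_eq hk oU₃ ne₃ vF₃ vG₃ vH₃ reg₃ raw₃ red₃ hH'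
  have adm : Admissible k U₃ F G H := ⟨ne₃, vF₃ 0, vG₃ 0, vH₃ 0⟩
  refine ⟨F, G, H, hF, hG, hH, U₃, fun p hp => s₁ (s₂ (s₃ hp)), oU₃, pU₃,
    linFlux_congr fun i j p hp => ?_, quadFlux_congr (fun i j p hp => ?_) fun i j l p hp => ?_⟩
  · rw [eB i j (s₂ (s₃ hp)), nfB_eqOn i j hp]
  · rw [eC i j (s₂ (s₃ hp)), nfC_eqOn adm i j hp]
    revert i j
    simp only [Fin.forall_fin_two]
    exact ⟨⟨rfl, rfl⟩, gG H p (s₃ hp), hH' p hp⟩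
  · rw [eD i j l (s₂ (s₃ hp)), nfD_eqOn hk oU₃ adm i j l hp]
    exact dD p hp i j l

end B2Deformation
end

noncomputable section

namespace B2Deformation

open Ex

variable {k : WithTop ℕ∞} {U : Set (ℝ × ℝ)} {p₀ : ℝ × ℝ}

/-! ### The action of Miura transformations on coefficients -/

section

variable {a b : ℝ × ℝ → ℝ}

lemma CkOn.add (ha : CkOn k U a) (hb : CkOn k U b) : CkOn k U fun p => a p + b p :=
  fun p hp => (ha p hp).add (hb p hp)

lemma CkOn.sub (ha : CkOn k U a) (hb : CkOn k U b) : CkOn k U fun p => a p - b p :=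
  fun p hp => (ha p hp).sub (hb p hp)

lemma CkOn.mul (ha : CkOn k U a) (hb : CkOn k U b) : CkOn k U fun p => a p * b p :=
  fun p hp => (ha p hp).mul (hb p hp)

lemma CkOn.const (c : ℝ) : CkOn k U fun _ => c := fun _ _ => contDiffAt_const

lemma CkOn.fst : CkOn k U fun p => p.1 := fun _ _ => contDiffAt_fst

lemma CkOn.inv_fst (h : ∀ p ∈ U, p.1 ≠ 0) : CkOn k U fun p => p.1⁻¹ :=
  fun p hp => contDiffAt_fst.inv (h p hp)

lemma CkOn.pd_self (hk : k = ∞ ∨ k = ω) (ha : CkOn k U a) (j : Fin 2) :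
    CkOn k U (B2Deformation.pd j a) := ha.pd (add_one_le_of_order hk) j

lemma CkOn.smooth (hk : k = ∞ ∨ k = ω) (ha : CkOn k U a) : CkOn ∞ U a :=
  fun p hp => (ha p hp).of_le (infty_le_of_order hk)

end

variable {M A : Fin 2 → ℝ × ℝ → ℝ} {B C γ : Fin 2 → Fin 2 → ℝ × ℝ → ℝ}
  {D : Fin 2 → Fin 2 → Fin 2 → ℝ × ℝ → ℝ}

lemma CkOn.brB (hk : k = ∞ ∨ k = ω) (hM : ∀ i, CkOn k U (M i)) (hA : ∀ i, CkOn k U (A i))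
    (i j : Fin 2) : CkOn k U (brB M A i j) := by
  have t : ∀ l, CkOn k U _ := fun l => (((hM i).pd_self hk l).mul ((hA l).pd_self hk j)).sub
    (((hA i).pd_self hk l).mul ((hM l).pd_self hk j))
  unfold B2Deformation.brB
  simpa only [Fin.sum_univ_two] using (t 0).add (t 1)

lemma CkOn.brC (hk : k = ∞ ∨ k = ω) (hM : ∀ i, CkOn k U (M i)) (hB : ∀ i j, CkOn k U (B i j))
    (i j : Fin 2) : CkOn k U (brC M B i j) := by
  have t : ∀ l, CkOn k U _ := fun l => (((hM i).pd_self hk l).mul (hB l j)).sub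
    ((hB i l).mul ((hM l).pd_self hk j))
  unfold B2Deformation.brC
  simpa only [Fin.sum_univ_two] using (t 0).add (t 1)

lemma CkOn.brD (hk : k = ∞ ∨ k = ω) (hM : ∀ i, CkOn k U (M i)) (hB : ∀ i j, CkOn k U (B i j))
    (i j l : Fin 2) : CkOn k U (brD M B i j l) := by
  have t : ∀ m, CkOn k U _ := fun m =>
    ((((hM i).pd_self hk m).mul ((hB m j).pd_self hk l)).sub
      (((hB i j).pd_self hk m).mul ((hM m).pd_self hk l))).sub
    ((hB i m).mul (((hM m).pd_self hk j).pd_self hk l))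
  unfold B2Deformation.brD
  simpa only [Fin.sum_univ_two] using (t 0).add (t 1)

/-- The first order coefficients of a transformed system. -/
def miuraB (M A : Fin 2 → ℝ × ℝ → ℝ) (B : Fin 2 → Fin 2 → ℝ × ℝ → ℝ) :
    Fin 2 → Fin 2 → ℝ × ℝ → ℝ := fun i j p => B i j p + brB M A i j p

/-- The coefficients of second derivatives in the system transformed by `M` alone. -/
def expC (M A : Fin 2 → ℝ × ℝ → ℝ) (B C : Fin 2 → Fin 2 → ℝ × ℝ → ℝ) :
    Fin 2 → Fin 2 → ℝ × ℝ → ℝ := fun i j p =>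
  C i j p + brC M B i j p + 1 / 2 * brC M (brB M A) i j p

/-- The coefficients of products in the system transformed by `M` alone. -/
def expD (M A : Fin 2 → ℝ × ℝ → ℝ) (B : Fin 2 → Fin 2 → ℝ × ℝ → ℝ)
    (D : Fin 2 → Fin 2 → Fin 2 → ℝ × ℝ → ℝ) : Fin 2 → Fin 2 → Fin 2 → ℝ × ℝ → ℝ := fun i j l p =>
  D i j l p + brD M B i j l p + 1 / 2 * brD M (brB M A) i j l p

/-- The effect of `γ` on the coefficients of second derivatives. -/
def shiftC (A : Fin 2 → ℝ × ℝ → ℝ) (γ C : Fin 2 → Fin 2 → ℝ × ℝ → ℝ) :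
    Fin 2 → Fin 2 → ℝ × ℝ → ℝ := fun i j p => C i j p - brC A γ i j p

/-- The effect of `γ` on the coefficients of products. -/
def shiftD (A : Fin 2 → ℝ × ℝ → ℝ) (γ : Fin 2 → Fin 2 → ℝ × ℝ → ℝ)
    (D : Fin 2 → Fin 2 → Fin 2 → ℝ × ℝ → ℝ) : Fin 2 → Fin 2 → Fin 2 → ℝ × ℝ → ℝ := fun i j l p =>
  D i j l p - brD A γ i j l p

/-- Collecting the coefficients of `u_x v_x`. -/
def collect (D : Fin 2 → Fin 2 → Fin 2 → ℝ × ℝ → ℝ) : Fin 2 → Fin 2 → Fin 2 → ℝ × ℝ → ℝ :=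
  fun i => ![![D i 0 0, fun p => D i 0 1 p + D i 1 0 p], ![fun _ => 0, D i 1 1]]

/-- The coefficients of u_x v_x and v_x u_x are not separately determined by a flux. Collecting them
removes this ambiguity, as the normal form presupposes. -/
lemma quadFlux_collect (C : Fin 2 → Fin 2 → ℝ × ℝ → ℝ) (D : Fin 2 → Fin 2 → Fin 2 → ℝ × ℝ → ℝ) :
    quadFlux C (collect D) = quadFlux C D := by
  funext i z
  simp only [quadFlux, quadPoly, Fin.sum_univ_two, collect, Matrix.cons_val_zero,
    Matrix.cons_val_one]
  ring

lemma ckOn_miuraB (hk : k = ∞ ∨ k = ω) (hM : ∀ i, CkOn k U (M i)) (hA : ∀ i, CkOn k U (A i))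
    (hB : ∀ i j, CkOn k U (B i j)) (i j : Fin 2) : CkOn k U (miuraB M A B i j) :=
  (hB i j).add (.brB hk hM hA i j)

lemma ckOn_expC (hk : k = ∞ ∨ k = ω) (hM : ∀ i, CkOn k U (M i)) (hA : ∀ i, CkOn k U (A i))
    (hB : ∀ i j, CkOn k U (B i j)) (hC : ∀ i j, CkOn k U (C i j)) (i j : Fin 2) :
    CkOn k U (expC M A B C i j) :=
  ((hC i j).add (.brC hk hM hB i j)).add
    ((CkOn.const _).mul (.brC hk hM (fun i j => .brB hk hM hA i j) i j))

lemma ckOn_expD (hk : k = ∞ ∨ k = ω) (hM : ∀ i, CkOn k U (M i)) (hA : ∀ i, CkOn k U (A i))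
    (hB : ∀ i j, CkOn k U (B i j)) (hD : ∀ i j l, CkOn k U (D i j l)) (i j l : Fin 2) :
    CkOn k U (expD M A B D i j l) :=
  ((hD i j l).add (.brD hk hM hB i j l)).add
    ((CkOn.const _).mul (.brD hk hM (fun i j => .brB hk hM hA i j) i j l))

lemma ckOn_shiftC (hk : k = ∞ ∨ k = ω) (hA : ∀ i, CkOn k U (A i)) (hγ : ∀ i j, CkOn k U (γ i j))
    (hC : ∀ i j, CkOn k U (C i j)) (i j : Fin 2) : CkOn k U (shiftC A γ C i j) :=
  (hC i j).sub (.brC hk hA hγ i j)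

lemma ckOn_shiftD (hk : k = ∞ ∨ k = ω) (hA : ∀ i, CkOn k U (A i)) (hγ : ∀ i j, CkOn k U (γ i j))
    (hD : ∀ i j l, CkOn k U (D i j l)) (i j l : Fin 2) : CkOn k U (shiftD A γ D i j l) :=
  (hD i j l).sub (.brD hk hA hγ i j l)

lemma ckOn_collect (hD : ∀ i j l, CkOn k U (D i j l)) (i j l : Fin 2) :
    CkOn k U (collect D i j l) := by
  revert j l
  simp only [Fin.forall_fin_two]
  exact ⟨⟨hD i 0 0, (hD i 0 1).add (hD i 1 0)⟩, .const 0, hD i 1 1⟩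

lemma transport₁_eq (hM : ∀ i, CkOn ∞ U (M i)) (hA : ∀ i, CkOn ∞ U (A i)) :
    FluxEq U (transport₁ (baseFlux M) (baseFlux A) (linFlux B)) (linFlux (miuraB M A B)) := by
  intro i z hz
  simp only [transport₁, Pi.add_apply, br_baseFlux_baseFlux hM hA i hz, linFlux, linPoly, miuraB,
    Fin.sum_univ_two]
  ring

/-- The minus signs in `shiftC` and `shiftD` come from antisymmetry: the term is `br γ A`, whereas
the coefficient formulas are those of `br A γ`. -/
lemma transport₂_eq (hU : IsOpen U) (hM : ∀ i, CkOn ∞ U (M i)) (hA : ∀ i, CkOn ∞ U (A i))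
    (hB : ∀ i j, CkOn ∞ U (B i j)) (hγ : ∀ i j, CkOn ∞ U (γ i j)) :
    FluxEq U (transport₂ (baseFlux M) (linFlux γ) (baseFlux A) (linFlux B) (quadFlux C D))
      (quadFlux (shiftC A γ (expC M A B C)) (collect (shiftD A γ (expD M A B D)))) := by
  intro i z hz
  have h1 := br_baseFlux_linFlux hU hM hB i hz
  have h2 := br_congr (α := baseFlux M) hU (fun _ _ _ => rfl) (br_baseFlux_baseFlux hM hA) i hz
  rw [br_baseFlux_linFlux hU hM (fun i j => CkOn.brB (Or.inl rfl) hM hA i j) i hz] at h2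
  have h3 := br_antisymm (linFlux γ) (baseFlux A) i z
  rw [br_baseFlux_linFlux hU hA hγ i hz] at h3
  rw [quadFlux_collect]
  simp only [transport₂, Pi.add_apply, Pi.smul_apply, smul_eq_mul, h1, h2, h3]
  simp only [quadFlux, quadPoly, shiftC, shiftD, expC, expD, Fin.sum_univ_two]
  ring

/-! ### Normalization -/

lemma evals_fluxA : evals fluxA = fluxB2 := funext fun i => funext fun p => (fluxB2_eq i p).symm

lemma pd_pd_fluxB2 (p : ℝ × ℝ) : pd 0 (pd 0 (fluxB2 0)) p = 2 * p.1 ∧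
    pd 1 (pd 0 (fluxB2 0)) p = 1 ∧ pd 0 (pd 1 (fluxB2 0)) p = 1 ∧ pd 1 (pd 1 (fluxB2 0)) p = 0 ∧
    pd 0 (pd 0 (fluxB2 1)) p = 0 ∧ pd 1 (pd 0 (fluxB2 1)) p = 0 ∧ pd 0 (pd 1 (fluxB2 1)) p = 0 ∧
    pd 1 (pd 1 (fluxB2 1)) p = 1 := by
  have e : ∀ i, fluxB2 i = (fluxA i).eval := fun i => funext fun p => fluxB2_eq i p
  simp only [e, pd_pd_eval_eq (k := ω) (Or.inr rfl) isOpen_univ (valid_fluxA _) (Set.mem_univ p)]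
  simp only [fluxA, Matrix.cons_val_zero, Matrix.cons_val_one, d_add, d_mul, d_c, d_zero_u,
    d_one_u, d_zero_v, d_one_v, eval_add, eval_mul, eval_c, eval_u, eval_v]
  refine ⟨?_, ?_, ?_, ?_, ?_, ?_, ?_, ?_⟩ <;> ring

/-- The transformation changes B₀₀ by -u ∂_u M₁, and B₁₁ - B₁₀/u + u B₀₁ by u²(∂_u M₀ - u ∂_v M₀ -
∂_v M₁). Both are made to vanish by solving first for M₁ along ∂_u and then for M₀ along ∂_u - u∂_v.
-/
lemma exists_firstNormal (hk : k = ∞ ∨ k = ω) (hp₀ : p₀.1 ≠ 0)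
    (hB : ∀ i j, NearCk k p₀ (B i j)) :
    ∃ M : Fin 2 → ℝ × ℝ → ℝ, (∀ i, NearCk k p₀ (M i)) ∧
      ∀ᶠ p in 𝓝 p₀, miuraB M fluxB2 B 0 0 p = 0 ∧ miuraB M fluxB2 B 1 1 p =
        miuraB M fluxB2 B 1 0 p * p.1⁻¹ - p.1 * miuraB M fluxB2 B 0 1 p := by
  have hinv : NearCk k p₀ fun p => p.1⁻¹ := by
    filter_upwards [continuousAt_fst.eventually_ne hp₀] with p hp using contDiffAt_fst.inv hp
  obtain ⟨M₁, hM₁, e₁⟩ := exists_pd_zero_eq hk (h := fun p => B 0 0 p * p.1⁻¹)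
    (by filter_upwards [hB 0 0, hinv] with p h1 h2 using h1.mul h2)
  obtain ⟨M₀, hM₀, e₀⟩ := exists_charDeriv_eq hk (p₀ := p₀) (h := fun p => pd 1 M₁ p -
    (B 1 1 p - B 1 0 p * p.1⁻¹ + p.1 * B 0 1 p) * p.1⁻¹ * p.1⁻¹)
    (by
      filter_upwards [hM₁, hB 1 1, hB 1 0, hB 0 1, hinv] with p h1 h2 h3 h4 h5
      exact (ContDiffAt.pd h1 (add_one_le_of_order hk) 1).sub
        ((((h2.sub (h3.mul h5)).add (contDiffAt_fst.mul h4)).mul h5).mul h5))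
  refine ⟨![M₀, M₁], Fin.forall_fin_two.2 ⟨hM₀, hM₁⟩, ?_⟩
  filter_upwards [e₁, e₀, continuousAt_fst.eventually_ne hp₀] with p h1 h0 hp
  obtain ⟨f1, f2, f3, f4⟩ := pd_fluxB2 p
  simp only [miuraB, brB, Fin.sum_univ_two, f1, f2, f3, f4, Matrix.cons_val_zero,
    Matrix.cons_val_one, h1]
  have e : pd 0 M₀ p = p.1 * pd 1 M₀ p + (pd 1 M₁ p -
    (B 1 1 p - B 1 0 p * p.1⁻¹ + p.1 * B 0 1 p) * p.1⁻¹ * p.1⁻¹) := by linear_combination h0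
  rw [e]
  constructor
  · field_simp
    ring
  · field_simp
    ring

/-- Here the conditions are algebraic in the unknown: γ₁₀ removes C₀₀, then γ₀₀ removes D₀₀₀, γ₁₁
adjusts the coefficient of u_x v_x in the second equation, and γ₀₁ removes C₀₁. Each step divides by
u and uses at most a derivative of γ₁₀. -/
lemma exists_secondNormal (hk : k = ∞ ∨ k = ω) (hne : ∀ p ∈ U, p.1 ≠ 0)
    (hC : ∀ i j, CkOn k U (C i j)) (hD : ∀ i j l, CkOn k U (D i j l)) :
    ∃ γ : Fin 2 → Fin 2 → ℝ × ℝ → ℝ, (∀ i j, CkOn k U (γ i j)) ∧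
      SecondNormal U (shiftC fluxB2 γ C) (collect (shiftD fluxB2 γ D)) := by
  have hi : CkOn k U fun p => p.1⁻¹ := .inv_fst hne
  obtain ⟨γ₁₀, h₁₀, e₁₀⟩ : ∃ a : ℝ × ℝ → ℝ, CkOn k U a ∧ ∀ p, a p = C 0 0 p * p.1⁻¹ :=
    ⟨_, (hC 0 0).mul hi, fun p => rfl⟩
  obtain ⟨γ₀₀, h₀₀, e₀₀⟩ : ∃ a : ℝ × ℝ → ℝ, CkOn k U a ∧
      ∀ p, a p = 1 / 2 * (p.1 * pd 0 γ₁₀ p - D 0 0 0 p) * p.1⁻¹ :=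
    ⟨_, ((CkOn.const (1 / 2)).mul ((CkOn.fst.mul (h₁₀.pd_self hk 0)).sub (hD 0 0 0))).mul hi,
      fun p => rfl⟩
  obtain ⟨γ₁₁, h₁₁, e₁₁⟩ : ∃ a : ℝ × ℝ → ℝ, CkOn k U a ∧ ∀ p, a p = (D 1 0 1 p + D 1 1 0 p -
      p.1 * D 1 1 1 p + p.1 * pd 0 γ₁₀ p + 2 * γ₁₀ p) * p.1⁻¹ :=
    ⟨_, (((((hD 1 0 1).add (hD 1 1 0)).sub (CkOn.fst.mul (hD 1 1 1))).add
      (CkOn.fst.mul (h₁₀.pd_self hk 0))).add ((CkOn.const 2).mul h₁₀)).mul hi, fun p => rfl⟩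
  obtain ⟨γ₀₁, h₀₁, e₀₁⟩ : ∃ a : ℝ × ℝ → ℝ, CkOn k U a ∧
      ∀ p, a p = C 0 1 p * p.1⁻¹ * p.1⁻¹ - (γ₁₁ p - γ₀₀ p) * p.1⁻¹ :=
    ⟨_, (((hC 0 1).mul hi).mul hi).sub ((h₁₁.sub h₀₀).mul hi), fun p => rfl⟩
  refine ⟨![![γ₀₀, γ₀₁], ![γ₁₀, γ₁₁]], ?_, ?_, ?_, ?_, ?_⟩
  · simp only [Fin.forall_fin_two]
    exact ⟨⟨h₀₀, h₀₁⟩, h₁₀, h₁₁⟩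
  · intro j p hp
    have hp0 := hne p hp
    obtain ⟨f1, f2, f3, f4⟩ := pd_fluxB2 p
    revert j
    simp only [Fin.forall_fin_two, shiftC, brC, Fin.sum_univ_two, f1, f2, f3, f4,
      Matrix.cons_val_zero, Matrix.cons_val_one, e₁₀, e₀₁]
    constructor
    · field_simp
      ring
    · field_simp
      ring
  · intro p hp
    have hp0 := hne p hp
    obtain ⟨f1, f2, f3, -⟩ := pd_fluxB2 p
    obtain ⟨s1, -, -, -, s5, -, -, -⟩ := pd_pd_fluxB2 p
    simp only [collect, shiftD, brD, Fin.sum_univ_two, f1, f2, f3, s1, s5, Matrix.cons_val_zero,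
      Matrix.cons_val_one]
    rw [e₀₀]
    field_simp
    ring
  · intro p hp
    have hp0 := hne p hp
    obtain ⟨f1, f2, f3, f4⟩ := pd_fluxB2 p
    obtain ⟨-, s2, s3, s4, -, s6, s7, s8⟩ := pd_pd_fluxB2 p
    simp only [collect, shiftD, brD, Fin.sum_univ_two, f1, f2, f3, f4, s2, s3, s4, s6, s7, s8,
      Matrix.cons_val_zero, Matrix.cons_val_one]
    rw [e₁₁]
    field_simp
    ring
  · exact fun i p _ => rfl

end B2Deformation
end

noncomputable section

namespace B2Deformation

open ConsSystem

variable {k : WithTop ℕ∞} {U : Set (ℝ × ℝ)} {p₀ : ℝ × ℝ} {z : Jet}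

/-! ### Taylor expansions along curves of jets -/

/-- The function φ - φ'x has derivative bounded by C|ε| on the ball of radius |ε|, the derivative of
φ being differentiable at 0; the mean value inequality gives the second factor |ε|. -/
lemma isBigO_sq_of_contDiffAt {φ : ℝ → ℝ} {φ' : ℝ} (h : ContDiffAt ℝ 2 φ 0)
    (h' : HasDerivAt φ φ' 0) :
    (fun ε => φ ε - φ 0 - φ' * ε) =O[𝓝 0] fun ε : ℝ => ε ^ 2 := by
  have hd : ContDiffAt ℝ 1 (deriv φ) 0 :=
    (h.fderiv_right (m := 1) (by norm_num)).clm_apply contDiffAt_const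
  obtain ⟨C, hC⟩ := (hd.differentiableAt (by norm_num)).isBigO_sub.bound
  obtain ⟨r, hr, hball⟩ := Metric.eventually_nhds_iff_ball.1
    (hC.and ((h.eventually (by simp)).mono fun x hx => hx.differentiableAt (by norm_num)))
  refine IsBigO.of_bound C ?_
  filter_upwards [Metric.ball_mem_nhds (0 : ℝ) hr] with ε hε
  rw [mem_ball_zero_iff] at hε
  have sub : ∀ x ∈ Metric.closedBall (0 : ℝ) ‖ε‖, x ∈ Metric.ball (0 : ℝ) r := fun x hx =>
    mem_ball_zero_iff.2 ((mem_closedBall_zero_iff.1 hx).trans_lt hε)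
  have hC0 : 0 ≤ C * ‖ε‖ := by
    have := (hball ε (mem_ball_zero_iff.2 hε)).1
    rw [sub_zero] at this
    exact (norm_nonneg _).trans this
  have key := Convex.norm_image_sub_le_of_norm_hasDerivWithin_le (𝕜 := ℝ)
    (f := fun x => φ x - φ' * x) (f' := fun x => deriv φ x - φ') (C := C * ‖ε‖)
    (s := Metric.closedBall (0 : ℝ) ‖ε‖) (x := 0) (y := ε)
    (fun x hx => ?_) (fun x hx => ?_) (convex_closedBall _ _)
    (Metric.mem_closedBall_self (norm_nonneg _)) (by simp)
  · have e : φ ε - φ 0 - φ' * ε = φ ε - φ' * ε - (φ 0 - φ' * 0) := by ring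
    rw [e, norm_pow, pow_two, ← mul_assoc]
    rwa [sub_zero] at key
  · have := ((hball x (sub x hx)).2.hasDerivAt.sub ((hasDerivAt_id x).const_mul φ'))
    rw [mul_one] at this
    exact this.hasDerivWithinAt
  · have := (hball x (sub x hx)).1
    rw [h'.deriv, sub_zero] at this
    refine this.trans ?_
    rcases eq_or_ne ε 0 with rfl | hε0
    · have : x = 0 := by simpa using hx
      simp [this]
    · have : 0 ≤ C := nonneg_of_mul_nonneg_left hC0 (norm_pos_iff.2 hε0)
      exact mul_le_mul_of_nonneg_left (mem_closedBall_zero_iff.1 hx) this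

/-- The curve `z + ε a + ε² b` of jets. -/
def jetCurve (z a b : Jet) (ε : ℝ) : Jet := z + ε • a + ε ^ 2 • b

lemma base_jetCurve (z a b : Jet) (ε : ℝ) :
    (jetCurve z a b ε).base = z.base + ε • a.base + ε ^ 2 • b.base := by
  simp [Jet.base, jetCurve]

lemma hasDerivAt_quadratic (x y w : ℝ) :
    HasDerivAt (fun ε : ℝ => x + ε * y + ε ^ 2 * w) y 0 := by
  have h := (((hasDerivAt_id (0 : ℝ)).mul_const y).const_add x).add
    (((hasDerivAt_id (0 : ℝ)).pow 2).mul_const w)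
  exact HasDerivAt.congr_deriv h (by simp)

/-- The term ε²b does not affect the first derivative at ε = 0, which is the line derivative along
`a`. It does enter the ε²-coefficient of the leading flux, treated in `isBigO_fluxB2`. -/
lemma IsDiffPoly.curve (hU : IsOpen U) {f : Jet → ℝ} (hf : IsDiffPoly U f)
    (hz : z ∈ jetsOver U) (a b : Jet) :
    ContDiffAt ℝ ∞ (fun ε => f (jetCurve z a b ε)) 0 ∧
      HasDerivAt (fun ε => f (jetCurve z a b ε)) (lineDeriv ℝ f z a) 0 := by
  have h0 : jetCurve z a b 0 = z := by simp [jetCurve]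
  induction hf with
  | @base A hA =>
    have hb : (jetCurve z a b 0).base = z.base := by rw [h0]
    have hA' : ContDiffAt ℝ ∞ A (jetCurve z a b 0).base := by rw [hb]; exact hA _ hz
    constructor
    · refine hA'.comp (f := fun ε => (jetCurve z a b ε).base) 0 (ContDiff.contDiffAt ?_)
      simp only [base_jetCurve]
      fun_prop
    · have hd : HasDerivAt (fun ε => (jetCurve z a b ε).base) a.base 0 :=
        (hasDerivAt_quadratic _ _ _).prodMk (hasDerivAt_quadratic _ _ _)
      rw [(hasLineDerivAt_base (hA.differentiableAt hz) a).lineDeriv]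
      have h := (hA'.differentiableAt (by simp)).hasFDerivAt.comp_hasDerivAt (0 : ℝ) hd
      rw [fderiv_eq_pd, hb] at h
      exact h
  | coord s i =>
    rw [(hasLineDerivAt_coord s i z a).lineDeriv]
    refine ⟨ContDiff.contDiffAt ?_, hasDerivAt_quadratic _ _ _⟩
    change ContDiff ℝ ∞ fun ε : ℝ => z s i + ε * a s i + ε ^ 2 * b s i
    fun_prop
  | add ha hb iha ihb =>
    rw [(hasLineDerivAt_add (ha.hasLineDerivAt hU hz a) (hb.hasLineDerivAt hU hz a)).lineDeriv]
    exact ⟨iha.1.add ihb.1, iha.2.add ihb.2⟩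
  | mul ha hb iha ihb =>
    rw [(hasLineDerivAt_mul (ha.hasLineDerivAt hU hz a) (hb.hasLineDerivAt hU hz a)).lineDeriv]
    have h := iha.2.mul ihb.2
    rw [h0] at h
    exact ⟨iha.1.mul ihb.1, h⟩
  | @congr f g ha hab ih =>
    have e : (fun ε => g (jetCurve z a b ε)) =ᶠ[𝓝 0] fun ε => f (jetCurve z a b ε) := by
      have : Continuous fun ε : ℝ => (jetCurve z a b ε).base := by
        simp only [base_jetCurve]; fun_prop
      have h := (this.continuousAt (x := 0)).preimage_mem_nhds
        (hU.mem_nhds (by rw [h0]; exact hz))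
      filter_upwards [h] with ε hε
      exact (hab hε).symm
    rw [← lineDeriv_congr_over hU hab hz]
    exact ⟨ih.1.congr_of_eventuallyEq e, ih.2.congr_of_eventuallyEq e⟩

lemma IsDiffPoly.isBigO_sq (hU : IsOpen U) {f : Jet → ℝ} (hf : IsDiffPoly U f)
    (hz : z ∈ jetsOver U) (a b : Jet) :
    (fun ε => f (jetCurve z a b ε) - f z - lineDeriv ℝ f z a * ε) =O[𝓝 0] fun ε : ℝ => ε ^ 2 := by
  have h := hf.curve hU hz a b
  have := isBigO_sq_of_contDiffAt (h.1.of_le two_le_infty) h.2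
  simpa [jetCurve] using this

lemma IsDiffPoly.isBigO_id (hU : IsOpen U) {f : Jet → ℝ} (hf : IsDiffPoly U f)
    (hz : z ∈ jetsOver U) (a b : Jet) :
    (fun ε => f (jetCurve z a b ε) - f z) =O[𝓝 0] fun ε : ℝ => ε := by
  have := (hf.curve hU hz a b).2.isBigO_sub
  simpa [jetCurve] using this

/-- The second derivative of `fluxB2 i` at `p`, applied to `q` twice. -/
def hessB2 (p q : ℝ × ℝ) : Fin 2 → ℝ := ![2 * q.1 * q.2 + 2 * p.1 * q.1 ^ 2, q.2 ^ 2]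

/-- The fluxes are polynomials, so the remainder is ε³ times the explicit polynomial `g` in ε. Only
the leading flux has to be expanded to second order, the corrections already carrying a power of ε.
-/
lemma isBigO_fluxB2 (p q r : ℝ × ℝ) (i : Fin 2) :
    (fun ε : ℝ => fluxB2 i (p + ε • q + ε ^ 2 • r) - fluxB2 i p -
      ε * (pd 0 (fluxB2 i) p * q.1 + pd 1 (fluxB2 i) p * q.2) -
      ε ^ 2 * (pd 0 (fluxB2 i) p * r.1 + pd 1 (fluxB2 i) p * r.2 + 1 / 2 * hessB2 p q i))
      =O[𝓝 0] fun ε : ℝ => ε ^ 3 := by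
  have key : ∀ {f g : ℝ → ℝ}, Continuous g → (∀ ε, f ε = ε ^ 3 * g ε) →
      f =O[𝓝 0] fun ε : ℝ => ε ^ 3 := by
    intro f g hg hfg
    have := (isBigO_refl (fun ε : ℝ => ε ^ 3) (𝓝 0)).mul ((hg.continuousAt (x := 0)).isBigO_one ℝ)
    exact this.congr (fun ε => (hfg ε).symm) fun ε => mul_one _
  obtain ⟨h1, h2, h3, h4⟩ := pd_fluxB2 p
  fin_cases i
  · refine key (g := fun ε => q.1 * r.2 + r.1 * q.2 + ε * r.1 * r.2 +
      (2 * p.1 * q.1 * r.1 + ε * p.1 * r.1 ^ 2) +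
      1 / 3 * (q.1 + ε * r.1) ^ 3) (by fun_prop) fun ε => ?_
    change fluxB2 0 _ - fluxB2 0 p - ε * (pd 0 (fluxB2 0) p * q.1 + pd 1 (fluxB2 0) p * q.2) -
      ε ^ 2 * (pd 0 (fluxB2 0) p * r.1 + pd 1 (fluxB2 0) p * r.2 + 1 / 2 * hessB2 p q 0) = _
    rw [h1, h2]
    simp only [fluxB2, hessB2, Matrix.cons_val_zero, Prod.fst_add, Prod.snd_add, Prod.smul_fst,
      Prod.smul_snd, smul_eq_mul]
    ring
  · refine key (g := fun ε => q.2 * r.2 + 1 / 2 * ε * r.2 ^ 2) (by fun_prop) fun ε => ?_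
    change fluxB2 1 _ - fluxB2 1 p - ε * (pd 0 (fluxB2 1) p * q.1 + pd 1 (fluxB2 1) p * q.2) -
      ε ^ 2 * (pd 0 (fluxB2 1) p * r.1 + pd 1 (fluxB2 1) p * r.2 + 1 / 2 * hessB2 p q 1) = _
    rw [h3, h4]
    simp only [fluxB2, hessB2, Matrix.cons_val_zero, Matrix.cons_val_one, Prod.snd_add,
      Prod.smul_snd, smul_eq_mul]
    ring

/-! ### Miura transformations and the transport of fluxes -/

variable {M : Fin 2 → ℝ × ℝ → ℝ} {X₁ X₂ Γ Β : Fin 2 → Jet → ℝ}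

/-- Chain rule: a second derivative along the flow of M is the Hessian on the velocity plus the
first derivative along the acceleration, which is itself the prolongation of the flux M
differentiated along its flow. -/
lemma der_along_der_along_fluxB2 (hU : IsOpen U) (hM : ∀ i, CkOn ∞ U (M i))
    (hz : z ∈ jetsOver U) (i : Fin 2) :
    der (along (baseFlux M)) (der (along (baseFlux M)) (baseFlux fluxB2 i)) z =
      hessB2 z.base (along (baseFlux M) z 0 0, along (baseFlux M) z 0 1) i +
      der (along fun i => der (along (baseFlux M)) (baseFlux M i)) (baseFlux fluxB2 i) z := by
  have bM := isDiffFlux_baseFlux hM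
  have aM := bM.along hU
  have hf := fun i => ckOn_fluxB2 (k := ∞) (U := U) i
  have e1 : Set.EqOn (der (along (baseFlux M)) (baseFlux fluxB2 i))
      (fun z => pd 0 (fluxB2 i) z.base * along (baseFlux M) z 0 0 +
        pd 1 (fluxB2 i) z.base * along (baseFlux M) z 0 1) (jetsOver U) := fun z hz =>
    der_base ((hf i).differentiableAt hz)
  have e2 : ∀ l, der (along (baseFlux M)) (fun z => along (baseFlux M) z 0 l) z =
      along (fun i => der (along (baseFlux M)) (baseFlux M i)) z 0 l := fun l =>
    (dx_der_along hU bM (bM l) hz).symm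
  have d : ∀ j, IsDiffPoly U fun z => pd j (fluxB2 i) z.base := fun j => .base ((hf i).pd_top j)
  have e3 : der (along fun i => der (along (baseFlux M)) (baseFlux M i)) (baseFlux fluxB2 i) z = _ :=
    der_base ((hf i).differentiableAt hz)
  rw [der_congr hU e1 hz, der_add hU ((d 0).mul (aM 0 0)) ((d 1).mul (aM 0 1)) hz,
    der_mul hU (d 0) (aM 0 0) hz, der_mul hU (d 1) (aM 0 1) hz, e2, e2, e3,
    der_base (((hf i).pd_top 0).differentiableAt hz),
    der_base (((hf i).pd_top 1).differentiableAt hz)]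
  obtain ⟨s1, s2, s3, s4, s5, s6, s7, s8⟩ := pd_pd_fluxB2 z.base
  clear e1 e3 d
  revert i
  simp only [Fin.forall_fin_two, hessB2, Matrix.cons_val_zero, Matrix.cons_val_one, s1, s2, s3, s4,
    s5, s6, s7, s8]
  constructor <;> ring

/-- The second order part of the statement that `w = u + ∂ₓ(ε M + ε² β)` takes a system to the
transported one, where `β = γ + ½ M_t` along the flow with the flux `M`. -/
lemma miura_order_two (hU : IsOpen U) (hM : ∀ i, CkOn ∞ U (M i)) (hX₁ : IsDiffFlux U X₁)
    (hΓ : IsDiffFlux U Γ)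
    (hΒ : FluxEq U Β (Γ + (1 / 2 : ℝ) • fun i => der (along (baseFlux M)) (baseFlux M i)))
    (hz : z ∈ jetsOver U) (i : Fin 2) :
    der (along Β) (baseFlux fluxB2 i) z +
        1 / 2 * hessB2 z.base (along (baseFlux M) z 0 0, along (baseFlux M) z 0 1) i +
        der (along (baseFlux M)) (transport₁ (baseFlux M) (baseFlux fluxB2) X₁ i) z +
        transport₂ (baseFlux M) Γ (baseFlux fluxB2) X₁ X₂ i z =
      X₂ i z + der (along (baseFlux fluxB2)) (Β i) z + der (along X₁) (baseFlux M i) z := by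
  have bM := isDiffFlux_baseFlux hM
  have bA := isDiffFlux_baseFlux fun i => ckOn_fluxB2 (k := ∞) (U := U) i
  have aM := bM.along hU
  have aA := bA.along hU
  have bW : IsDiffFlux U fun i => der (along (baseFlux M)) (baseFlux M i) := fun i =>
    (bM i).der hU aM
  have h1 := der_along_congr hU hΒ (fun z _ => rfl : Set.EqOn (baseFlux fluxB2 i) _ _) hz
  rw [der_along_add hU hΓ (bW.smul _) (bA i) hz, der_along_smul hU _ bW hz] at h1
  have h2 : der (along (baseFlux fluxB2)) (Β i) z = _ := der_congr hU (hΒ i) hz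
  have h2' := der_add (w := along (baseFlux fluxB2)) hU (hΓ i) ((bW i).smul (1 / 2)) hz
  rw [der_smul hU _ (bW i) hz] at h2'
  have h3 := der_along_der_along_fluxB2 hU hM hz i
  have h4 := der_add (w := along (baseFlux M)) hU (hX₁ i) (bM.br hU bA i) hz
  have h5 := der_sub (w := along (baseFlux M)) hU ((bM i).der hU aA) ((bA i).der hU aM) hz
  have h6 := der_along_comm hU bM bA (bM i) hz
  have e1 : der (along (baseFlux M)) (transport₁ (baseFlux M) (baseFlux fluxB2) X₁ i) z = _ := h4
  have e2 : der (along (baseFlux M)) (br (baseFlux M) (baseFlux fluxB2) i) z = _ := h5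
  have e3 : der (along (baseFlux fluxB2)) (Β i) z = _ := h2.trans h2'
  rw [e1, e3, h1]
  simp only [transport₂, Pi.add_apply, Pi.smul_apply, smul_eq_mul]
  rw [br, br, br, ← h6, e2]
  linear_combination (1 / 2) * (-h3)

variable {β γ : Fin 2 → Fin 2 → ℝ × ℝ → ℝ} {X N : ConsSystem}

/-- Prolongation is linear in the potential, so the transformed jet is an exact quadratic curve in
ε, without remainder. -/
lemma miuraJet_eq (hU : IsOpen U) (hM : ∀ i, CkOn ∞ U (M i)) (hβ : ∀ i j, CkOn ∞ U (β i j))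
    (hz : z ∈ jetsOver U) (ε : ℝ) :
    miuraJet (miuraPotential M β ε) z =
      jetCurve z (along (baseFlux M) z) (along (linFlux β) z) ε := by
  have bM := isDiffFlux_baseFlux hM
  have bβ := isDiffFlux_linFlux hβ
  have e : miuraPotential M β ε = ε • baseFlux M + ε ^ 2 • linFlux β := rfl
  have h : miuraJet (miuraPotential M β ε) z = z + along (miuraPotential M β ε) z := by
    funext s i
    simp only [miuraJet, Pi.add_apply, along_apply]
  rw [h, e, along_add hU (bM.smul _) (bβ.smul _) hz, along_smul hU _ bM hz, along_smul hU _ bβ hz,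
    jetCurve, add_assoc]

/-- The time derivative of the potential. -/
lemma evol_miuraPotential (hU : IsOpen U) (hX : X.SmoothOver U) (hM : ∀ i, CkOn ∞ U (M i))
    (hβ : ∀ i j, CkOn ∞ U (β i j)) (hz : z ∈ jetsOver U) (ε : ℝ) (i : Fin 2) :
    evol (X.field ε) (miuraPotential M β ε i) z =
      ε * der (along (baseFlux X.A)) (baseFlux M i) z +
      ε ^ 2 * (der (along (baseFlux X.A)) (linFlux β i) z +
        der (along (linFlux X.B)) (baseFlux M i) z) +
      ε ^ 3 * (der (along (quadFlux X.C X.D)) (baseFlux M i) z +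
        der (along (linFlux X.B)) (linFlux β i) z +
        ε * der (along (quadFlux X.C X.D)) (linFlux β i) z) := by
  have bM := isDiffFlux_baseFlux hM
  have bβ := isDiffFlux_linFlux hβ
  have h1 : evol (X.field ε) (miuraPotential M β ε i) z =
      der (along (X.flux ε)) (fun z => ε * baseFlux M i z) z +
        der (along (X.flux ε)) (fun z => ε ^ 2 * linFlux β i z) z :=
    der_add (w := along (X.flux ε)) hU ((bM i).smul ε) ((bβ i).smul (ε ^ 2)) hz
  have h2 : ∀ {a : Jet → ℝ}, IsDiffPoly U a → der (along (X.flux ε)) a z =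
      der (along (baseFlux X.A)) a z + ε * der (along (linFlux X.B)) a z +
        ε ^ 2 * der (along (quadFlux X.C X.D)) a z := by
    intro a ha
    rw [flux_eq, der_along_add hU (hX.base.add (hX.lin.smul ε)) (hX.quad.smul _) ha hz,
      der_along_add hU hX.base (hX.lin.smul ε) ha hz, der_along_smul hU _ hX.lin hz,
      der_along_smul hU _ hX.quad hz]
  rw [h1, der_smul hU _ (bM i) hz, der_smul hU _ (bβ i) hz, h2 (bM i), h2 (bβ i)]
  ring

/-- With one power of ε the linear part is needed only to first order, and with two the quadratic
part only to zeroth. The coefficients of 1 agree since both systems have the same leading flux,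
those of ε by `h₁`, those of ε² by `miura_order_two`. -/
theorem isBigO_of_transport (hU : IsOpen U) (hM : ∀ i, CkOn ∞ U (M i))
    (hγ : ∀ i j, CkOn ∞ U (γ i j)) (hβ : ∀ i j, CkOn ∞ U (β i j))
    (hΒ : FluxEq U (linFlux β)
      (linFlux γ + (1 / 2 : ℝ) • fun i => der (along (baseFlux M)) (baseFlux M i)))
    (hX : X.SmoothOver U) (hXA : X.A = fluxB2) (hNA : N.A = fluxB2)
    (hB : ∀ i j, CkOn ∞ U (N.B i j)) (hC : ∀ i j, CkOn ∞ U (N.C i j))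
    (hD : ∀ i j l, CkOn ∞ U (N.D i j l))
    (h₁ : FluxEq U (transport₁ (baseFlux M) (baseFlux fluxB2) (linFlux X.B)) (linFlux N.B))
    (h₂ : FluxEq U (transport₂ (baseFlux M) (linFlux γ) (baseFlux fluxB2) (linFlux X.B)
      (quadFlux X.C X.D)) (quadFlux N.C N.D)) (hz : z ∈ jetsOver U) (i : Fin 2) :
    (fun ε : ℝ => N.flux ε i (miuraJet (miuraPotential M β ε) z) -
      (X.flux ε i z + evol (X.field ε) (miuraPotential M β ε i) z))
        =O[𝓝 0] fun ε : ℝ => ε ^ 3 := by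
  simp only [miuraJet_eq hU hM hβ hz, evol_miuraPotential hU hX hM hβ hz, flux_eq, hXA, hNA,
    Pi.add_apply, Pi.smul_apply, smul_eq_mul]
  set a := along (baseFlux M) z with ha
  set b := along (linFlux β) z with hb
  have o1 : (fun ε : ℝ => ε * (linFlux N.B i (jetCurve z a b ε) - linFlux N.B i z -
      lineDeriv ℝ (linFlux N.B i) z a * ε)) =O[𝓝 0] fun ε : ℝ => ε ^ 3 :=
    ((isBigO_refl (fun ε : ℝ => ε) _).mul
      ((isDiffFlux_linFlux hB i).isBigO_sq hU hz a b)).congr_right fun ε => by ring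
  have o2 : (fun ε : ℝ => ε ^ 2 * (quadFlux N.C N.D i (jetCurve z a b ε) - quadFlux N.C N.D i z))
      =O[𝓝 0] fun ε : ℝ => ε ^ 3 :=
    ((isBigO_refl (fun ε : ℝ => ε ^ 2) _).mul
      ((isDiffFlux_quadFlux hC hD i).isBigO_id hU hz a b)).congr_right fun ε => by ring
  have o0 := isBigO_fluxB2 z.base a.base b.base i
  have o3 : (fun ε : ℝ => ε ^ 3 * (der (along (quadFlux X.C X.D)) (baseFlux M i) z +
      der (along (linFlux X.B)) (linFlux β i) z +
      ε * der (along (quadFlux X.C X.D)) (linFlux β i) z)) =O[𝓝 0] fun ε : ℝ => ε ^ 3 := by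
    have hc : Continuous fun ε : ℝ => der (along (quadFlux X.C X.D)) (baseFlux M i) z +
      der (along (linFlux X.B)) (linFlux β i) z +
      ε * der (along (quadFlux X.C X.D)) (linFlux β i) z := by fun_prop
    exact ((isBigO_refl (fun ε : ℝ => ε ^ 3) _).mul
      ((hc.continuousAt (x := 0)).isBigO_one ℝ)).congr_right fun ε => mul_one _
  refine (((o0.add o1).add o2).sub o3).congr_left fun ε => ?_
  have f := fun i => (ckOn_fluxB2 (k := ∞) (U := U) i).differentiableAt hz
  have d1 : der (along (baseFlux M)) (baseFlux fluxB2 i) z = _ := der_base (f i)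
  have d2 : der (along (linFlux β)) (baseFlux fluxB2 i) z = _ := der_base (f i)
  have d3 : der (along (baseFlux M)) (linFlux N.B i) z = lineDeriv ℝ (linFlux N.B i) z a := rfl
  have k1 := h₁ i hz
  have k2 := miura_order_two (X₂ := quadFlux X.C X.D) hU hM hX.lin (isDiffFlux_linFlux hγ) hΒ hz i
  rw [h₂ i hz, der_congr hU (h₁ i) hz, d2, d3] at k2
  simp only [transport₁, Pi.add_apply, br] at k1
  rw [d1] at k1
  have ebase : baseFlux fluxB2 i (jetCurve z a b ε) =
      fluxB2 i (z.base + ε • a.base + ε ^ 2 • b.base) := by rw [← base_jetCurve]; rfl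
  have ez : baseFlux fluxB2 i z = fluxB2 i z.base := rfl
  have ea : a.base = (a 0 0, a 0 1) := rfl
  have eb : b.base = (b 0 0, b 0 1) := rfl
  rw [ebase, ez]
  simp only [← ha, ← hb] at k1 k2
  rw [ea, eb]
  linear_combination ε * k1 - ε ^ 2 * k2

end B2Deformation
end

noncomputable section

namespace B2Deformation

open ConsSystem Ex

variable {k : WithTop ℕ∞} {U : Set (ℝ × ℝ)} {p₀ : ℝ × ℝ} {F G H : ℝ → ℝ}

/-! ### Reduction to the normal form -/

lemma CkOn.congr (hU : IsOpen U) {a b : ℝ × ℝ → ℝ} (hb : CkOn k U b) (h : Set.EqOn a b U) :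
    CkOn k U a :=
  fun p hp => (hb p hp).congr_of_eventuallyEq (h.eventuallyEq_of_mem (hU.mem_nhds hp))

/-- This makes explicit the second order term of the flow of εM: half the derivative of M along
itself is linear in u_x and can be absorbed into β. -/
lemma linFlux_square {M : Fin 2 → ℝ × ℝ → ℝ} (γ : Fin 2 → Fin 2 → ℝ × ℝ → ℝ)
    (hM : ∀ i, CkOn ∞ U (M i)) :
    FluxEq U (linFlux fun i j p => γ i j p + 1 / 2 * ∑ l, pd l (M i) p * pd j (M l) p)
      (linFlux γ + (1 / 2 : ℝ) • fun i => der (along (baseFlux M)) (baseFlux M i)) := by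
  intro i z hz
  have h : der (along (baseFlux M)) (baseFlux M i) z = _ := der_base ((hM i).differentiableAt hz)
  simp only [Pi.add_apply, Pi.smul_apply, smul_eq_mul]
  rw [h]
  simp only [along_baseFlux_zero hM hz, linFlux, linPoly, Fin.sum_univ_two]
  ring

/-- The symmetry with s = u²/2 + v and ψ = 0, the one to which the integrability assumption is
applied in the reduction. -/
lemma commuteDispersionless_radA {A : Fin 2 → ℝ × ℝ → ℝ}
    (hA : ∀ᶠ p in 𝓝 p₀, ∀ i, A i p = fluxB2 i p) : CommuteDispersionless p₀ A (evals radA) := by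
  obtain ⟨U, hU, oU, pU⟩ := eventually_nhds_iff.1 hA
  refine eventually_nhds_iff.2 ⟨U, fun p hp z hz i => ?_, oU, pU⟩
  subst hz
  have e : ∀ A : Fin 2 → ℝ × ℝ → ℝ, (dispersionless A).flux 0 = baseFlux A := by
    intro A; funext i z; simp [flux, dispersionless, baseFlux]
  have hAe : FluxEq U (baseFlux A) (baseFlux fluxB2) := fun i z hz => hU _ hz i
  have hS : ∀ i, CkOn ∞ U (evals radA i) := fun i => (valid_radA i).ckOn (Or.inl rfl)
  rw [bracket_eq, e, e, br_congr oU hAe (fun _ _ _ => rfl) i hp,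
    br_baseFlux_baseFlux ckOn_fluxB2 hS i hp]
  have h0 : ∀ j, brB fluxB2 (evals radA) i j z.base = 0 := by
    intro j
    obtain ⟨h1, h2, h3, h4⟩ := pd_fluxB2 z.base
    revert i j
    simp only [Fin.forall_fin_two, brB, Fin.sum_univ_two, h1, h2, h3, h4, evals,
      pd_eval_eq (k := ω) (Or.inr rfl) isOpen_univ (valid_radA _) (Set.mem_univ z.base)]
    simp only [radA, Matrix.cons_val_zero, Matrix.cons_val_one, d_add, d_mul, d_c, d_zero_u,
      d_one_u, d_zero_v, d_one_v, eval_add, eval_mul, eval_c, eval_u]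
    refine ⟨⟨?_, ?_⟩, ?_, ?_⟩ <;> ring
  simp only [linFlux, linPoly, h0, zero_mul, Finset.sum_const_zero]

lemma ckOn_normalForm (hk : k = ∞ ∨ k = ω) (hU : IsOpen U) (h : Admissible k U F G H) :
    (∀ i j, CkOn k U ((normalForm F G H).B i j)) ∧
    (∀ i j, CkOn k U ((normalForm F G H).C i j)) ∧
    ∀ i j l, CkOn k U ((normalForm F G H).D i j l) :=
  ⟨fun i j => ((valid_nfB h i j).ckOn hk).congr hU (nfB_eqOn i j),
    fun i j => ((valid_nfC h i j).ckOn hk).congr hU (nfC_eqOn h i j),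
    fun i j l => ((valid_nfD h i j l).ckOn hk).congr hU (nfD_eqOn hk hU h i j l)⟩

/-- Integrability supplies an extension `Y` of the symmetry (u²/2 + v, 0). The same M and γ
transport both systems, and the transported pair still commutes to second order; `exists_normalForm`
then identifies the transported system, and `isBigO_of_transport` the Miura transformation. -/
theorem reducesTo_normalForm (hk : k = ∞ ∨ k = ω) (hp₀ : p₀.1 ≠ 0) {X : ConsSystem}
    (hX : X.NearCk k p₀) (hA : ∀ᶠ p in 𝓝 p₀, ∀ i, X.A i p = fluxB2 i p)
    (hint : X.IntegrableUpToTwo k p₀) :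
    ∃ F G H : ℝ → ℝ, B2Deformation.NearCk k (p₀.1 ^ 2 / 2 + p₀.2) F ∧
      B2Deformation.NearCk k (p₀.1 ^ 2 / 2 + p₀.2) G ∧ B2Deformation.NearCk k p₀.2 H ∧
      ReducesTo k p₀ X (normalForm F G H) := by
  obtain ⟨Y, hY, hYA, hcomm⟩ := hint.2 (evals radA)
    (fun i => .of_forall fun p => (valid_radA (U := Set.univ) i).ckOn hk p trivial)
    (commuteDispersionless_radA hA)
  obtain ⟨M, hM, hMn⟩ := exists_firstNormal hk hp₀ hX.2.1
  have ev := (((((((eventually_all.2 hM).and hMn).and (continuousAt_fst.eventually_ne hp₀)).and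
    (((eventually_all.2 fun i => eventually_all.2 (hX.2.1 i)).and
      (eventually_all.2 fun i => eventually_all.2 (hX.2.2.1 i))).and
      (eventually_all.2 fun i => eventually_all.2 fun j => eventually_all.2 (hX.2.2.2 i j)))).and
    (((eventually_all.2 fun i => eventually_all.2 (hY.2.1 i)).and
      (eventually_all.2 fun i => eventually_all.2 (hY.2.2.1 i))).and
      (eventually_all.2 fun i => eventually_all.2 fun j => eventually_all.2 (hY.2.2.2 i j)))).and
    hA).and hcomm)
  obtain ⟨U, hU, oU, pU⟩ := eventually_nhds_iff.1 ev
  have hM' : ∀ i, CkOn k U (M i) := fun i p hp => (hU p hp).1.1.1.1.1.1 i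
  have hn : FirstNormal U (miuraB M fluxB2 X.B) :=
    ⟨fun p hp => (hU p hp).1.1.1.1.1.2.1, fun p hp => (hU p hp).1.1.1.1.1.2.2⟩
  have hne : ∀ p ∈ U, p.1 ≠ 0 := fun p hp => (hU p hp).1.1.1.1.2
  have hB : ∀ i j, CkOn k U (X.B i j) := fun i j p hp => (hU p hp).1.1.1.2.1.1 i j
  have hC : ∀ i j, CkOn k U (X.C i j) := fun i j p hp => (hU p hp).1.1.1.2.1.2 i j
  have hD : ∀ i j l, CkOn k U (X.D i j l) := fun i j l p hp => (hU p hp).1.1.1.2.2 i j l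
  have hB' : ∀ i j, CkOn k U (Y.B i j) := fun i j p hp => (hU p hp).1.1.2.1.1 i j
  have hC' : ∀ i j, CkOn k U (Y.C i j) := fun i j p hp => (hU p hp).1.1.2.1.2 i j
  have hD' : ∀ i j l, CkOn k U (Y.D i j l) := fun i j l p hp => (hU p hp).1.1.2.2 i j l
  have hXA : ∀ i, Set.EqOn (X.A i) (fluxB2 i) U := fun i p hp => (hU p hp).1.2 i
  have hS : ∀ i, CkOn k U (evals radA i) := fun i => (valid_radA i).ckOn hk
  -- the given system with the fluxes of the `(2,1)` flow
  set Z : ConsSystem := ⟨fluxB2, X.B, X.C, X.D⟩ with hZ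
  have hXZ : ∀ ε, FluxEq U (X.flux ε) (Z.flux ε) := flux_congr hXA (fun _ _ _ _ => rfl)
    (fun _ _ _ _ => rfl) fun _ _ _ _ _ => rfl
  have sZ : Z.SmoothOver U := ⟨ckOn_fluxB2, fun i j => (hB i j).smooth hk,
    fun i j => (hC i j).smooth hk, fun i j l => (hD i j l).smooth hk⟩
  have sY : Y.SmoothOver U := ⟨fun i => by rw [hYA]; exact (hS i).smooth hk,
    fun i j => (hB' i j).smooth hk, fun i j => (hC' i j).smooth hk,
    fun i j l => (hD' i j l).smooth hk⟩
  obtain ⟨c₀, c₁, c₂⟩ := fluxEq_of_isBigO oU sZ sY fun p hp z hz i => by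
    have h := (hU p hp).2 z hz i
    have e : ∀ ε, bracket X Y ε i z = bracket Z Y ε i z := fun ε =>
      bracket_congr oU (hXZ ε) (fun _ _ _ => rfl) i (by subst hz; exact hp)
    simpa only [e] using h
  -- the Miura transformation
  have sM : ∀ i, CkOn ∞ U (M i) := fun i => (hM' i).smooth hk
  have fA : ∀ i, CkOn k U (fluxB2 i) := ckOn_fluxB2
  obtain ⟨γ, hγ, hn₂⟩ := exists_secondNormal hk hne (ckOn_expC hk hM' fA hB hC)
    (ckOn_expD hk hM' fA hB hD)
  have sγ : ∀ i j, CkOn ∞ U (γ i j) := fun i j => (hγ i j).smooth hk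
  have bM := isDiffFlux_baseFlux sM
  have bγ := isDiffFlux_linFlux sγ
  have t₁ := commute_transport₁ oU bM sZ.base sZ.lin sY.base sY.lin c₀ c₁
  have t₂ := commute_transport₂ oU bM bγ sZ.base sZ.lin sZ.quad sY.base sY.lin sY.quad c₀ c₁ c₂
  have hZ₁ := transport₁_eq (B := Z.B) sM sZ.A
  have hY₁ := transport₁_eq (B := Y.B) sM sY.A
  have hZ₂ := transport₂_eq (C := Z.C) (D := Z.D) oU sM sZ.A sZ.B sγ
  have hY₂ := transport₂_eq (C := Y.C) (D := Y.D) oU sM sY.A sY.B sγ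
  have r : ∀ {α : Fin 2 → Jet → ℝ}, FluxEq U α α := fun _ _ _ => rfl
  rw [hYA] at hY₁ hY₂
  obtain ⟨F, G, H, hF, hG, hH, V, hVU, oV, pV, e₁, e₂⟩ := exists_normalForm hk oU pU hne
    (ckOn_miuraB hk hM' fA hB) (ckOn_miuraB hk hM' hS hB')
    (ckOn_shiftC hk fA hγ (ckOn_expC hk hM' fA hB hC))
    (ckOn_shiftC hk hS hγ (ckOn_expC hk hM' hS hB' hC'))
    (ckOn_collect (ckOn_shiftD hk fA hγ (ckOn_expD hk hM' fA hB hD)))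
    (ckOn_collect (ckOn_shiftD hk hS hγ (ckOn_expD hk hM' hS hB' hD')))
    hn hn₂ (fun i p _ => rfl)
    (fun i z hz => by
      rw [evals_fluxA, ← t₁ i hz, hYA]
      simp only [Pi.add_apply]
      rw [br_congr oU r hY₁ i hz, br_congr oU hZ₁ r i hz])
    (fun i z hz => by
      rw [evals_fluxA, ← t₂ i hz, hYA]
      simp only [Pi.add_apply]
      rw [br_congr oU r hY₂ i hz, br_congr oU hZ₁ hY₁ i hz, br_congr oU hZ₂ r i hz])
  -- The exponent γ is turned into the coefficient β of the Miura transformation by adding the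
  -- quadratic term of the flow of M.
  refine ⟨F, G, H, hF, hG, hH, M, fun i j p => γ i j p + 1 / 2 * ∑ l, pd l (M i) p * pd j (M l) p,
    hM, fun i j => ?_, ?_⟩
  · refine eventually_of_mem (oU.mem_nhds pU) fun p hp => ?_
    have t : ∀ l, CkOn k U _ := fun l => ((hM' i).pd_self hk l).mul ((hM' l).pd_self hk j)
    simpa only [Fin.sum_univ_two] using
      ((hγ i j).add ((CkOn.const (1 / 2)).mul ((t 0).add (t 1)))) p hp
  obtain ⟨W, hW, oW, pW⟩ := eventually_nhds_iff.1
    ((eventually_admissible hp₀ hF hG hH).and (oV.eventually_mem pV))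
  have adm : Admissible k W F G H := ⟨fun p hp => (hW p hp).1.1, fun p hp => (hW p hp).1.2.1,
    fun p hp => (hW p hp).1.2.2.1, fun p hp => (hW p hp).1.2.2.2⟩
  have hWV : W ⊆ V := fun p hp => (hW p hp).2
  have hWU := hWV.trans hVU
  obtain ⟨n₁, n₂, n₃⟩ := ckOn_normalForm hk oW adm
  have sβ : ∀ i j, CkOn ∞ W fun p => γ i j p + 1 / 2 * ∑ l, pd l (M i) p * pd j (M l) p := by
    intro i j
    have t : ∀ l, CkOn ∞ W _ := fun l =>
      (((sM i).pd_top l).mul ((sM l).pd_top j)).mono hWU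
    simpa only [Fin.sum_univ_two] using
      ((sγ i j).mono hWU).add ((CkOn.const (1 / 2)).mul ((t 0).add (t 1)))
  refine eventually_of_mem (oW.mem_nhds pW) fun p hp z hz i => ?_
  have hz' : z ∈ jetsOver W := by subst hz; exact hp
  have main := isBigO_of_transport (X := Z) (N := normalForm F G H) oW
    (fun i => (sM i).mono hWU) (fun i j => (sγ i j).mono hWU) sβ
    (linFlux_square γ fun i => (sM i).mono hWU)
    ⟨fun i => (sZ.A i).mono hWU, fun i j => (sZ.B i j).mono hWU, fun i j => (sZ.C i j).mono hWU,
      fun i j l => (sZ.D i j l).mono hWU⟩ rfl rfl (fun i j => (n₁ i j).smooth hk)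
    (fun i j => (n₂ i j).smooth hk) (fun i j l => (n₃ i j l).smooth hk)
    (fun i z hz => (hZ₁.mono hWU i hz).trans (e₁.mono hWV i hz))
    (fun i z hz => (hZ₂.mono hWU i hz).trans (e₂.mono hWV i hz)) hz' i
  refine main.congr_left fun ε => ?_
  have e : evol (X.field ε) (miuraPotential M
      (fun i j p => γ i j p + 1 / 2 * ∑ l, pd l (M i) p * pd j (M l) p) ε i) z = evol (Z.field ε) _ z :=
    der_along_congr oU (hXZ ε) (fun _ _ => rfl) (hWU hz')
  rw [hXZ ε i (hWU hz'), e]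

end B2Deformation

/-! ### The theorem: reduction and converse -/

theorem mainTheorem6 (k : WithTop ℕ∞) (hk : k = ∞ ∨ k = ω) (p₀ : ℝ × ℝ) (hp₀ : p₀.1 ≠ 0) :
    (∀ X : B2Deformation.ConsSystem, X.NearCk k p₀ →
      (∀ᶠ p in 𝓝 p₀, ∀ i, X.A i p = B2Deformation.fluxB2 i p) →
      X.IntegrableUpToTwo k p₀ →
        ∃ F G H : ℝ → ℝ,
          B2Deformation.NearCk k (p₀.1 ^ 2 / 2 + p₀.2) F ∧
          B2Deformation.NearCk k (p₀.1 ^ 2 / 2 + p₀.2) G ∧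
          B2Deformation.NearCk k p₀.2 H ∧
          B2Deformation.ReducesTo k p₀ X (B2Deformation.normalForm F G H)) ∧
    (∀ F G H : ℝ → ℝ,
      B2Deformation.NearCk k (p₀.1 ^ 2 / 2 + p₀.2) F →
      B2Deformation.NearCk k (p₀.1 ^ 2 / 2 + p₀.2) G →
      B2Deformation.NearCk k p₀.2 H →
        (B2Deformation.normalForm F G H).IntegrableUpToTwo k p₀) :=
  ⟨fun _ hX hA hint => B2Deformation.reducesTo_normalForm hk hp₀ hX hA hint,
    fun _ _ _ hF hG hH => B2Deformation.integrable_normalForm hk hp₀ hF hG hH⟩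
end
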